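/- Let $d\ge 2$ and let $p,q\in[1,\infty]$ satisfy $1/p+1/q<2/d$, with $q<\infty$ if $d=2$. Put $$p^*=\frac{p}{p-1},\qquad \rho=\frac{2qd}{q(d-2)+d},\qquad \nu=2-\frac{2p^*}{\rho}$$ (with $p^*=1$ if $p=\infty$, and $\rho=2d/(d-2)$ if $q=\infty$). Then $\nu>1$, and there is a constant $C_1=C_1(d,p,q)>0$, depending only on $d,p,q$, such that the following holds. Let $a:\mathbb R^d\to\mathbb R^{d\times d}$ be a measurable field of symmetric matrices and let $\lambda,\Lambda\ge 0$ be measurable functions on $\mathbb R^d$ such that, for almost every $x$ and all $\xi\in\mathbb R^d$, $\lambda(x)|\xi|^2\le\langle a(x)\xi,\xi\rangle\le\Lambda(x)|\xi|^2$, and such that $\Lambda\in L^p_{loc}(\mathbb R^d)$ and $\lambda^{-1}\in L^q_{loc}(\mathbb R^d)$ (so $\lambda>0$ a.e.). Let $\mathcal E(u,v)=\sum_{i,j}\int_{\mathbb R^d}a_{ij}\,\partial_iu\,\partial_jv\,dx$ and $(u,v)_\Lambda=\int uv\,\Lambda\,dx$. For $G\subset\mathbb R^d$ open let $\mathcal F^\Lambda_G$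 be the closure of $C_0^\infty(G)$ in $L^2(\Lambda dx)$ with respect to $\mathcal E+(\cdot,\cdot)_\Lambda$, put $\mathcal F^\Lambda=\mathcal F^\Lambda_{\mathbb R^d}$, and extend $\mathcal E$ to $\mathcal F^\Lambda$ by closure. For an open interval $I$, a function $u:I\to\mathcal F^\Lambda$ is called subcaloric in $I\times G$ if $t\mapsto(u(t,\cdot),\phi)_\Lambda$ is differentiable on $I$ for every $\phi\in L^2(G,\Lambda dx)$, and $\frac{d}{dt}(u,\phi)_\Lambda+\mathcal E(u,\phi)\le 0$ on $I$ for every nonnegative $\phi\in\mathcal F^\Lambda_G$. Let $\tau>0$, $s\in\mathbb R$, $x\in\mathbb R^d$, $r>0$, $B=B(x,r)$, and for $\delta\in(0,1]$ let $$Q_\delta=(s-\delta\tau r^2,s)\times B(x,\delta r),\qquad Q=Q_1 .$$ Let $1/2\le\sigma'<\sigma\le 1$, and let $u$ be subcaloric in $Q$ and positive there (it is enough that $u(t,\cdot)\ge 0$ a.e. on $B$ for every $t\in(s-\tau r^2,s)$). Then $$\sup_{Q_{\sigma'}}u\;\le\; C_1\,\bigl(C_S^{B,\Lambda}\bigr)^{\frac1{2\nu-2}}\;\tau^{\frac12}\,\Bigl[\frac{1+\tau^{-1}}{(\sigma-\sigma')^2}\Bigr]^{\frac{\nu}{2\nu-2}}\;\|u\|_{2,Q_\sigma,\Lambda},$$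 where $$C_S^{B,\Lambda}=\|\lambda^{-1}\|_{q,B}\,\|\Lambda\|_{p,B}^{2p^*/\rho},\qquad \|f\|_{p,B}=\Bigl(\frac1{|B|}\int_B|f|^p\,dx\Bigr)^{1/p}\ \ (\text{the essential supremum of } |f| \text{ over } B\text{ if }p=\infty),$$ $$\|u\|_{2,Q_\sigma,\Lambda}=\Bigl(\frac1{|Q_\sigma|}\int_{Q_\sigma}|u(t,z)|^2\,\Lambda(z)\,dz\,dt\Bigr)^{1/2}\in[0,\infty],$$ and $\sup_{Q_{\sigma'}}u$ is the supremum over $t\in(s-\sigma'\tau r^2,s)$ of the essential supremum of $u(t,\cdot)$ over $B(x,\sigma' r)$. -/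

import Mathlib

open Set Filter Topology MeasureTheory
open scoped ENNReal ContDiff

noncomputable section

namespace DegenerateParabolic

/-- `ℝ^d` with its Euclidean norm. -/
abbrev Space (d : ℕ) : Type := EuclideanSpace ℝ (Fin d)

/-- The bilinear form `⟨A ξ, η⟩ = ∑ A_ij ξ_i η_j` of a matrix `A`. -/
def pairing {d : ℕ} (A : Matrix (Fin d) (Fin d) ℝ) (ξ η : Space d) : ℝ :=
  ∑ i, ∑ j, A i j * ξ i * η j

/-- The standing assumptions on the coefficients: `a` is a measurable field of symmetric matrices
with `λ |ξ|² ≤ ⟨a ξ, ξ⟩ ≤ Λ |ξ|²`, `Λ ∈ L^p_loc` and `λ⁻¹ ∈ L^q_loc`. Positivity of `λ` almost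
everywhere is what `λ⁻¹ ∈ L^q_loc` means at the zeros of `λ`, where the real inverse would be `0`
instead of `∞`. -/
structure IsCoefficient {d : ℕ} (a : Space d → Matrix (Fin d) (Fin d) ℝ)
    (lam Lam : Space d → ℝ) (p q : ℝ≥0∞) : Prop where
  measurable_entry : ∀ i j, AEMeasurable (fun x => a x i j) volume
  symm : ∀ᵐ x, (a x).IsSymm
  pos : ∀ᵐ x, 0 < lam x
  lower : ∀ᵐ x, ∀ ξ : Space d, lam x * ‖ξ‖ ^ 2 ≤ pairing (a x) ξ ξ
  upper : ∀ᵐ x, ∀ ξ : Space d, pairing (a x) ξ ξ ≤ Lam x * ‖ξ‖ ^ 2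
  memLp_upper : ∀ (x : Space d) (r : ℝ), MemLp Lam p (volume.restrict (Metric.ball x r))
  memLp_lower : ∀ (x : Space d) (r : ℝ),
    MemLp (fun z => (lam z)⁻¹) q (volume.restrict (Metric.ball x r))

/-- The measure `θ dx`. -/
def weightedMeasure {d : ℕ} (θ : Space d → ℝ) : Measure (Space d) :=
  volume.withDensity fun x => ENNReal.ofReal (θ x)

/-- `u` belongs to the closure of `C_0^∞(G)` in `L²(θ dx)` with respect to
`ℰ(u, u) + (u, u)_θ`, and `W` is its gradient: some `φ n ∈ C_0^∞(G)` converge to `u` in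
`L²(θ dx)`, while `∇ (φ n)` converges to `W` in the energy norm `(∫ ⟨a ξ, ξ⟩ dx)^(1/2)`. -/
def HasFormGradient {d : ℕ} (a : Space d → Matrix (Fin d) (Fin d) ℝ) (θ : Space d → ℝ)
    (G : Set (Space d)) (u : Space d → ℝ) (W : Space d → Space d) : Prop :=
  MemLp u 2 (weightedMeasure θ) ∧ AEStronglyMeasurable W volume ∧
  ∃ φ : ℕ → Space d → ℝ,
    (∀ n, ContDiff ℝ ∞ (φ n) ∧ HasCompactSupport (φ n) ∧ tsupport (φ n) ⊆ G) ∧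
    Tendsto (fun n => eLpNorm (fun x => φ n x - u x) 2 (weightedMeasure θ)) atTop (𝓝 0) ∧
    Tendsto (fun n => ∫⁻ x, ENNReal.ofReal
      (pairing (a x) (gradient (φ n) x - W x) (gradient (φ n) x - W x))) atTop (𝓝 0)

/-- The space `ℱ_G^θ`, the closure of `C_0^∞(G)` with respect to `ℰ + (·, ·)_θ`; its elements are
functions on `ℝ^d` that vanish almost everywhere outside `G`. For `G = ℝ^d` it is `ℱ^θ`. -/
def MemForm {d : ℕ} (a : Space d → Matrix (Fin d) (Fin d) ℝ) (θ : Space d → ℝ)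
    (G : Set (Space d)) (u : Space d → ℝ) : Prop :=
  ∃ W, HasFormGradient a θ G u W

open Classical in
/-- The gradient of an element of `ℱ^θ`. It is unique up to null sets, since the form is closable
(`λ⁻¹` and `θ⁻¹` being locally integrable). -/
def formGradient {d : ℕ} (a : Space d → Matrix (Fin d) (Fin d) ℝ) (θ : Space d → ℝ)
    (u : Space d → ℝ) : Space d → Space d :=
  if h : MemForm a θ univ u then h.choose else 0

/-- The Dirichlet form `ℰ(u, v) = ∑ ∫ a_ij ∂_i u ∂_j v dx` on `ℱ^θ`. -/
def dirichletForm {d : ℕ} (a : Space d → Matrix (Fin d) (Fin d) ℝ) (θ : Space d → ℝ)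
    (u v : Space d → ℝ) : ℝ :=
  ∫ x, pairing (a x) (formGradient a θ u x) (formGradient a θ v x)

/-- `u : I → ℱ^θ` is subcaloric in `I × G`, for `I` and `G` open: `t ↦ (u t, φ)_θ` is
differentiable on `I` for all `φ ∈ L²(G, θ dx)`, and `d/dt (u, φ)_θ + ℰ(u, φ) ≤ 0` on `I` for all
nonnegative `φ ∈ ℱ_G^θ`. -/
structure IsSubcaloric {d : ℕ} (a : Space d → Matrix (Fin d) (Fin d) ℝ) (θ : Space d → ℝ)
    (I : Set ℝ) (G : Set (Space d)) (u : ℝ → Space d → ℝ) : Prop where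
  memForm : ∀ t ∈ I, MemForm a θ univ (u t)
  differentiableAt : ∀ φ : Space d → ℝ, MemLp φ 2 ((weightedMeasure θ).restrict G) →
    ∀ t ∈ I, DifferentiableAt ℝ (fun t' => ∫ x in G, u t' x * φ x ∂(weightedMeasure θ)) t
  deriv_add_le : ∀ φ : Space d → ℝ, MemForm a θ G φ → (∀ᵐ x, 0 ≤ φ x) → ∀ t ∈ I,
    deriv (fun t' => ∫ x in G, u t' x * φ x ∂(weightedMeasure θ)) t
      + dirichletForm a θ (u t) φ ≤ 0

/-- The averaged norm `‖f‖_{p,B} = (|B|⁻¹ ∫_B |f|^p dx)^(1/p)`, the essential supremum of `|f|`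
over `B` if `p = ∞`. -/
def avgNorm {d : ℕ} (f : Space d → ℝ) (p : ℝ≥0∞) (B : Set (Space d)) : ℝ≥0∞ :=
  eLpNorm f p ((volume B)⁻¹ • volume.restrict B)

/-- The averaged norm `‖u‖_{2,I×B,Λ} = (|I × B|⁻¹ ∫_I ∫_B |u(t,z)|² Λ(z) dz dt)^(1/2)`. -/
def avgNormTwo {d : ℕ} (Lam : Space d → ℝ) (I : Set ℝ) (B : Set (Space d))
    (u : ℝ → Space d → ℝ) : ℝ≥0∞ :=
  ((volume I * volume B)⁻¹ *
    ∫⁻ t in I, ∫⁻ z in B, ENNReal.ofReal (u t z ^ 2 * Lam z)) ^ (1 / 2 : ℝ)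

/-- The supremum over `I × B` of `u`, for a family `u t` of functions that are determined up to
null sets of `ℝ^d`. It is meant for nonnegative `u`. -/
def cylinderSup {d : ℕ} (I : Set ℝ) (B : Set (Space d)) (u : ℝ → Space d → ℝ) : ℝ≥0∞ :=
  ⨆ t ∈ I, essSup (fun z => ENNReal.ofReal (u t z)) (volume.restrict B)

/-- The conjugate exponent `p* = p / (p - 1)`, equal to `1` if `p = ∞`. -/
def conjExp (p : ℝ≥0∞) : ℝ := (ENNReal.conjExponent p).toReal

/-- The exponent `ρ = 2qd / (q(d-2) + d) = 2d / ((d-2) + d/q)`, written with `1/q` so that `q = ∞`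
is allowed (for `d ≥ 3`). -/
def rho (d : ℕ) (q : ℝ≥0∞) : ℝ := 2 * d / ((d - 2) + d * (q⁻¹).toReal)

/-- The exponent `ν = 2 - 2p*/ρ`. -/
def nu (d : ℕ) (p q : ℝ≥0∞) : ℝ := 2 - 2 * conjExp p / rho d q

/-- The Sobolev constant `C_S^{B,Λ} = ‖λ⁻¹‖_{q,B} ‖Λ‖_{p,B}^{2p*/ρ}`. -/
def sobolevConst {d : ℕ} (lam Lam : Space d → ℝ) (p q : ℝ≥0∞) (B : Set (Space d)) : ℝ≥0∞ :=
  avgNorm (fun z => (lam z)⁻¹) q B * avgNorm Lam p B ^ (2 * conjExp p / rho d q)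

end DegenerateParabolic

end

/-! The proof is De Giorgi's iteration over the levels of `u`. For a level `κ ≥ 0` and a spatial
cutoff `η`, testing with `2 η² (u - κ)_+` gives at each time the bound `energy(η (u - κ)_+) ≤ -2
d/dt ∫ η² (u - κ)_+² Λ + 10 sup|∇η|² ∫ (u - κ)_+² Λ` (`IsSubcaloric.energy_le`). Integrating from a
well-chosen initial time controls, on a smaller cylinder, both the supremum in time of `∫ (u - κ)_+²
Λ` and the space-time energy by the space-time integral of `(u - κ)_+² Λ` on a larger one
(`exists_caccioppoli`).

The gain comes from `exists_interpolation`. Hölder with `λ⁻¹ ∈ L^q` bounds `∇w` in `L^s`, `1/s = 1/2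
+ 1/(2q)`, by the energy; Sobolev puts `w` in `L^ρ`; Hölder with `Λ ∈ L^p` puts `w` in `L^r(Λ dx)`
with `r = ρ/p*`. The condition `1/p + 1/q < 2/d` says exactly that `r > 2`, that is `ν > 1`, so
`‖w‖²` in `L²(Λ dx)` is at most a constant times the energy times `Λ({w ≠ 0})^(ν - 1)`. By Chebyshev
the level set is small when the integral at a lower level is small. Along the levels `k (1 - 2⁻ⁿ)`
this yields a superlinear recursion (`exists_deGiorgi_step`), which forces `(u - k)_+ = 0` on the
final cylinder once `k` is a suitable multiple of the `L²` norm (`exists_deGiorgi`). In the final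
constant all powers of `r` cancel (`constant_eq`).

Two points need care. The test function must lie in the form domain with the expected gradient: this
follows from the chain rule for smooth functions, closedness of the gradient
(`HasFormGradient.of_tendsto`) and closability (`HasFormGradient.ae_eq`). And `u` is only weakly
differentiable in time: Banach–Steinhaus makes it pointwise Lipschitz into `L²(Λ dx)`, which
suffices to differentiate `∫ χ (u - κ)_+² Λ` and makes it continuous, so the bound holds at every
time. -/

namespace DegenerateParabolic

/-! ### Quadratic form, weighted measure and energy. -/

section Pairing

variable {d : ℕ} (A : Matrix (Fin d) (Fin d) ℝ)

lemma pairing_add_left (ξ η ζ : Space d) :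
    pairing A (ξ + η) ζ = pairing A ξ ζ + pairing A η ζ := by
  simp [pairing, mul_add, add_mul, Finset.sum_add_distrib]

lemma pairing_add_right (ξ η ζ : Space d) :
    pairing A ζ (ξ + η) = pairing A ζ ξ + pairing A ζ η := by
  simp [pairing, mul_add, Finset.sum_add_distrib]

lemma pairing_smul_left (c : ℝ) (ξ ζ : Space d) : pairing A (c • ξ) ζ = c * pairing A ξ ζ := by
  simp only [pairing, Finset.mul_sum, PiLp.smul_apply, smul_eq_mul]
  exact Finset.sum_congr rfl fun i _ => Finset.sum_congr rfl fun j _ => by ring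

lemma pairing_smul_right (c : ℝ) (ξ ζ : Space d) : pairing A ζ (c • ξ) = c * pairing A ζ ξ := by
  simp only [pairing, Finset.mul_sum, PiLp.smul_apply, smul_eq_mul]
  exact Finset.sum_congr rfl fun i _ => Finset.sum_congr rfl fun j _ => by ring

lemma pairing_zero_left (ζ : Space d) : pairing A 0 ζ = 0 := by simp [pairing]

lemma pairing_comm {A : Matrix (Fin d) (Fin d) ℝ} (hA : A.IsSymm) (ξ η : Space d) :
    pairing A ξ η = pairing A η ξ := by
  simp only [pairing]
  rw [Finset.sum_comm]
  exact Finset.sum_congr rfl fun i _ => Finset.sum_congr rfl fun j _ => by rw [hA.apply]; ring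

variable {A}

lemma two_mul_abs_pairing_le (hA : A.IsSymm) (hpos : ∀ ξ, 0 ≤ pairing A ξ ξ) (ξ η : Space d) :
    2 * |pairing A ξ η| ≤ pairing A ξ ξ + pairing A η η := by
  have h1 := hpos (ξ + η)
  have h2 := hpos (ξ + (-1 : ℝ) • η)
  simp only [pairing_add_left, pairing_add_right, pairing_smul_left, pairing_smul_right,
    pairing_comm hA η ξ] at h1 h2
  rcases abs_cases (pairing A ξ η) with h | h <;> linarith

lemma pairing_add_self_le (hA : A.IsSymm) (hpos : ∀ ξ, 0 ≤ pairing A ξ ξ) (ξ η : Space d) :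
    pairing A (ξ + η) (ξ + η) ≤ 2 * pairing A ξ ξ + 2 * pairing A η η := by
  have h1 := two_mul_abs_pairing_le hA hpos ξ η
  simp only [pairing_add_left, pairing_add_right, pairing_comm hA η ξ]
  linarith [le_abs_self (pairing A ξ η)]

end Pairing

/-- The energy `∫ ⟨a W, W⟩ dx` of a vector field. -/
noncomputable def energy {d : ℕ} (a : Space d → Matrix (Fin d) (Fin d) ℝ) (W : Space d → Space d) :
    ℝ≥0∞ :=
  ∫⁻ x, ENNReal.ofReal (pairing (a x) (W x) (W x))

lemma aemeasurable_of_forall_ball {d : ℕ} {f : Space d → ℝ}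
    (h : ∀ r : ℝ, AEMeasurable f (volume.restrict (Metric.ball 0 r))) : AEMeasurable f := by
  have : AEMeasurable f (volume.restrict (⋃ n : ℕ, Metric.ball (0 : Space d) n)) :=
    aemeasurable_iUnion_iff.2 fun n => h n
  rwa [Metric.iUnion_ball_nat, Measure.restrict_univ] at this

lemma weightedMeasure_ac {d : ℕ} (Lam : Space d → ℝ) : weightedMeasure Lam ≪ volume :=
  withDensity_absolutelyContinuous _ _

namespace IsCoefficient

variable {d : ℕ} {a : Space d → Matrix (Fin d) (Fin d) ℝ} {lam Lam : Space d → ℝ} {p q : ℝ≥0∞}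

lemma aemeasurable_upper (h : IsCoefficient a lam Lam p q) : AEMeasurable Lam :=
  aemeasurable_of_forall_ball fun r => (h.memLp_upper 0 r).aestronglyMeasurable.aemeasurable

lemma aemeasurable_lower_inv (h : IsCoefficient a lam Lam p q) :
    AEMeasurable (fun x => (lam x)⁻¹) :=
  aemeasurable_of_forall_ball fun r => (h.memLp_lower 0 r).aestronglyMeasurable.aemeasurable

lemma aemeasurable_lower (h : IsCoefficient a lam Lam p q) : AEMeasurable lam := by
  simpa only [Pi.inv_def, inv_inv] using h.aemeasurable_lower_inv.inv

lemma nonneg (h : IsCoefficient a lam Lam p q) : ∀ᵐ x, ∀ ξ, 0 ≤ pairing (a x) ξ ξ := by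
  filter_upwards [h.pos, h.lower] with x hx hl ξ
  exact le_trans (by positivity) (hl ξ)

lemma lower_le_upper (h : IsCoefficient a lam Lam p q) (hd : 0 < d) : ∀ᵐ x, lam x ≤ Lam x := by
  filter_upwards [h.lower, h.upper] with x hl hu
  have := (hl (EuclideanSpace.single ⟨0, hd⟩ 1)).trans (hu _)
  simpa using this

lemma upper_pos (h : IsCoefficient a lam Lam p q) (hd : 0 < d) : ∀ᵐ x, 0 < Lam x := by
  filter_upwards [h.pos, h.lower_le_upper hd] with x h1 h2 using h1.trans_le h2

lemma aemeasurable_pairing (h : IsCoefficient a lam Lam p q) {V W : Space d → Space d}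
    (hV : AEMeasurable V) (hW : AEMeasurable W) :
    AEMeasurable (fun x => pairing (a x) (V x) (W x)) := by
  unfold pairing
  refine Finset.aemeasurable_fun_sum _ fun i _ => Finset.aemeasurable_fun_sum _ fun j _ => ?_
  have hc (i : Fin d) {V : Space d → Space d} (hV : AEMeasurable V) :
      AEMeasurable (fun x => V x i) :=
    (EuclideanSpace.proj (𝕜 := ℝ) i).continuous.measurable.comp_aemeasurable hV
  exact ((h.measurable_entry i j).mul (hc i hV)).mul (hc j hW)

/-- Since `0 < λ ≤ Λ` almost everywhere, `Λ dx` and `dx` have the same null sets. -/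
lemma ae_weightedMeasure_iff (h : IsCoefficient a lam Lam p q) (hd : 0 < d) {P : Space d → Prop} :
    (∀ᵐ x ∂(weightedMeasure Lam), P x) ↔ ∀ᵐ x, P x := by
  rw [weightedMeasure, ae_withDensity_iff' h.aemeasurable_upper.ennreal_ofReal]
  refine ⟨fun H => ?_, fun H => H.mono fun x hx _ => hx⟩
  filter_upwards [H, h.upper_pos hd] with x hx h1
  exact hx (by simpa using h1)

lemma volume_ac (h : IsCoefficient a lam Lam p q) (hd : 0 < d) :
    volume ≪ weightedMeasure Lam :=
  fun s hs => by
    have : ∀ᵐ x ∂(weightedMeasure Lam), x ∉ s := by simpa [ae_iff] using hs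
    simpa [ae_iff] using (h.ae_weightedMeasure_iff hd).1 this

lemma lintegral_weightedMeasure (h : IsCoefficient a lam Lam p q) {f : Space d → ℝ≥0∞}
    (hf : AEMeasurable f) :
    ∫⁻ x, f x ∂(weightedMeasure Lam) = ∫⁻ x, ENNReal.ofReal (Lam x) * f x := by
  rw [weightedMeasure, lintegral_withDensity_eq_lintegral_mul₀ h.aemeasurable_upper.ennreal_ofReal hf]
  rfl

lemma setLIntegral_weightedMeasure (h : IsCoefficient a lam Lam p q) {f : Space d → ℝ≥0∞}
    (hf : AEMeasurable f) {s : Set (Space d)} (hs : MeasurableSet s) :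
    ∫⁻ x in s, f x ∂(weightedMeasure Lam) = ∫⁻ x in s, ENNReal.ofReal (Lam x) * f x := by
  rw [weightedMeasure, restrict_withDensity hs, lintegral_withDensity_eq_lintegral_mul₀
    h.aemeasurable_upper.ennreal_ofReal.restrict hf.restrict]
  rfl

lemma integrableOn_upper (h : IsCoefficient a lam Lam p q) (hp : 1 ≤ p) (x : Space d) (r : ℝ) :
    IntegrableOn Lam (Metric.ball x r) :=
  have : IsFiniteMeasure (volume.restrict (Metric.ball x r)) :=
    isFiniteMeasure_restrict.2 measure_ball_lt_top.ne
  (h.memLp_upper x r).integrable hp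

lemma integrableOn_lower_inv (h : IsCoefficient a lam Lam p q) (hq : 1 ≤ q) (x : Space d)
    (r : ℝ) : IntegrableOn (fun z => (lam z)⁻¹) (Metric.ball x r) :=
  have : IsFiniteMeasure (volume.restrict (Metric.ball x r)) :=
    isFiniteMeasure_restrict.2 measure_ball_lt_top.ne
  (h.memLp_lower x r).integrable hq

lemma weightedMeasure_ball_lt_top (h : IsCoefficient a lam Lam p q) (hp : 1 ≤ p) (x : Space d)
    (r : ℝ) : weightedMeasure Lam (Metric.ball x r) < ⊤ := by
  rw [weightedMeasure, withDensity_apply _ measurableSet_ball]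
  exact (h.integrableOn_upper hp x r).lintegral_lt_top

lemma isLocallyFiniteMeasure (h : IsCoefficient a lam Lam p q) (hp : 1 ≤ p) :
    IsLocallyFiniteMeasure (weightedMeasure Lam) :=
  ⟨fun x => ⟨Metric.ball x 1, Metric.ball_mem_nhds x one_pos,
    h.weightedMeasure_ball_lt_top hp x 1⟩⟩

lemma energy_add_le (h : IsCoefficient a lam Lam p q) {V W : Space d → Space d}
    (hV : AEMeasurable V) (hW : AEMeasurable W) :
    energy a (fun x => V x + W x) ≤ 2 * energy a V + 2 * energy a W := by
  unfold energy
  rw [← lintegral_const_mul'' _ (h.aemeasurable_pairing hV hV).ennreal_ofReal,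
    ← lintegral_const_mul'' _ (h.aemeasurable_pairing hW hW).ennreal_ofReal,
    ← lintegral_add_left' ((h.aemeasurable_pairing hV hV).ennreal_ofReal.const_mul _)]
  refine lintegral_mono_ae ?_
  filter_upwards [h.symm, h.nonneg] with x hs hn
  calc _ ≤ ENNReal.ofReal (2 * pairing (a x) (V x) (V x) + 2 * pairing (a x) (W x) (W x)) :=
        ENNReal.ofReal_le_ofReal (pairing_add_self_le hs hn _ _)
    _ = _ := by
        rw [ENNReal.ofReal_add (by linarith [hn (V x)]) (by linarith [hn (W x)]),
          ENNReal.ofReal_mul (by norm_num), ENNReal.ofReal_mul (by norm_num)]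
        simp

end IsCoefficient

lemma energy_neg {d : ℕ} (a : Space d → Matrix (Fin d) (Fin d) ℝ) (W : Space d → Space d) :
    energy a (fun x => -W x) = energy a W := by
  unfold energy
  congr with x
  simp only [← neg_one_smul ℝ (W x), pairing_smul_left, pairing_smul_right]
  simp

/-- A bounded multiplier does not increase the energy by more than the square of its bound. -/
lemma energy_smul_le {d : ℕ} (a : Space d → Matrix (Fin d) (Fin d) ℝ) {c : Space d → ℝ} {M : ℝ}
    (hc : ∀ x, |c x| ≤ M) (W : Space d → Space d) :
    energy a (fun x => c x • W x) ≤ ENNReal.ofReal (M ^ 2) * energy a W := by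
  unfold energy
  rw [← lintegral_const_mul' _ _ ENNReal.ofReal_ne_top]
  refine lintegral_mono fun x => ?_
  rw [pairing_smul_left, pairing_smul_right, ← mul_assoc, ENNReal.ofReal_mul (mul_self_nonneg _)]
  gcongr
  rw [← abs_mul_abs_self, sq]
  exact mul_self_le_mul_self (abs_nonneg _) (hc x)

end DegenerateParabolic

/-! ### Convergence in energy and closedness of the form gradient. -/

namespace DegenerateParabolic

section Gradient

variable {d : ℕ} {φ : Space d → ℝ}

lemma gradient_eq_comp (φ : Space d → ℝ) :
    gradient φ = fun x => (InnerProductSpace.toDual ℝ (Space d)).symm (fderiv ℝ φ x) := rfl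

lemma norm_gradient (φ : Space d → ℝ) (x : Space d) : ‖gradient φ x‖ = ‖fderiv ℝ φ x‖ := by
  simp [gradient]

lemma continuous_gradient (hφ : ContDiff ℝ ∞ φ) : Continuous (gradient φ) := by
  rw [gradient_eq_comp]
  exact (LinearIsometryEquiv.continuous _).comp (hφ.continuous_fderiv (by simp))

lemma hasCompactSupport_gradient (hφ : HasCompactSupport φ) : HasCompactSupport (gradient φ) := by
  rw [gradient_eq_comp]
  exact (hφ.fderiv (𝕜 := ℝ)).comp_left (map_zero (InnerProductSpace.toDual ℝ (Space d)).symm)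

lemma gradient_mul_comp {χ : Space d → ℝ} {f : ℝ → ℝ} {x : Space d}
    (hχ : DifferentiableAt ℝ χ x) (hφ : DifferentiableAt ℝ φ x)
    (hf : DifferentiableAt ℝ f (φ x)) :
    gradient (fun x => χ x * f (φ x)) x =
      (χ x * deriv f (φ x)) • gradient φ x + f (φ x) • gradient χ x := by
  have h1 : HasFDerivAt (fun x => f (φ x)) (deriv f (φ x) • fderiv ℝ φ x) x :=
    hf.hasDerivAt.comp_hasFDerivAt x hφ.hasFDerivAt
  rw [gradient, (hχ.hasFDerivAt.fun_mul h1).fderiv, map_add, smul_smul, map_smul, map_smul]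
  rfl

lemma gradient_sub {ψ : Space d → ℝ} {x : Space d} (hφ : DifferentiableAt ℝ φ x)
    (hψ : DifferentiableAt ℝ ψ x) :
    gradient (fun x => φ x - ψ x) x = gradient φ x - gradient ψ x := by
  rw [gradient, fderiv_fun_sub hφ hψ, map_sub]
  rfl

end Gradient

lemma eLpNorm_two_sq {α E : Type*} {m : MeasurableSpace α} [NormedAddCommGroup E] (μ : Measure α)
    (f : α → E) : eLpNorm f 2 μ ^ 2 = ∫⁻ x, ‖f x‖ₑ ^ 2 ∂μ := by
  have := eLpNorm_nnreal_pow_eq_lintegral (f := f) (μ := μ) (p := 2) (by norm_num)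
  simpa using this

variable {d : ℕ} {a : Space d → Matrix (Fin d) (Fin d) ℝ} {lam Lam : Space d → ℝ} {p q : ℝ≥0∞}

namespace IsCoefficient

lemma energy_le_eLpNorm_sq (h : IsCoefficient a lam Lam p q) {W : Space d → Space d}
    (hW : AEStronglyMeasurable W) : energy a W ≤ eLpNorm W 2 (weightedMeasure Lam) ^ 2 := by
  rw [eLpNorm_two_sq, h.lintegral_weightedMeasure (hW.enorm.pow_const 2)]
  refine lintegral_mono_ae ?_
  filter_upwards [h.upper] with x hx
  refine (ENNReal.ofReal_le_ofReal (hx (W x))).trans ?_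
  rw [ENNReal.ofReal_mul' (by positivity), ENNReal.ofReal_pow (norm_nonneg _), ofReal_norm]

lemma energy_gradient_lt_top (h : IsCoefficient a lam Lam p q) (hp : 1 ≤ p) {φ : Space d → ℝ}
    (hφ : ContDiff ℝ ∞ φ) (hc : HasCompactSupport φ) : energy a (gradient φ) < ⊤ := by
  have := h.isLocallyFiniteMeasure hp
  have hm : MemLp (gradient φ) 2 (weightedMeasure Lam) :=
    (continuous_gradient hφ).memLp_of_hasCompactSupport (hasCompactSupport_gradient hc)
  exact (h.energy_le_eLpNorm_sq (continuous_gradient hφ).aestronglyMeasurable).trans_lt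
    (ENNReal.pow_lt_top hm.2)

lemma tendsto_energy_add (h : IsCoefficient a lam Lam p q) {V W : ℕ → Space d → Space d}
    (hV : ∀ n, AEMeasurable (V n)) (hW : ∀ n, AEMeasurable (W n))
    (hV0 : Tendsto (fun n => energy a (V n)) atTop (𝓝 0))
    (hW0 : Tendsto (fun n => energy a (W n)) atTop (𝓝 0)) :
    Tendsto (fun n => energy a (fun x => V n x + W n x)) atTop (𝓝 0) := by
  have : Tendsto (fun n => 2 * energy a (V n) + 2 * energy a (W n)) atTop (𝓝 (2 * 0 + 2 * 0)) :=
    (ENNReal.Tendsto.const_mul hV0 (by simp)).add (ENNReal.Tendsto.const_mul hW0 (by simp))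
  simp only [mul_zero, add_zero] at this
  exact tendsto_of_tendsto_of_tendsto_of_le_of_le tendsto_const_nhds this (fun _ => zero_le)
    fun n => h.energy_add_le (hV n) (hW n)

/-- Dominated convergence for the energy. -/
lemma tendsto_energy_smul (h : IsCoefficient a lam Lam p q) {W : Space d → Space d}
    (hW : AEMeasurable W) (hfin : energy a W ≠ ⊤) {c : ℕ → Space d → ℝ}
    (hcm : ∀ n, AEMeasurable (c n)) {M : ℝ} (hc : ∀ n x, |c n x| ≤ M)
    (hc0 : ∀ᵐ x, Tendsto (fun n => c n x) atTop (𝓝 0)) :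
    Tendsto (fun n => energy a (fun x => c n x • W x)) atTop (𝓝 0) := by
  have key : Tendsto (fun n => energy a (fun x => c n x • W x)) atTop
      (𝓝 (∫⁻ _ : Space d, 0)) := by
    refine tendsto_lintegral_of_dominated_convergence'
      (fun x => ENNReal.ofReal (M ^ 2) * ENNReal.ofReal (pairing (a x) (W x) (W x)))
      (fun n => (h.aemeasurable_pairing ((hcm n).smul hW) ((hcm n).smul hW)).ennreal_ofReal)
      (fun n => .of_forall fun x => ?_) ?_ ?_
    · dsimp only
      rw [pairing_smul_left, pairing_smul_right, ← mul_assoc,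
        ENNReal.ofReal_mul (mul_self_nonneg _)]
      gcongr
      rw [← abs_mul_abs_self, sq]
      exact mul_self_le_mul_self (abs_nonneg _) (hc n x)
    · rw [lintegral_const_mul' _ _ ENNReal.ofReal_ne_top]
      exact ENNReal.mul_ne_top ENNReal.ofReal_ne_top hfin
    · filter_upwards [hc0] with x hx
      have : Tendsto (fun n => c n x * (c n x * pairing (a x) (W x) (W x))) atTop
          (𝓝 (0 * (0 * pairing (a x) (W x) (W x)))) := hx.mul (hx.mul_const _)
      simp only [pairing_smul_left, pairing_smul_right]
      simpa using ENNReal.tendsto_ofReal this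
  simpa using key

end IsCoefficient

namespace HasFormGradient

variable {G : Set (Space d)} {u : Space d → ℝ} {W : Space d → Space d}

lemma mono {G' : Set (Space d)} (hG : G ⊆ G') (hu : HasFormGradient a Lam G u W) :
    HasFormGradient a Lam G' u W := by
  obtain ⟨h1, h2, φ, h3, h4⟩ := hu
  exact ⟨h1, h2, φ, fun n => ⟨(h3 n).1, (h3 n).2.1, (h3 n).2.2.trans hG⟩, h4⟩

/-- `W` differs by a field of energy below `1` from the gradient of a test function, whose energy is
finite because `Λ` is locally integrable. -/
lemma energy_lt_top (h : IsCoefficient a lam Lam p q) (hp : 1 ≤ p)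
    (hu : HasFormGradient a Lam G u W) : energy a W < ⊤ := by
  obtain ⟨h1, h2, φ, h3, h4, h5⟩ := hu
  obtain ⟨n, hn⟩ := (h5.eventually_lt_const (u := 1) one_pos).exists
  have hm := (continuous_gradient (h3 n).1).aestronglyMeasurable (μ := volume)
  have := h.energy_add_le hm.aemeasurable (hm.sub h2).aemeasurable.neg
  have e : (fun x => gradient (φ n) x + (-(gradient (φ n) - W)) x) = W := by
    ext1 x; simp
  rw [e] at this
  refine this.trans_lt (ENNReal.add_lt_top.2 ⟨ENNReal.mul_lt_top (by simp)
    (h.energy_gradient_lt_top hp (h3 n).1 (h3 n).2.1), ENNReal.mul_lt_top (by simp) ?_⟩)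
  exact (energy_neg a (gradient (φ n) - W)).trans_lt (hn.trans ENNReal.one_lt_top)

/-- The approximating sequence may be chosen to converge almost everywhere. -/
lemma exists_ae_tendsto (h : IsCoefficient a lam Lam p q) (hd : 0 < d)
    (hu : HasFormGradient a Lam G u W) : ∃ φ : ℕ → Space d → ℝ,
    (∀ n, ContDiff ℝ ∞ (φ n) ∧ HasCompactSupport (φ n) ∧ tsupport (φ n) ⊆ G) ∧
    Tendsto (fun n => eLpNorm (fun x => φ n x - u x) 2 (weightedMeasure Lam)) atTop (𝓝 0) ∧
    Tendsto (fun n => energy a (fun x => gradient (φ n) x - W x)) atTop (𝓝 0) ∧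
    ∀ᵐ x, Tendsto (fun n => φ n x) atTop (𝓝 (u x)) := by
  obtain ⟨h1, h2, φ, h3, h4, h5⟩ := hu
  have hm : TendstoInMeasure (weightedMeasure Lam) φ atTop u :=
    tendstoInMeasure_of_tendsto_eLpNorm (p := 2) (by simp)
      (fun n => (h3 n).1.continuous.aestronglyMeasurable) h1.1 h4
  obtain ⟨ns, hns, hae⟩ := hm.exists_seq_tendsto_ae
  exact ⟨fun n => φ (ns n), fun n => h3 _, h4.comp hns.tendsto_atTop, h5.comp hns.tendsto_atTop,
    (h.ae_weightedMeasure_iff hd).1 hae⟩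

/-- The graph of the form gradient is closed. -/
lemma of_tendsto (h : IsCoefficient a lam Lam p q) {v : ℕ → Space d → ℝ}
    {V : ℕ → Space d → Space d} (hv : ∀ n, HasFormGradient a Lam G (v n) (V n))
    (hu : MemLp u 2 (weightedMeasure Lam)) (hW : AEStronglyMeasurable W)
    (hvu : Tendsto (fun n => eLpNorm (fun x => v n x - u x) 2 (weightedMeasure Lam)) atTop (𝓝 0))
    (hVW : Tendsto (fun n => energy a (fun x => V n x - W x)) atTop (𝓝 0)) :
    HasFormGradient a Lam G u W := by
  -- Diagonal choice: a test function within `1/(n+1)` of the pair `(v n, V n)`.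
  have key (n : ℕ) : ∃ φ : Space d → ℝ,
      (ContDiff ℝ ∞ φ ∧ HasCompactSupport φ ∧ tsupport φ ⊆ G) ∧
      eLpNorm (fun x => φ x - v n x) 2 (weightedMeasure Lam) < ((n : ℝ≥0∞) + 1)⁻¹ ∧
      energy a (fun x => gradient φ x - V n x) < ((n : ℝ≥0∞) + 1)⁻¹ := by
    obtain ⟨h1, h2, φ, h3, h4, h5⟩ := hv n
    have hpos : (0 : ℝ≥0∞) < ((n : ℝ≥0∞) + 1)⁻¹ := ENNReal.inv_pos.2 (by finiteness)
    obtain ⟨m, hm⟩ := ((h4.eventually_lt_const hpos).and (h5.eventually_lt_const hpos)).exists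
    exact ⟨φ m, h3 m, hm⟩
  choose φ h1 h2 h3 using key
  have hlim : Tendsto (fun n : ℕ => ((n : ℝ≥0∞) + 1)⁻¹) atTop (𝓝 0) := by
    have := (tendsto_add_atTop_iff_nat 1).2 ENNReal.tendsto_inv_nat_nhds_zero
    simpa using this
  have hcont (n : ℕ) := (continuous_gradient (h1 n).1).aestronglyMeasurable (μ := volume)
  refine ⟨hu, hW, φ, h1, ?_, ?_⟩
  · have := hlim.add hvu
    rw [add_zero] at this
    refine tendsto_of_tendsto_of_tendsto_of_le_of_le tendsto_const_nhds this (fun _ => zero_le)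
      fun n => ?_
    have e : (fun x => φ n x - u x) = (fun x => φ n x - v n x) + fun x => v n x - u x := by
      ext x; simp
    dsimp only
    rw [e]
    refine (eLpNorm_add_le ?_ ((hv n).1.1.sub hu.1) (by simp)).trans (add_le_add (h2 n).le le_rfl)
    exact (h1 n).1.continuous.aestronglyMeasurable.sub (hv n).1.1
  · have := h.tendsto_energy_add (V := fun n x => gradient (φ n) x - V n x)
      (W := fun n x => V n x - W x) (fun n => ((hcont n).sub (hv n).2.1).aemeasurable)
      (fun n => ((hv n).2.1.sub hW).aemeasurable)
      (tendsto_of_tendsto_of_tendsto_of_le_of_le tendsto_const_nhds hlim (fun _ => zero_le)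
        fun n => (h3 n).le) hVW
    simpa [energy] using this

end HasFormGradient

end DegenerateParabolic

/-! ### Chain rule and truncation in the form domain. -/

namespace DegenerateParabolic

section Ramp

/-- A smooth nondecreasing approximation of the positive part `x ↦ max x 0`. -/
noncomputable def smoothRamp (n : ℕ) (x : ℝ) : ℝ :=
  ∫ t in (0 : ℝ)..x, Real.smoothTransition (n * t)

lemma continuous_smoothTransition_mul (n : ℕ) :
    Continuous fun t : ℝ => Real.smoothTransition (n * t) :=
  Real.smoothTransition.continuous.comp (continuous_const.mul continuous_id)

lemma hasDerivAt_smoothRamp (n : ℕ) (x : ℝ) :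
    HasDerivAt (smoothRamp n) (Real.smoothTransition (n * x)) x :=
  (continuous_smoothTransition_mul n).integral_hasStrictDerivAt 0 x |>.hasDerivAt

lemma contDiff_smoothRamp (n : ℕ) : ContDiff ℝ ∞ (smoothRamp n) := by
  rw [contDiff_infty_iff_deriv]
  refine ⟨fun x => (hasDerivAt_smoothRamp n x).differentiableAt, ?_⟩
  rw [funext fun x => (hasDerivAt_smoothRamp n x).deriv]
  exact Real.smoothTransition.contDiff.comp (contDiff_const.mul contDiff_id)

lemma smoothRamp_of_nonpos (n : ℕ) {x : ℝ} (hx : x ≤ 0) : smoothRamp n x = 0 := by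
  rw [smoothRamp, intervalIntegral.integral_symm, intervalIntegral.integral_of_le hx, neg_eq_zero]
  refine integral_eq_zero_of_ae ?_
  filter_upwards [ae_restrict_mem measurableSet_Ioc] with t ht
  exact Real.smoothTransition.zero_of_nonpos (mul_nonpos_of_nonneg_of_nonpos n.cast_nonneg ht.2)

/-- Every approximating derivative vanishes at `0`, so the limit is the indicator of the strict
inequality and convergence holds at every point. Hence truncation does not require knowing that the
gradient vanishes on level sets. -/
lemma tendsto_smoothTransition_mul (x : ℝ) :
    Tendsto (fun n : ℕ => Real.smoothTransition (n * x)) atTop (𝓝 (if 0 < x then 1 else 0)) := by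
  split_ifs with hx
  · refine tendsto_const_nhds.congr' ?_
    obtain ⟨N, hN⟩ := exists_nat_ge x⁻¹
    filter_upwards [eventually_ge_atTop N] with n hn
    refine (Real.smoothTransition.one_of_one_le ?_).symm
    have : x⁻¹ ≤ n := hN.trans (by exact_mod_cast hn)
    calc (1 : ℝ) = x⁻¹ * x := (inv_mul_cancel₀ hx.ne').symm
      _ ≤ n * x := by gcongr
  · refine tendsto_const_nhds.congr fun n => ?_
    exact (Real.smoothTransition.zero_of_nonpos
      (mul_nonpos_of_nonneg_of_nonpos n.cast_nonneg (not_lt.1 hx))).symm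

lemma abs_smoothRamp_sub_le (n : ℕ) (x y : ℝ) :
    |smoothRamp n x - smoothRamp n y| ≤ |x - y| := by
  have : LipschitzWith 1 (smoothRamp n) := by
    refine lipschitzWith_of_nnnorm_deriv_le
      (fun x => (hasDerivAt_smoothRamp n x).differentiableAt) fun x => ?_
    rw [(hasDerivAt_smoothRamp n x).deriv, ← NNReal.coe_le_coe, coe_nnnorm, Real.norm_eq_abs,
      abs_of_nonneg (Real.smoothTransition.nonneg _)]
    exact Real.smoothTransition.le_one _
  simpa [Real.dist_eq] using this.dist_le_mul x y

lemma tendsto_smoothRamp (x : ℝ) :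
    Tendsto (fun n => smoothRamp n x) atTop (𝓝 (max x 0)) := by
  rcases le_or_gt x 0 with hx | hx
  · simp only [smoothRamp_of_nonpos _ hx, max_eq_right hx]
    exact tendsto_const_nhds
  · have key : Tendsto (fun n => smoothRamp n x) atTop (𝓝 (∫ _ in (0 : ℝ)..x, (1 : ℝ))) := by
      refine intervalIntegral.tendsto_integral_filter_of_dominated_convergence (fun _ => 1)
        (.of_forall fun n => (continuous_smoothTransition_mul n).aestronglyMeasurable)
        (.of_forall fun n => .of_forall fun t _ => ?_) (by simp) (.of_forall fun t ht => ?_)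
      · rw [Real.norm_eq_abs, abs_of_nonneg (Real.smoothTransition.nonneg _)]
        exact Real.smoothTransition.le_one _
      · rw [uIoc_of_le hx.le] at ht
        simpa [ht.1] using tendsto_smoothTransition_mul t
    simpa [max_eq_left hx.le] using key

end Ramp

variable {d : ℕ} {a : Space d → Matrix (Fin d) (Fin d) ℝ} {lam Lam : Space d → ℝ} {p q : ℝ≥0∞}

lemma tendsto_zero_of_sq {f : ℕ → ℝ≥0∞} (hf : Tendsto (fun n => f n ^ 2) atTop (𝓝 0)) :
    Tendsto f atTop (𝓝 0) := by
  have := hf.ennrpow_const (1 / 2 : ℝ)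
  rw [ENNReal.zero_rpow_of_pos (by norm_num)] at this
  refine this.congr fun n => ?_
  rw [← ENNReal.rpow_two, ← ENNReal.rpow_mul]
  norm_num

lemma exists_forall_abs_le {χ : Space d → ℝ} (hχ : Continuous χ) (hc : HasCompactSupport χ) :
    ∃ M, ∀ x, |χ x| ≤ M := hχ.bounded_above_of_compact_support hc

namespace IsCoefficient

/-- The upper bound by `Λ` and the boundedness of `∇χ` turn `L²(Λ dx)` convergence of the factor
into convergence in energy. -/
lemma tendsto_energy_smul_gradient (h : IsCoefficient a lam Lam p q) {χ : Space d → ℝ}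
    (hχ : ContDiff ℝ ∞ χ) (hχc : HasCompactSupport χ) {g : ℕ → Space d → ℝ}
    (hg : ∀ n, AEStronglyMeasurable (g n))
    (hg0 : Tendsto (fun n => eLpNorm (g n) 2 (weightedMeasure Lam)) atTop (𝓝 0)) :
    Tendsto (fun n => energy a (fun x => g n x • gradient χ x)) atTop (𝓝 0) := by
  obtain ⟨M, hM⟩ := (continuous_gradient hχ).bounded_above_of_compact_support
    (hasCompactSupport_gradient hχc)
  have hlim : Tendsto (fun n => (ENNReal.ofReal M * eLpNorm (g n) 2 (weightedMeasure Lam)) ^ 2)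
      atTop (𝓝 0) := by
    have := ENNReal.Tendsto.pow (n := 2)
      (ENNReal.Tendsto.const_mul (a := ENNReal.ofReal M) hg0 (by simp))
    simpa using this
  refine tendsto_of_tendsto_of_tendsto_of_le_of_le tendsto_const_nhds hlim (fun _ => zero_le)
    fun n => (h.energy_le_eLpNorm_sq
      ((hg n).smul (continuous_gradient hχ).aestronglyMeasurable)).trans ?_
  gcongr
  refine eLpNorm_le_mul_eLpNorm_of_ae_le_mul (.of_forall fun x => ?_) 2
  rw [Pi.smul_apply', norm_smul, mul_comm]
  gcongr
  exact hM x

end IsCoefficient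

namespace HasFormGradient

variable {G : Set (Space d)} {u : Space d → ℝ} {W : Space d → Space d}

lemma aestronglyMeasurable (h : IsCoefficient a lam Lam p q) (hd : 0 < d)
    (hu : HasFormGradient a Lam G u W) : AEStronglyMeasurable u :=
  hu.1.1.mono_ac (h.volume_ac hd)

/-- Chain rule with a smooth function, followed by a smooth cutoff. -/
lemma mul_comp (h : IsCoefficient a lam Lam p q) (hd : 0 < d) (hp : 1 ≤ p)
    (hu : HasFormGradient a Lam univ u W) {χ : Space d → ℝ} (hχ : ContDiff ℝ ∞ χ)
    (hχc : HasCompactSupport χ) (hχG : tsupport χ ⊆ G) {f : ℝ → ℝ} (hf : ContDiff ℝ ∞ f)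
    (hf0 : f 0 = 0) (hf' : ∀ x, |deriv f x| ≤ 1) (hfl : ∀ x y, |f x - f y| ≤ |x - y|) :
    HasFormGradient a Lam G (fun x => χ x * f (u x))
      (fun x => (χ x * deriv f (u x)) • W x + f (u x) • gradient χ x) := by
  have hum := hu.aestronglyMeasurable h hd
  have hen := hu.energy_lt_top h hp
  have hf'c : Continuous (deriv f) := hf.continuous_deriv (by simp)
  have hχm : AEStronglyMeasurable χ := hχ.continuous.aestronglyMeasurable
  have hgm := (continuous_gradient hχ).aestronglyMeasurable (μ := volume)
  obtain ⟨M, hM⟩ := exists_forall_abs_le hχ.continuous hχc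
  obtain ⟨φ, hφ, hφu, hφW, hφae⟩ := hu.exists_ae_tendsto h hd
  have hφg (n : ℕ) := (continuous_gradient (hφ n).1).aestronglyMeasurable (μ := volume)
  have hφm (n : ℕ) := (hφ n).1.continuous.aestronglyMeasurable (μ := volume)
  refine ⟨?_, ?_, fun n x => χ x * f (φ n x), fun n => ⟨?_, ?_, ?_⟩, ?_, ?_⟩
  · refine hu.1.of_le_mul (c := M) ((hχm.mul
      (hf.continuous.comp_aestronglyMeasurable hum)).mono_ac (weightedMeasure_ac Lam))
      (.of_forall fun x => ?_)
    rw [norm_mul]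
    have := hfl (u x) 0
    rw [hf0, sub_zero, sub_zero] at this
    exact mul_le_mul (hM x) this (abs_nonneg _) ((abs_nonneg _).trans (hM x))
  · exact ((hχm.mul (hf'c.comp_aestronglyMeasurable hum)).smul hu.2.1).add
      ((hf.continuous.comp_aestronglyMeasurable hum).smul hgm)
  · exact hχ.mul (hf.comp (hφ n).1)
  · exact hχc.mul_right
  · exact (tsupport_mul_subset_left).trans hχG
  · have hlim := ENNReal.Tendsto.const_mul (a := ENNReal.ofReal M) hφu (by simp)
    rw [mul_zero] at hlim
    refine tendsto_of_tendsto_of_tendsto_of_le_of_le tendsto_const_nhds hlim (fun _ => zero_le)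
      fun n => eLpNorm_le_mul_eLpNorm_of_ae_le_mul (.of_forall fun x => ?_) 2
    rw [← mul_sub, norm_mul]
    exact mul_le_mul (hM x) (hfl _ _) (abs_nonneg _) ((abs_nonneg _).trans (hM x))
  -- The error splits into three terms: one small by energy convergence of the gradients, one by
  -- dominated convergence (whence the almost everywhere convergent sequence), one by convergence in
  -- `L²(Λ dx)`.
  · have e (n : ℕ) (x : Space d) : gradient (fun x => χ x * f (φ n x)) x -
        ((χ x * deriv f (u x)) • W x + f (u x) • gradient χ x) =
        ((χ x * deriv f (φ n x)) • (gradient (φ n) x - W x) +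
          (χ x * (deriv f (φ n x) - deriv f (u x))) • W x) +
          (f (φ n x) - f (u x)) • gradient χ x := by
      rw [gradient_mul_comp (hχ.differentiable (by simp) x)
        ((hφ n).1.differentiable (by simp) x) (hf.differentiable (by simp) _)]
      module
    simp only [e]
    have hfφ (n : ℕ) := hf'c.comp_aestronglyMeasurable (hφm n)
    have hfu := hf'c.comp_aestronglyMeasurable hum
    have m1 (n : ℕ) := ((hχm.mul (hfφ n)).smul ((hφg n).sub hu.2.1)).aemeasurable
    have m2 (n : ℕ) := ((hχm.mul ((hfφ n).sub hfu)).smul hu.2.1).aemeasurable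
    have mf (n : ℕ) := (hf.continuous.comp_aestronglyMeasurable (hφm n)).sub
      (hf.continuous.comp_aestronglyMeasurable hum)
    have t1 : Tendsto (fun n => energy a (fun x =>
        (χ x * deriv f (φ n x)) • (gradient (φ n) x - W x))) atTop (𝓝 0) := by
      have := ENNReal.Tendsto.const_mul (a := ENNReal.ofReal (M ^ 2)) hφW (by simp)
      rw [mul_zero] at this
      refine tendsto_of_tendsto_of_tendsto_of_le_of_le tendsto_const_nhds this (fun _ => zero_le)
        fun n => energy_smul_le a (fun x => ?_) _
      rw [abs_mul]
      exact (mul_le_mul (hM x) (hf' _) (abs_nonneg _) ((abs_nonneg _).trans (hM x))).trans_eq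
        (mul_one M)
    have t2 : Tendsto (fun n => energy a (fun x =>
        (χ x * (deriv f (φ n x) - deriv f (u x))) • W x)) atTop (𝓝 0) := by
      refine h.tendsto_energy_smul hu.2.1.aemeasurable hen.ne
        (fun n => (hχm.mul ((hfφ n).sub hfu)).aemeasurable) (M := M * 2) (fun n x => ?_) ?_
      · rw [abs_mul]
        refine mul_le_mul (hM x) ((abs_sub _ _).trans ?_) (abs_nonneg _)
          ((abs_nonneg _).trans (hM x))
        linarith [hf' (φ n x), hf' (u x)]
      · filter_upwards [hφae] with x hx
        have := (((hf'c.tendsto (u x)).comp hx).sub_const (deriv f (u x))).const_mul (χ x)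
        simpa using this
    have t3 : Tendsto (fun n => energy a (fun x =>
        (f (φ n x) - f (u x)) • gradient χ x)) atTop (𝓝 0) := by
      refine h.tendsto_energy_smul_gradient hχ hχc mf ?_
      refine tendsto_of_tendsto_of_tendsto_of_le_of_le tendsto_const_nhds hφu (fun _ => zero_le)
        fun n => eLpNorm_mono fun x => hfl _ _
    exact h.tendsto_energy_add (fun n => (m1 n).add (m2 n))
      (fun n => ((mf n).smul hgm).aemeasurable) (h.tendsto_energy_add m1 m2 t1 t2) t3

/-- Truncation at a nonnegative level, followed by a smooth cutoff. -/
lemma mul_truncation (h : IsCoefficient a lam Lam p q) (hd : 0 < d) (hp : 1 ≤ p)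
    (hu : HasFormGradient a Lam univ u W) {χ : Space d → ℝ} (hχ : ContDiff ℝ ∞ χ)
    (hχc : HasCompactSupport χ) (hχG : tsupport χ ⊆ G) {κ : ℝ} (hκ : 0 ≤ κ) :
    HasFormGradient a Lam G (fun x => χ x * max (u x - κ) 0)
      (fun x => (χ x * if κ < u x then 1 else 0) • W x + max (u x - κ) 0 • gradient χ x) := by
  have hum := hu.aestronglyMeasurable h hd
  have hen := hu.energy_lt_top h hp
  have hχm : AEStronglyMeasurable χ := hχ.continuous.aestronglyMeasurable
  have hgm := (continuous_gradient hχ).aestronglyMeasurable (μ := volume)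
  obtain ⟨M, hM⟩ := exists_forall_abs_le hχ.continuous hχc
  have hM0 : 0 ≤ M := (abs_nonneg _).trans (hM 0)
  have hvm : AEStronglyMeasurable (fun x => max (u x - κ) 0) :=
    (hum.sub aestronglyMeasurable_const).sup aestronglyMeasurable_const
  have hvle (x : Space d) : |max (u x - κ) 0| ≤ |u x| := by
    rw [abs_of_nonneg (le_max_right _ _)]
    exact max_le (by linarith [le_abs_self (u x)]) (abs_nonneg _)
  have hv2 : MemLp (fun x => max (u x - κ) 0) 2 (weightedMeasure Lam) :=
    hu.1.mono (hvm.mono_ac (weightedMeasure_ac Lam)) (.of_forall hvle)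
  have hind : AEStronglyMeasurable (fun x => if κ < u x then (1 : ℝ) else 0) := by
    have : Measurable fun y : ℝ => if κ < y then (1 : ℝ) else 0 :=
      Measurable.ite measurableSet_Ioi measurable_const measurable_const
    exact (this.comp_aemeasurable hum.aemeasurable).aestronglyMeasurable
  have hsm (n : ℕ) : ContDiff ℝ ∞ fun y => smoothRamp n (y - κ) :=
    (contDiff_smoothRamp n).comp (contDiff_id.sub contDiff_const)
  have hder (n : ℕ) (y : ℝ) : deriv (fun y => smoothRamp n (y - κ)) y =
      Real.smoothTransition (n * (y - κ)) :=
    ((hasDerivAt_smoothRamp n (y - κ)).comp_sub_const y κ).deriv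
  -- Here `κ ≥ 0` is needed: the outer function must vanish at `0`, so that the composition is
  -- bounded by `|u|` and stays in `L²`.
  have hzero (n : ℕ) : smoothRamp n (0 - κ) = 0 := smoothRamp_of_nonpos n (by linarith)
  have hlip (n : ℕ) (x y : ℝ) : |smoothRamp n (x - κ) - smoothRamp n (y - κ)| ≤ |x - y| := by
    simpa using abs_smoothRamp_sub_le n (x - κ) (y - κ)
  have hv (n : ℕ) : HasFormGradient a Lam G (fun x => χ x * smoothRamp n (u x - κ))
      (fun x => (χ x * Real.smoothTransition (n * (u x - κ))) • W x
        + smoothRamp n (u x - κ) • gradient χ x) := by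
    have := hu.mul_comp h hd hp hχ hχc hχG (hsm n) (hzero n) (fun x => by
      rw [hder, abs_of_nonneg (Real.smoothTransition.nonneg _)]
      exact Real.smoothTransition.le_one _) (hlip n)
    simpa only [hder] using this
  have hrm (n : ℕ) : AEStronglyMeasurable (fun x => smoothRamp n (u x - κ)) :=
    (hsm n).continuous.comp_aestronglyMeasurable hum
  have hdiff (n : ℕ) (x : Space d) : |smoothRamp n (u x - κ) - max (u x - κ) 0| ≤ 2 * |u x| := by
    have h1 := hlip n (u x) 0
    rw [hzero, sub_zero, sub_zero] at h1
    linarith [abs_sub (smoothRamp n (u x - κ)) (max (u x - κ) 0), hvle x]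
  have hconv : Tendsto (fun n => eLpNorm (fun x => smoothRamp n (u x - κ) - max (u x - κ) 0) 2
      (weightedMeasure Lam)) atTop (𝓝 0) := by
    have h2 : Tendsto (fun n => eLpNorm (fun x => smoothRamp n (u x - κ) - max (u x - κ) 0) 2
        (weightedMeasure Lam) ^ 2) atTop (𝓝 (∫⁻ _ : Space d, 0 ∂(weightedMeasure Lam))) := by
      simp only [eLpNorm_two_sq]
      refine tendsto_lintegral_of_dominated_convergence' (fun x => ‖2 * u x‖ₑ ^ 2)
        (fun n => (((hrm n).sub hvm).mono_ac (weightedMeasure_ac Lam)).enorm.pow_const 2)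
        (fun n => .of_forall fun x => ?_) ?_ (.of_forall fun x => ?_)
      · dsimp only
        gcongr
        refine enorm_le_iff_norm_le.2 ((hdiff n x).trans_eq ?_)
        simp
      · rw [← eLpNorm_two_sq]
        exact (ENNReal.pow_lt_top (hu.1.const_mul 2).2).ne
      · have := ((tendsto_smoothRamp (u x - κ)).sub_const (max (u x - κ) 0)).enorm
        simpa using ENNReal.Tendsto.pow (n := 2) this
    rw [lintegral_zero] at h2
    exact tendsto_zero_of_sq h2
  -- The smooth ramps give pairs on the graph of the gradient; closedness passes to the limit.
  refine of_tendsto h hv ?_ ?_ ?_ ?_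
  · exact hv2.of_le_mul (c := M) ((hχm.mul hvm).mono_ac (weightedMeasure_ac Lam))
      (.of_forall fun x => by rw [norm_mul]; gcongr; exact hM x)
  · exact ((hχm.mul hind).smul hu.2.1).add (hvm.smul hgm)
  · have hlim := ENNReal.Tendsto.const_mul (a := ENNReal.ofReal M) hconv (by simp)
    rw [mul_zero] at hlim
    refine tendsto_of_tendsto_of_tendsto_of_le_of_le tendsto_const_nhds hlim (fun _ => zero_le)
      fun n => eLpNorm_le_mul_eLpNorm_of_ae_le_mul (.of_forall fun x => ?_) 2
    rw [← mul_sub, norm_mul]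
    gcongr
    exact hM x
  · have e (n : ℕ) (x : Space d) : ((χ x * Real.smoothTransition (n * (u x - κ))) • W x
        + smoothRamp n (u x - κ) • gradient χ x) -
        ((χ x * if κ < u x then 1 else 0) • W x + max (u x - κ) 0 • gradient χ x) =
        (χ x * (Real.smoothTransition (n * (u x - κ)) - if κ < u x then 1 else 0)) • W x +
          (smoothRamp n (u x - κ) - max (u x - κ) 0) • gradient χ x := by
      module
    simp only [e]
    have hcm (n : ℕ) : AEStronglyMeasurable (fun x =>
        χ x * (Real.smoothTransition (n * (u x - κ)) - if κ < u x then 1 else 0)) := by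
      refine hχm.mul (AEStronglyMeasurable.sub ?_ hind)
      exact ((continuous_smoothTransition_mul n).comp
        (continuous_id.sub continuous_const)).comp_aestronglyMeasurable hum
    refine h.tendsto_energy_add (fun n => ((hcm n).smul hu.2.1).aemeasurable)
      (fun n => (((hrm n).sub hvm).smul hgm).aemeasurable) ?_
      (h.tendsto_energy_smul_gradient hχ hχc (fun n => (hrm n).sub hvm) hconv)
    refine h.tendsto_energy_smul hu.2.1.aemeasurable hen.ne (fun n => (hcm n).aemeasurable)
      (M := M) (fun n x => ?_) (.of_forall fun x => ?_)
    · rw [abs_mul]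
      refine (mul_le_mul (hM x) ?_ (abs_nonneg _) hM0).trans_eq (mul_one M)
      have h0 := Real.smoothTransition.nonneg (n * (u x - κ))
      have h1 := Real.smoothTransition.le_one (n * (u x - κ))
      rw [abs_le]
      split_ifs <;> constructor <;> linarith
    · have := ((tendsto_smoothTransition_mul (u x - κ)).sub_const
        (if κ < u x then 1 else 0)).const_mul (χ x)
      simpa [sub_pos] using this

end HasFormGradient

end DegenerateParabolic

/-! ### Weighted Hölder inequality and closability. -/

namespace DegenerateParabolic

variable {d : ℕ} {a : Space d → Matrix (Fin d) (Fin d) ℝ} {lam Lam : Space d → ℝ} {p q : ℝ≥0∞}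

namespace IsCoefficient

/-- Hölder's inequality `‖f‖_s ≤ ‖λ⁻¹‖_t^(1/2) (∫ λ |f|²)^(1/2)` with `1/s = 1/(2t) + 1/2`. -/
lemma eLpNorm_le_lower (h : IsCoefficient a lam Lam p q) {E : Type*} [NormedAddCommGroup E]
    [NormedSpace ℝ E] {f : Space d → E} (hf : AEStronglyMeasurable f) (s t : ℝ≥0∞)
    [ENNReal.HolderTriple (2 * t) 2 s] (B : Set (Space d)) :
    eLpNorm f s (volume.restrict B) ≤
      eLpNorm (fun z => (lam z)⁻¹) t (volume.restrict B) ^ (1 / 2 : ℝ) *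
        (∫⁻ x, ENNReal.ofReal (lam x) * ‖f x‖ₑ ^ 2) ^ (1 / 2 : ℝ) := by
  set w : Space d → ℝ := fun x => ‖(lam x)⁻¹‖ ^ (1 / 2 : ℝ) with hw
  set g : Space d → E := fun x => Real.sqrt (lam x) • f x with hg
  have hgm : AEStronglyMeasurable g :=
    (h.aemeasurable_lower.sqrt.aestronglyMeasurable).smul hf
  have hwm : AEStronglyMeasurable w :=
    (h.aemeasurable_lower_inv.norm.pow_const (1 / 2 : ℝ)).aestronglyMeasurable
  -- Hölder is applied to the factorization `f = λ^(-1/2) · (λ^(1/2) f)`, with exponents `2t` and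
  -- `2`.
  have e : f =ᵐ[volume.restrict B] w • g := by
    refine ae_restrict_of_ae ?_
    filter_upwards [h.pos] with x hx
    simp only [hw, hg, Pi.smul_apply', smul_smul]
    rw [Real.norm_of_nonneg (inv_nonneg.2 hx.le), ← Real.sqrt_eq_rpow, ← Real.sqrt_mul
      (inv_nonneg.2 hx.le), inv_mul_cancel₀ hx.ne', Real.sqrt_one, one_smul]
  rw [eLpNorm_congr_ae e]
  refine (eLpNorm_smul_le_mul_eLpNorm (p := 2 * t) (q := 2) hgm.restrict hwm.restrict).trans ?_
  gcongr
  · rw [hw, eLpNorm_norm_rpow _ (by norm_num : (0 : ℝ) < 1 / 2)]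
    have : 2 * t * ENNReal.ofReal (1 / 2) = t := by
      rw [mul_comm 2 t, mul_assoc]
      have : (2 : ℝ≥0∞) * ENNReal.ofReal (1 / 2) = 1 := by
        rw [← ENNReal.ofReal_ofNat, ← ENNReal.ofReal_mul (by norm_num)]; norm_num
      rw [this, mul_one]
    rw [this]
  · rw [← ENNReal.rpow_le_rpow_iff (by norm_num : (0 : ℝ) < 2), ← ENNReal.rpow_mul]
    norm_num
    rw [eLpNorm_two_sq]
    refine (setLIntegral_le_lintegral _ _).trans (lintegral_mono_ae ?_)
    filter_upwards [h.pos] with x hx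
    rw [hg, enorm_smul, mul_pow, ← enorm_pow, Real.sq_sqrt hx.le, Real.enorm_eq_ofReal hx.le]

lemma lintegral_lower_le_energy (h : IsCoefficient a lam Lam p q) (W : Space d → Space d) :
    ∫⁻ x, ENNReal.ofReal (lam x) * ‖W x‖ₑ ^ 2 ≤ energy a W := by
  refine lintegral_mono_ae ?_
  filter_upwards [h.lower] with x hx
  refine le_trans (le_of_eq ?_) (ENNReal.ofReal_le_ofReal (hx (W x)))
  rw [ENNReal.ofReal_mul' (by positivity), ENNReal.ofReal_pow (norm_nonneg _), ofReal_norm]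

lemma lintegral_lower_le_eLpNorm (h : IsCoefficient a lam Lam p q) (hd : 0 < d)
    {f : Space d → ℝ} (hf : AEStronglyMeasurable f) :
    ∫⁻ x, ENNReal.ofReal (lam x) * ‖f x‖ₑ ^ 2 ≤ eLpNorm f 2 (weightedMeasure Lam) ^ 2 := by
  rw [eLpNorm_two_sq, h.lintegral_weightedMeasure (hf.enorm.pow_const 2)]
  refine lintegral_mono_ae ?_
  filter_upwards [h.lower_le_upper hd] with x hx
  gcongr

/-- Convergence in `L²(λ dx)` implies convergence of integrals against bounded functions. -/
lemma tendsto_integral_smul (h : IsCoefficient a lam Lam p q) (hq : 1 ≤ q) {E : Type*}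
    [NormedAddCommGroup E] [NormedSpace ℝ E] {f : ℕ → Space d → E}
    (hf : ∀ n, AEStronglyMeasurable (f n))
    (hlim : Tendsto (fun n => ∫⁻ x, ENNReal.ofReal (lam x) * ‖f n x‖ₑ ^ 2) atTop (𝓝 0))
    {E' F : Type*} [NormedAddCommGroup E'] [NormedSpace ℝ E'] [NormedAddCommGroup F]
    [NormedSpace ℝ F] (L : E →L[ℝ] E' →L[ℝ] F) {g : Space d → E'} (hg : Continuous g)
    (hgc : HasCompactSupport g) : Tendsto (fun n => ∫ x, L (f n x) (g x)) atTop (𝓝 0) := by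
  obtain ⟨M, hM⟩ := hg.bounded_above_of_compact_support hgc
  obtain ⟨R, hR⟩ := hgc.isCompact.isBounded.subset_ball (0 : Space d)
  have hHT : ENNReal.HolderTriple (2 * 1) 2 1 := ⟨by
    rw [mul_one, inv_one]; exact ENNReal.inv_two_add_inv_two⟩
  have hfin : eLpNorm (fun z => (lam z)⁻¹) 1 (volume.restrict (Metric.ball 0 R)) ^ (1 / 2 : ℝ)
      ≠ ⊤ := by
    refine ENNReal.rpow_ne_top_of_nonneg (by norm_num) ?_
    exact ((memLp_one_iff_integrable.2 (h.integrableOn_lower_inv hq 0 R)).2).ne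
  have key : Tendsto (fun n => ENNReal.ofReal (‖L‖ * M) *
      (eLpNorm (fun z => (lam z)⁻¹) 1 (volume.restrict (Metric.ball 0 R)) ^ (1 / 2 : ℝ) *
        (∫⁻ x, ENNReal.ofReal (lam x) * ‖f n x‖ₑ ^ 2) ^ (1 / 2 : ℝ))) atTop (𝓝 0) := by
    have := ENNReal.Tendsto.const_mul (a := ENNReal.ofReal (‖L‖ * M)) (ENNReal.Tendsto.const_mul
      (hlim.ennrpow_const (1 / 2 : ℝ)) (Or.inr hfin)) (by simp)
    rwa [ENNReal.zero_rpow_of_pos (by norm_num), mul_zero, mul_zero] at this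
  rw [tendsto_zero_iff_enorm_tendsto_zero]
  refine tendsto_of_tendsto_of_tendsto_of_le_of_le tendsto_const_nhds key (fun _ => zero_le)
    fun n => ?_
  refine (enorm_integral_le_lintegral_enorm _).trans ?_
  refine le_trans ?_ (mul_le_mul_right (h.eLpNorm_le_lower (hf n) 1 1 (Metric.ball 0 R)) _)
  rw [eLpNorm_one_eq_lintegral_enorm, ← lintegral_const_mul' _ _ ENNReal.ofReal_ne_top,
    ← lintegral_indicator measurableSet_ball]
  refine lintegral_mono fun x => ?_
  by_cases hx : x ∈ Metric.ball (0 : Space d) R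
  · rw [indicator_of_mem hx, ← ofReal_norm, ← ofReal_norm (f n x),
      ← ENNReal.ofReal_mul (mul_nonneg (norm_nonneg L) ((norm_nonneg (g x)).trans (hM x)))]
    refine ENNReal.ofReal_le_ofReal (((L.le_opNorm₂ _ _)).trans ?_)
    have := hM x
    calc ‖L‖ * ‖f n x‖ * ‖g x‖ ≤ ‖L‖ * ‖f n x‖ * M := by gcongr
      _ = _ := by ring
  · have : g x = 0 := image_eq_zero_of_notMem_tsupport fun h => hx (hR h)
    simp [this]

end IsCoefficient

/-- Integration by parts. -/
lemma integral_smul_gradient {φ g : Space d → ℝ} (hφ : ContDiff ℝ ∞ φ) (hg : ContDiff ℝ ∞ g)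
    (hφc : HasCompactSupport φ) (hgc : HasCompactSupport g) :
    ∫ x, g x • gradient φ x = -∫ x, φ x • gradient g x := by
  have hi {φ g : Space d → ℝ} (hφ : ContDiff ℝ ∞ φ) (hg : ContDiff ℝ ∞ g)
      (hgc : HasCompactSupport g) : Integrable fun x => g x • gradient φ x :=
    (hg.continuous.smul (continuous_gradient hφ)).integrable_of_hasCompactSupport hgc.smul_right
  refine ext_inner_left ℝ fun v => ?_
  rw [inner_neg_right, ← integral_inner (hi hφ hg hgc), ← integral_inner (hi hg hφ hφc)]
  have e (φ g : Space d → ℝ) (x : Space d) :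
      inner ℝ v (g x • gradient φ x) = g x * fderiv ℝ φ x v := by
    rw [inner_smul_right, inner_gradient_right]; rfl
  simp only [e]
  have hi' {φ g : Space d → ℝ} (hφ : ContDiff ℝ ∞ φ) (hg : ContDiff ℝ ∞ g)
      (hgc : HasCompactSupport g) : Integrable fun x => g x * fderiv ℝ φ x v :=
    (hg.continuous.mul ((hφ.continuous_fderiv (by simp)).clm_apply
      continuous_const)).integrable_of_hasCompactSupport hgc.mul_right
  rw [integral_mul_fderiv_eq_neg_fderiv_mul_of_integrable]
  · simp only [mul_comm]
  · simpa only [mul_comm] using hi' hg hφ hφc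
  · exact hi' hφ hg hgc
  · exact (hg.continuous.mul hφ.continuous).integrable_of_hasCompactSupport hgc.mul_right
  · exact fun x _ => hg.differentiable (by simp) x
  · exact fun x _ => hφ.differentiable (by simp) x

namespace HasFormGradient

variable {G : Set (Space d)} {u : Space d → ℝ} {V W : Space d → Space d}

/-- The form is closable: the form gradient is unique up to null sets. -/
lemma ae_eq (h : IsCoefficient a lam Lam p q) (hd : 0 < d) (hp : 1 ≤ p) (hq : 1 ≤ q)
    (hV : HasFormGradient a Lam G u V) (hW : HasFormGradient a Lam G u W) : V =ᵐ[volume] W := by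
  have hum := hV.aestronglyMeasurable h hd
  have hDen : energy a (fun x => V x + -W x) < ⊤ := by
    refine (h.energy_add_le hV.2.1.aemeasurable hW.2.1.neg.aemeasurable).trans_lt ?_
    have := energy_neg a W
    have h1 := hV.energy_lt_top h hp
    have h2 := hW.energy_lt_top h hp
    exact ENNReal.add_lt_top.2 ⟨ENNReal.mul_lt_top (by simp) h1,
      ENNReal.mul_lt_top (by simp) (this.trans_lt h2)⟩
  have hDm : AEStronglyMeasurable (fun x => V x + -W x) := hV.2.1.add hW.2.1.neg
  have hHT : ENNReal.HolderTriple (2 * 1) 2 1 := ⟨by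
    rw [mul_one, inv_one]; exact ENNReal.inv_two_add_inv_two⟩
  -- Finite energy and `λ⁻¹ ∈ L¹_loc` make `V - W` locally integrable, so it may be tested against
  -- smooth functions.
  have hloc : LocallyIntegrable (fun x => V x + -W x) := fun x =>
    ⟨Metric.ball x 1, Metric.ball_mem_nhds x one_pos, memLp_one_iff_integrable.1
      ⟨hDm.restrict, (h.eLpNorm_le_lower hDm 1 1 _).trans_lt (ENNReal.mul_lt_top
        (ENNReal.rpow_lt_top_of_nonneg (by norm_num)
          (memLp_one_iff_integrable.2 (h.integrableOn_lower_inv hq x 1)).2.ne)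
        (ENNReal.rpow_lt_top_of_nonneg (by norm_num)
          ((h.lintegral_lower_le_energy _).trans_lt hDen).ne))⟩⟩
  obtain ⟨h1, h2, φ, hφ, hφu, hφV⟩ := hV
  obtain ⟨h3, h4, ψ, hψ, hψu, hψW⟩ := hW
  have hφm (n : ℕ) := (hφ n).1.continuous.aestronglyMeasurable (μ := volume)
  have hψm (n : ℕ) := (hψ n).1.continuous.aestronglyMeasurable (μ := volume)
  have hφg (n : ℕ) := (continuous_gradient (hφ n).1).aestronglyMeasurable (μ := volume)
  have hψg (n : ℕ) := (continuous_gradient (hψ n).1).aestronglyMeasurable (μ := volume)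
  have hχ (n : ℕ) : ContDiff ℝ ∞ (fun x => φ n x - ψ n x) := (hφ n).1.sub (hψ n).1
  have hχc (n : ℕ) : HasCompactSupport (fun x => φ n x - ψ n x) := (hφ n).2.1.sub (hψ n).2.1
  have hχg (n : ℕ) (x : Space d) :
      gradient (fun x => φ n x - ψ n x) x = gradient (φ n) x - gradient (ψ n) x :=
    gradient_sub ((hφ n).1.differentiable (by simp) x) ((hψ n).1.differentiable (by simp) x)
  have hχ0 : Tendsto (fun n => ∫⁻ x, ENNReal.ofReal (lam x) * ‖φ n x - ψ n x‖ₑ ^ 2) atTop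
      (𝓝 0) := by
    have := ENNReal.Tendsto.pow (n := 2) (hφu.add hψu)
    rw [add_zero, zero_pow two_ne_zero] at this
    refine tendsto_of_tendsto_of_tendsto_of_le_of_le tendsto_const_nhds this (fun _ => zero_le)
      fun n => (h.lintegral_lower_le_eLpNorm hd ((hφm n).sub (hψm n))).trans ?_
    gcongr
    have e : (fun x => φ n x - ψ n x) = (fun x => φ n x - u x) - fun x => ψ n x - u x := by
      ext x; simp
    have := eLpNorm_sub_le (p := 2) (((hφm n).sub hum).mono_ac (weightedMeasure_ac Lam))
      (((hψm n).sub hum).mono_ac (weightedMeasure_ac Lam)) (by norm_num)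
    change eLpNorm (fun x => φ n x - ψ n x) 2 _ ≤ _
    rw [e]
    exact this
  have hχW : Tendsto (fun n => ∫⁻ x, ENNReal.ofReal (lam x) *
      ‖gradient (fun x => φ n x - ψ n x) x - (V x + -W x)‖ₑ ^ 2) atTop (𝓝 0) := by
    have := h.tendsto_energy_add (V := fun n x => gradient (φ n) x - V x)
      (W := fun n x => -(gradient (ψ n) x - W x)) (fun n => ((hφg n).sub h2).aemeasurable)
      (fun n => ((hψg n).sub h4).neg.aemeasurable) hφV (by
        simp only [energy_neg]; exact hψW)
    refine tendsto_of_tendsto_of_tendsto_of_le_of_le tendsto_const_nhds this (fun _ => zero_le)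
      fun n => (h.lintegral_lower_le_energy _).trans (le_of_eq ?_)
    congr 1
    ext1 x
    rw [hχg]
    abel
  -- The differences `φ n - ψ n` tend to `0` in `L²(λ dx)` and their gradients to `V - W` in the
  -- same weighted norm. Integrating by parts against `g` and letting `n → ∞` shows that `V - W`
  -- vanishes as a distribution.
  have hzero : ∀ᵐ x, V x + -W x = 0 := by
    refine ae_eq_zero_of_integral_contDiff_smul_eq_zero hloc fun g hg hgc => ?_
    have t1 := h.tendsto_integral_smul hq
      (fun n => (continuous_gradient (hχ n)).aestronglyMeasurable.sub hDm) hχW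
      (ContinuousLinearMap.lsmul ℝ ℝ).flip hg.continuous hgc
    have t2 := h.tendsto_integral_smul hq (fun n => (hχ n).continuous.aestronglyMeasurable) hχ0
      (ContinuousLinearMap.lsmul ℝ ℝ (E := Space d)) (continuous_gradient hg)
      (hasCompactSupport_gradient hgc)
    have e (n : ℕ) : ∫ x, (ContinuousLinearMap.lsmul ℝ ℝ).flip
        (gradient (fun x => φ n x - ψ n x) x - (V x + -W x)) (g x) =
        -(∫ x, ContinuousLinearMap.lsmul ℝ ℝ (φ n x - ψ n x) (gradient g x)) -
          ∫ x, g x • (V x + -W x) := by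
      have := integral_smul_gradient (hχ n) hg (hχc n) hgc
      simp only [ContinuousLinearMap.flip_apply, ContinuousLinearMap.lsmul_apply]
      rw [← this, ← integral_sub]
      · simp only [smul_sub]
      · exact (hg.continuous.smul (continuous_gradient (hχ n))).integrable_of_hasCompactSupport
          hgc.smul_right
      · exact hloc.integrable_smul_left_of_hasCompactSupport hg.continuous hgc
    have t3 := (t2.neg.sub_const (∫ x, g x • (V x + -W x)))
    have := tendsto_nhds_unique (t1.congr e) t3
    simpa using this.symm
  filter_upwards [hzero] with x hx
  exact add_neg_eq_zero.1 hx

end HasFormGradient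

end DegenerateParabolic

/-! ### Exponents, Sobolev inequality and interpolation. -/

namespace DegenerateParabolic

section Exponents

variable {d : ℕ} {p q : ℝ≥0∞}

lemma toReal_inv_add_toReal_inv_lt (hd : 2 ≤ d) (hpq : p⁻¹ + q⁻¹ < 2 / (d : ℝ≥0∞)) :
    (p⁻¹).toReal + (q⁻¹).toReal < 2 / d := by
  have hd0 : (d : ℝ≥0∞) ≠ 0 := by simp; omega
  have h2 : 2 / (d : ℝ≥0∞) ≠ ⊤ := ENNReal.div_ne_top (by simp) hd0
  have hfin := ENNReal.add_lt_top.1 (hpq.trans h2.lt_top)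
  rw [← ENNReal.toReal_add hfin.1.ne hfin.2.ne]
  have := (ENNReal.toReal_lt_toReal (hpq.trans h2.lt_top).ne h2).2 hpq
  simpa [ENNReal.toReal_div] using this

lemma two_div_le_one (hd : 2 ≤ d) : (2 : ℝ) / d ≤ 1 := by
  have : (2 : ℝ) ≤ d := by exact_mod_cast hd
  rw [div_le_one (by linarith)]
  exact this

lemma toReal_inv_lt_one (hd : 2 ≤ d) (hpq : p⁻¹ + q⁻¹ < 2 / (d : ℝ≥0∞)) :
    (p⁻¹).toReal < 1 := by
  have := toReal_inv_add_toReal_inv_lt hd hpq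
  linarith [two_div_le_one hd, ENNReal.toReal_nonneg (a := q⁻¹)]

lemma inv_ne_top_of_one_le (hp : 1 ≤ p) : p⁻¹ ≠ ⊤ := by
  simp [ENNReal.inv_eq_top, (zero_lt_one.trans_le hp).ne']

lemma inv_conjExp (hd : 2 ≤ d) (hp : 1 ≤ p) (hpq : p⁻¹ + q⁻¹ < 2 / (d : ℝ≥0∞)) :
    ENNReal.conjExponent p ≠ ⊤ ∧ 0 < conjExp p ∧ (conjExp p)⁻¹ = 1 - (p⁻¹).toReal := by
  have hc := (ENNReal.HolderConjugate.conjExponent hp)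
  have hsum := ENNReal.holderConjugate_iff.1 hc
  have hinv : (ENNReal.conjExponent p)⁻¹ ≠ ⊤ := fun h => by simp [h] at hsum
  have hr := congrArg ENNReal.toReal hsum
  rw [ENNReal.toReal_add (inv_ne_top_of_one_le hp) hinv, ENNReal.toReal_inv (ENNReal.conjExponent p),
    ENNReal.toReal_one] at hr
  have hP := toReal_inv_lt_one hd hpq
  have e : (conjExp p)⁻¹ = 1 - (p⁻¹).toReal := by rw [conjExp]; linarith
  have hpos : 0 < conjExp p := inv_pos.1 (by linarith)
  refine ⟨fun h => ?_, hpos, e⟩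
  simp [conjExp, h] at hpos

/-- For `d = 2` only the term `d/q` is left, and it is positive because `q < ∞`. -/
lemma rho_denominator_pos (hd : 2 ≤ d) (hq : 1 ≤ q) (hdq : d = 2 → q ≠ ⊤) :
    0 < ((d : ℝ) - 2) + d * (q⁻¹).toReal := by
  have h2 : (2 : ℝ) ≤ d := by exact_mod_cast hd
  rcases eq_or_lt_of_le hd with h | h
  · have : 0 < (q⁻¹).toReal :=
      ENNReal.toReal_pos (ENNReal.inv_ne_zero.2 (hdq h.symm)) (inv_ne_top_of_one_le hq)
    nlinarith
  · have h3 : (2 : ℝ) < d := by exact_mod_cast h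
    have : 0 ≤ (q⁻¹).toReal := ENNReal.toReal_nonneg
    nlinarith

lemma rho_pos (hd : 2 ≤ d) (hq : 1 ≤ q) (hdq : d = 2 → q ≠ ⊤) : 0 < rho d q := by
  have h2 : (2 : ℝ) ≤ d := by exact_mod_cast hd
  exact div_pos (by linarith) (rho_denominator_pos hd hq hdq)

/-- This exhibits `ρ` as the Sobolev conjugate of the exponent `s` with `1/s = 1/2 + 1/(2q)`. -/
lemma inv_rho (hd : 2 ≤ d) : (rho d q)⁻¹ = (1 / 2 + (q⁻¹).toReal / 2) - (d : ℝ)⁻¹ := by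
  have h2 : (2 : ℝ) ≤ d := by exact_mod_cast hd
  have : (d : ℝ) ≠ 0 := by linarith
  rw [rho, inv_div]
  field_simp
  ring

lemma two_mul_conjExp_div_rho (p q : ℝ≥0∞) (d : ℕ) : 2 * conjExp p / rho d q = 2 - nu d p q := by
  rw [nu]; ring

lemma nu_lt_two (hd : 2 ≤ d) (hp : 1 ≤ p) (hq : 1 ≤ q) (hpq : p⁻¹ + q⁻¹ < 2 / (d : ℝ≥0∞))
    (hdq : d = 2 → q ≠ ⊤) : nu d p q < 2 := by
  have h1 := rho_pos hd hq hdq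
  have h2 := (inv_conjExp hd hp hpq).2.1
  have : 0 < 2 * conjExp p / rho d q := by positivity
  rw [nu]; linarith

/-- `ν > 1` means `2/ρ < 1/p*`, that is `1 + 1/q - 2/d < 1 - 1/p`, which is the hypothesis on `p`
and `q`. -/
lemma one_lt_nu (hd : 2 ≤ d) (hp : 1 ≤ p) (hpq : p⁻¹ + q⁻¹ < 2 / (d : ℝ≥0∞)) :
    1 < nu d p q := by
  obtain ⟨-, h2, h3⟩ := inv_conjExp hd hp hpq
  have hlt := toReal_inv_add_toReal_inv_lt hd hpq
  have key : 2 * (rho d q)⁻¹ < (conjExp p)⁻¹ := by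
    rw [inv_rho hd, h3]
    have : (2 : ℝ) / d = 2 * (d : ℝ)⁻¹ := div_eq_mul_inv _ _
    linarith
  have := mul_lt_mul_of_pos_right key h2
  rw [inv_mul_cancel₀ h2.ne'] at this
  rw [nu, div_eq_mul_inv]
  linarith

end Exponents

variable {d : ℕ} {a : Space d → Matrix (Fin d) (Fin d) ℝ} {lam Lam : Space d → ℝ} {p q : ℝ≥0∞}

/-- Sobolev's inequality for the degenerate energy. -/
lemma exists_sobolev (hd : 2 ≤ d) (hq : 1 ≤ q) (hdq : d = 2 → q ≠ ⊤) : ∃ C : NNReal,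
    ∀ {a : Space d → Matrix (Fin d) (Fin d) ℝ} {lam Lam : Space d → ℝ} {p : ℝ≥0∞},
    IsCoefficient a lam Lam p q → ∀ {G : Set (Space d)} {w : Space d → ℝ} {W : Space d → Space d},
    HasFormGradient a Lam G w W →
    eLpNorm (fun z => (lam z)⁻¹) q (volume.restrict G) ≠ ⊤ → eLpNorm w (ENNReal.ofReal (rho d q)) volume ^ 2 ≤
      C * eLpNorm (fun z => (lam z)⁻¹) q (volume.restrict G) * energy a W := by
  have hQ : 0 ≤ (q⁻¹).toReal := ENNReal.toReal_nonneg
  have hQ1 : (q⁻¹).toReal ≤ 1 := by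
    have := ENNReal.toReal_mono (by simp) (ENNReal.inv_le_one.2 hq)
    simpa using this
  -- The integrability exponent of the gradient, `1/s = 1/2 + 1/(2q)`; it is at least `1` because `q
  -- ≥ 1`.
  set s : NNReal := Real.toNNReal (1 / 2 + (q⁻¹).toReal / 2)⁻¹ with hs
  have hs' : (s : ℝ) = (1 / 2 + (q⁻¹).toReal / 2)⁻¹ := Real.coe_toNNReal _ (by positivity)
  have hs1 : 1 ≤ s := by
    rw [← NNReal.coe_le_coe, hs', NNReal.coe_one]
    exact (one_le_inv₀ (by positivity)).2 (by linarith)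
  have hT : ENNReal.HolderTriple (2 * q) 2 (s : ℝ≥0∞) := ⟨by
    have hs0 : s ≠ 0 := (zero_lt_one.trans_le hs1).ne'
    rw [ENNReal.mul_inv (by simp) (by simp)]
    have hqt : q⁻¹ ≠ ⊤ := inv_ne_top_of_one_le hq
    have h2t : (2 : ℝ≥0∞)⁻¹ * q⁻¹ ≠ ⊤ := ENNReal.mul_ne_top (by simp) hqt
    rw [← ENNReal.toReal_eq_toReal_iff' (by finiteness) (by simp [hs0]), ENNReal.toReal_add h2t
      (by simp), ENNReal.toReal_mul, ENNReal.toReal_inv (s : ℝ≥0∞), ENNReal.coe_toReal, hs', inv_inv,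
      ENNReal.toReal_inv 2]
    norm_num
    ring⟩
  set K := SNormLESNormFDerivOfEqConst ℝ (volume : Measure (Space d)) s with hK
  refine ⟨K ^ 2 * 2, fun {a lam Lam p} h {G w W} hw hA => ?_⟩
  obtain ⟨φ, hφ, hφw, hφW, hφae⟩ := hw.exists_ae_tendsto h (by omega)
  have hφg (n : ℕ) := (continuous_gradient (hφ n).1).aestronglyMeasurable (μ := volume)
  set A := eLpNorm (fun z => (lam z)⁻¹) q (volume.restrict G)
  have hb (n : ℕ) : eLpNorm (φ n) (ENNReal.ofReal (rho d q)) volume ≤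
      (K ^ 2 * 2 * A * (energy a W + energy a (fun x => gradient (φ n) x - W x))) ^ (1 / 2 : ℝ) := by
    have h1 := eLpNorm_le_eLpNorm_fderiv_of_eq (F := ℝ) (volume : Measure (Space d))
      ((hφ n).1.of_le (by simp)) (hφ n).2.1 (p := s) (p' := (rho d q).toNNReal) hs1
      (by simp; omega) (by
        rw [Real.coe_toNNReal _ (rho_pos hd hq hdq).le, inv_rho hd, finrank_euclideanSpace_fin,
          NNReal.coe_inv, hs', inv_inv])
    have h2 : eLpNorm (fderiv ℝ (φ n)) s volume = eLpNorm (gradient (φ n)) s (volume.restrict G) := by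
      rw [eLpNorm_restrict_eq_of_support_subset]
      · exact eLpNorm_congr_norm_ae (.of_forall fun x => (norm_gradient _ _).symm)
      · refine fun x hx => (hφ n).2.2 (support_fderiv_subset ℝ (f := φ n) ?_)
        rwa [Function.mem_support, ← norm_ne_zero_iff, ← norm_gradient, norm_ne_zero_iff]
    have h3 := h.eLpNorm_le_lower (hφg n) s q G
    have h4 : ∫⁻ x, ENNReal.ofReal (lam x) * ‖gradient (φ n) x‖ₑ ^ 2 ≤
        2 * (energy a W + energy a (fun x => gradient (φ n) x - W x)) := by
      refine (h.lintegral_lower_le_energy _).trans ?_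
      have := h.energy_add_le hw.2.1.aemeasurable ((hφg n).sub hw.2.1).aemeasurable
      rw [mul_add]
      refine le_trans (le_of_eq ?_) this
      congr 1
      ext1 x
      simp
    calc _ ≤ K * eLpNorm (fderiv ℝ (φ n)) s volume := h1
      _ ≤ K * (A ^ (1 / 2 : ℝ) * (2 * (energy a W +
          energy a (fun x => gradient (φ n) x - W x))) ^ (1 / 2 : ℝ)) := by
        rw [h2]
        gcongr
        exact h3.trans (by gcongr)
      _ = _ := by
        rw [← ENNReal.mul_rpow_of_nonneg _ _ (by norm_num : (0 : ℝ) ≤ 1 / 2)]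
        have : (K : ℝ≥0∞) = (K ^ 2 : ℝ≥0∞) ^ (1 / 2 : ℝ) := by
          rw [← ENNReal.rpow_two, ← ENNReal.rpow_mul]; norm_num
        rw [this, ← ENNReal.mul_rpow_of_nonneg _ _ (by norm_num : (0 : ℝ) ≤ 1 / 2), ← this]
        congr 1
        ring
  -- Lower semicontinuity of the `L^ρ` norm under almost everywhere convergence carries the bound
  -- from test functions to `w`.
  have hlim := Lp.eLpNorm_lim_le_liminf_eLpNorm (p := ENNReal.ofReal (rho d q))
    (fun n => (hφ n).1.continuous.aestronglyMeasurable (μ := volume)) w hφae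
  have ht : Tendsto (fun n => (K ^ 2 * 2 * A * (energy a W +
      energy a (fun x => gradient (φ n) x - W x))) ^ (1 / 2 : ℝ)) atTop
      (𝓝 ((K ^ 2 * 2 * A * (energy a W + 0)) ^ (1 / 2 : ℝ))) :=
    (ENNReal.Tendsto.const_mul (tendsto_const_nhds.add hφW)
      (Or.inr (by finiteness))).ennrpow_const _
  have hfinal := hlim.trans ((liminf_le_liminf (.of_forall hb)).trans_eq ht.liminf_eq)
  calc _ ≤ ((K ^ 2 * 2 * A * (energy a W + 0)) ^ (1 / 2 : ℝ)) ^ 2 := by gcongr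
    _ = _ := by
      rw [← ENNReal.rpow_two, ← ENNReal.rpow_mul]
      norm_num

/-- Interpolation: the `L²(Λ dx)` norm is controlled by the energy and the measure of the set
where the function does not vanish. -/
lemma exists_interpolation (hd : 2 ≤ d) (hp : 1 ≤ p) (hq : 1 ≤ q)
    (hpq : p⁻¹ + q⁻¹ < 2 / (d : ℝ≥0∞)) (hdq : d = 2 → q ≠ ⊤) : ∃ C : NNReal,
    ∀ {a : Space d → Matrix (Fin d) (Fin d) ℝ} {lam Lam : Space d → ℝ},
    IsCoefficient a lam Lam p q → ∀ {G S : Set (Space d)} {w : Space d → ℝ}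
    {W : Space d → Space d}, HasFormGradient a Lam G w W →
    eLpNorm (fun z => (lam z)⁻¹) q (volume.restrict G) ≠ ⊤ → MeasurableSet S → S ⊆ G →
    Function.support w ⊆ S → eLpNorm w 2 (weightedMeasure Lam) ^ 2 ≤
      C * eLpNorm (fun z => (lam z)⁻¹) q (volume.restrict G) *
        eLpNorm Lam p (volume.restrict G) ^ (2 - nu d p q) * energy a W *
        weightedMeasure Lam S ^ (nu d p q - 1) := by
  obtain ⟨C, hC⟩ := exists_sobolev hd hq hdq
  refine ⟨C, fun {a lam Lam} h {G S w W} hw hA hS hSG hsupp => ?_⟩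
  have hd0 : 0 < d := by omega
  have hwm := hw.aestronglyMeasurable h hd0
  obtain ⟨hcfin, hcpos, -⟩ := inv_conjExp hd hp hpq
  have hρ := rho_pos hd hq hdq
  have hν := one_lt_nu hd hp hpq
  have hν2 := nu_lt_two hd hp hq hpq hdq
  -- With this `r`, Hölder with `p` and `p*` passes from `L^ρ(dx)` to `L^r(Λ dx)`. Since `2/r = 2 -
  -- ν`, Hölder from `L^r` to `L²` on `S` produces the power `2 (1/2 - 1/r) = ν - 1` of the measure
  -- of `S`.
  set r := rho d q / conjExp p with hr
  have hr0 : 0 < r := div_pos hρ hcpos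
  have h2r : 2 / r = 2 - nu d p q := by
    rw [← two_mul_conjExp_div_rho, hr]; field_simp
  have hr2 : 2 ≤ r := by
    have : 2 / r ≤ 1 := by linarith
    rwa [div_le_one hr0] at this
  have h1 : eLpNorm w 2 (weightedMeasure Lam) ≤
      eLpNorm w (ENNReal.ofReal r) ((weightedMeasure Lam).restrict S) *
        weightedMeasure Lam S ^ (1 / 2 - 1 / r) := by
    rw [← eLpNorm_restrict_eq_of_support_subset hsupp]
    have := eLpNorm_le_eLpNorm_mul_rpow_measure_univ (p := 2) (q := ENNReal.ofReal r)
      (μ := (weightedMeasure Lam).restrict S) (f := w)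
      (by rw [← ENNReal.ofReal_ofNat]; exact ENNReal.ofReal_le_ofReal hr2)
      (hwm.mono_ac ((Measure.absolutelyContinuous_of_le Measure.restrict_le_self).trans
        (weightedMeasure_ac Lam)))
    simpa [ENNReal.toReal_ofReal hr0.le] using this
  have h2 : eLpNorm w (ENNReal.ofReal r) ((weightedMeasure Lam).restrict S) ^ r ≤
      eLpNorm Lam p (volume.restrict G) * eLpNorm w (ENNReal.ofReal (rho d q)) volume ^ r := by
    have e1 : eLpNorm w (ENNReal.ofReal r) ((weightedMeasure Lam).restrict S) ^ r =
        ∫⁻ x in S, ‖w x‖ₑ ^ r ∂(weightedMeasure Lam) := by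
      have := eLpNorm_nnreal_pow_eq_lintegral (f := w) (μ := (weightedMeasure Lam).restrict S)
        (p := r.toNNReal) (by simpa using hr0)
      rwa [Real.coe_toNNReal _ hr0.le] at this
    rw [e1, h.setLIntegral_weightedMeasure (hwm.enorm.pow_const r) hS]
    have hHT : ENNReal.HolderTriple p (ENNReal.conjExponent p) 1 :=
      ENNReal.HolderConjugate.conjExponent hp
    have h3 := eLpNorm_smul_le_mul_eLpNorm (p := p) (q := ENNReal.conjExponent p) (r := 1)
      (μ := volume.restrict G) (φ := Lam) (f := fun x => ‖w x‖ ^ r)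
      (hwm.norm.aemeasurable.pow_const r).aestronglyMeasurable.restrict
      h.aemeasurable_upper.aestronglyMeasurable.restrict
    have e2 : ENNReal.conjExponent p * ENNReal.ofReal r = ENNReal.ofReal (rho d q) := by
      rw [← ENNReal.ofReal_toReal hcfin, ← ENNReal.ofReal_mul ENNReal.toReal_nonneg]
      congr 1
      change conjExp p * r = _
      rw [hr]; field_simp
    rw [eLpNorm_norm_rpow _ hr0, e2] at h3
    refine le_trans ?_ (h3.trans ?_)
    · rw [eLpNorm_one_eq_lintegral_enorm]
      refine (lintegral_mono_set hSG).trans (lintegral_mono fun x => ?_)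
      rw [Pi.smul_apply', enorm_smul]
      gcongr
      · exact Real.ofReal_le_enorm _
      · rw [Real.enorm_rpow_of_nonneg (norm_nonneg _) hr0.le, enorm_norm]
    · gcongr
      exact Measure.restrict_le_self
  have h3 : eLpNorm w (ENNReal.ofReal r) ((weightedMeasure Lam).restrict S) ^ 2 ≤
      eLpNorm Lam p (volume.restrict G) ^ (2 - nu d p q) *
        eLpNorm w (ENNReal.ofReal (rho d q)) volume ^ 2 := by
    have := ENNReal.rpow_le_rpow h2 (z := 2 / r) (by positivity)
    rw [ENNReal.mul_rpow_of_nonneg _ _ (by positivity), ← ENNReal.rpow_mul, ← ENNReal.rpow_mul,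
      mul_div_cancel₀ _ hr0.ne', ENNReal.rpow_two, ENNReal.rpow_two, h2r] at this
    exact this
  calc eLpNorm w 2 (weightedMeasure Lam) ^ 2
      ≤ (eLpNorm w (ENNReal.ofReal r) ((weightedMeasure Lam).restrict S) *
        weightedMeasure Lam S ^ (1 / 2 - 1 / r)) ^ 2 := by gcongr
    _ = eLpNorm w (ENNReal.ofReal r) ((weightedMeasure Lam).restrict S) ^ 2 *
        weightedMeasure Lam S ^ (nu d p q - 1) := by
      rw [mul_pow, ← ENNReal.rpow_natCast (_ ^ (1 / 2 - 1 / r)), ← ENNReal.rpow_mul]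
      congr 2
      push_cast
      have : 1 / r * 2 = 2 / r := by ring
      rw [sub_mul, this, h2r]
      ring
    _ ≤ (eLpNorm Lam p (volume.restrict G) ^ (2 - nu d p q) *
        (C * eLpNorm (fun z => (lam z)⁻¹) q (volume.restrict G) * energy a W)) *
        weightedMeasure Lam S ^ (nu d p q - 1) := by
      gcongr
      exact h3.trans (by gcongr; exact hC h hw hA)
    _ = _ := by ring

end DegenerateParabolic

/-! ### Weakly differentiable curves and the time derivative of truncated squares. -/

namespace DegenerateParabolic

section Hilbert

variable {H : Type*} [NormedAddCommGroup H] [InnerProductSpace ℝ H] [CompleteSpace H]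

/-- A weakly differentiable curve in a Hilbert space is pointwise Lipschitz. -/
lemma isBigO_sub_of_weakly_differentiable {U : ℝ → H} {t : ℝ}
    (hU : ∀ φ : H, DifferentiableAt ℝ (fun t' => inner ℝ (U t') φ) t) :
    (fun t' => U t' - U t) =O[𝓝 t] fun t' => t' - t := by
  by_contra hcon
  -- If the bound fails, some times `s n → t` have difference quotients of norm above `n`. Their
  -- inner products with each fixed vector converge, so Banach–Steinhaus bounds the quotients, a
  -- contradiction.
  have hex (n : ℕ) : ∃ s, |s - t| < 1 / ((n : ℝ) + 1) ∧ n * |s - t| < ‖U s - U t‖ := by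
    have h1 : ∃ᶠ s in 𝓝 t, ¬ ‖U s - U t‖ ≤ n * ‖s - t‖ :=
      fun h => hcon (Asymptotics.IsBigO.of_bound n (by simpa using h))
    have h2 : ∀ᶠ s in 𝓝 t, |s - t| < 1 / ((n : ℝ) + 1) :=
      Metric.ball_mem_nhds t (by positivity)
    obtain ⟨s, hs1, hs2⟩ := (h1.and_eventually h2).exists
    exact ⟨s, hs2, by simpa using hs1⟩
  choose s hs1 hs2 using hex
  have hst : Tendsto s atTop (𝓝 t) := by
    rw [tendsto_iff_dist_tendsto_zero]
    exact squeeze_zero (fun _ => dist_nonneg) (fun n => (hs1 n).le)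
      tendsto_one_div_add_atTop_nhds_zero_nat
  have hne (n : ℕ) : s n ≠ t := fun h => by have := hs2 n; simp [h] at this
  have hst' : Tendsto s atTop (𝓝[≠] t) :=
    tendsto_nhdsWithin_iff.2 ⟨hst, .of_forall fun n => hne n⟩
  obtain ⟨C, hC⟩ := banach_steinhaus (𝕜 := ℝ) (𝕜₂ := ℝ)
    (g := fun n => innerSL ℝ ((s n - t)⁻¹ • (U (s n) - U t))) fun φ => by
      have h1 := (hasDerivAt_iff_tendsto_slope.1 (hU φ).hasDerivAt).comp hst'
      obtain ⟨C, hC⟩ := h1.norm.bddAbove_range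
      refine ⟨C, fun n => ?_⟩
      have := hC ⟨n, rfl⟩
      simpa [slope_def_field, inner_smul_left, inner_sub_left, div_eq_inv_mul] using this
  obtain ⟨n, hn⟩ := exists_nat_ge C
  have h1 := hC n
  rw [innerSL_apply_norm, norm_smul, norm_inv, Real.norm_eq_abs,
    inv_mul_le_iff₀ (abs_pos.2 (sub_ne_zero.2 (hne n)))] at h1
  have h2 := hs2 n
  have h3 : |s n - t| * C ≤ |s n - t| * n := by gcongr
  linarith

/-- Chain rule for a weakly differentiable curve and a function with a quadratic expansion. -/
lemma hasDerivAt_comp_of_weakly_differentiable {U : ℝ → H} {t : ℝ}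
    (hU : ∀ φ : H, DifferentiableAt ℝ (fun t' => inner ℝ (U t') φ) t) {F : H → ℝ} {g : H}
    (hF : ∀ v, |F v - F (U t) - inner ℝ (v - U t) g| ≤ ‖v - U t‖ ^ 2) :
    HasDerivAt (fun t' => F (U t')) (deriv (fun t' => inner ℝ (U t') g) t) t := by
  have h1 := (hU g).hasDerivAt
  rw [hasDerivAt_iff_isLittleO] at h1 ⊢
  have hO := isBigO_sub_of_weakly_differentiable hU
  have h2 : (fun t' => F (U t') - F (U t) - inner ℝ (U t' - U t) g) =o[𝓝 t] fun t' => t' - t := by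
    have hb : (fun t' => F (U t') - F (U t) - inner ℝ (U t' - U t) g) =O[𝓝 t]
        fun t' => (t' - t) ^ 2 := by
      refine Asymptotics.IsBigO.trans (Asymptotics.IsBigO.of_bound 1
        (.of_forall fun t' => ?_)) (hO.norm_left.pow 2)
      simpa using hF (U t')
    refine hb.trans_isLittleO ?_
    have : Tendsto (fun t' : ℝ => t' - t) (𝓝 t) (𝓝 0) :=
      tendsto_sub_nhds_zero_iff.2 tendsto_id
    have h3 := ((Asymptotics.isLittleO_one_iff ℝ).2 this).mul_isBigO
      (Asymptotics.isBigO_refl (fun t' : ℝ => t' - t) (𝓝 t))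
    simpa [sq] using h3
  refine (h2.add h1).congr_left fun t' => ?_
  rw [inner_sub_left]
  ring

end Hilbert

/-- The function `(· - κ)_+²` is `C^{1,1}` with derivative `2 (· - κ)_+`, whose Lipschitz constant
is `2`; the first-order Taylor remainder is therefore at most the squared increment. -/
lemma abs_sq_posPart_sub_le (κ x y : ℝ) :
    |max (x - κ) 0 ^ 2 - max (y - κ) 0 ^ 2 - (x - y) * (2 * max (y - κ) 0)| ≤ (x - y) ^ 2 := by
  rw [abs_le]
  rcases max_cases (x - κ) 0 with ⟨h1, h2⟩ | ⟨h1, h2⟩ <;>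
  rcases max_cases (y - κ) 0 with ⟨h3, h4⟩ | ⟨h3, h4⟩ <;> rw [h1, h3] <;>
  constructor <;> nlinarith

section Curve

variable {α : Type*} {m : MeasurableSpace α} {μ : Measure α}

lemma _root_.MeasureTheory.MemLp.posPart_sub {f : α → ℝ} (hf : MemLp f 2 μ) {κ : ℝ}
    (hκ : 0 ≤ κ) : MemLp (fun x => max (f x - κ) 0) 2 μ := by
  refine hf.mono ((hf.1.sub aestronglyMeasurable_const).sup aestronglyMeasurable_const)
    (.of_forall fun x => ?_)
  rw [Real.norm_of_nonneg (le_max_right _ _)]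
  exact max_le (by linarith [Real.le_norm_self (f x)]) (norm_nonneg _)

lemma integrable_mul_posPart_sq {f χ : α → ℝ} (hf : MemLp f 2 μ) {κ : ℝ} (hκ : 0 ≤ κ)
    (hχ : AEStronglyMeasurable χ μ) (hχ1 : ∀ x, |χ x| ≤ 1) :
    Integrable (fun x => χ x * max (f x - κ) 0 ^ 2) μ :=
  (hf.posPart_sub hκ).integrable_sq.bdd_mul hχ (.of_forall hχ1)

/-- Integrated Taylor estimate: the quadratic expansion that
`hasDerivAt_comp_of_weakly_differentiable` asks of the functional `v ↦ ∫ χ (v - κ)_+²`. -/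
lemma abs_integral_posPart_sq_sub_le {f g χ : α → ℝ} (hf : MemLp f 2 μ) (hg : MemLp g 2 μ)
    {κ : ℝ} (hκ : 0 ≤ κ) (hχ : AEStronglyMeasurable χ μ) (hχ1 : ∀ x, |χ x| ≤ 1) :
    |∫ x, χ x * max (f x - κ) 0 ^ 2 ∂μ - ∫ x, χ x * max (g x - κ) 0 ^ 2 ∂μ -
      ∫ x, (f x - g x) * (χ x * (2 * max (g x - κ) 0)) ∂μ| ≤ ∫ x, (f x - g x) ^ 2 ∂μ := by
  have h1 := integrable_mul_posPart_sq hf hκ hχ hχ1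
  have h2 := integrable_mul_posPart_sq hg hκ hχ hχ1
  have h3 : Integrable (fun x => (f x - g x) * (χ x * (2 * max (g x - κ) 0))) μ := by
    have := ((hf.sub hg).integrable_mul ((hg.posPart_sub hκ).const_mul 2)).bdd_mul hχ
      (.of_forall hχ1)
    refine this.congr (.of_forall fun x => ?_)
    simp only [Pi.mul_apply, Pi.sub_apply]
    ring
  have h12 : Integrable (fun x => χ x * max (f x - κ) 0 ^ 2 - χ x * max (g x - κ) 0 ^ 2) μ :=
    h1.sub h2
  rw [← integral_sub h1 h2, ← integral_sub h12 h3]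
  refine (norm_integral_le_integral_norm _).trans (integral_mono (h12.sub h3).norm
    (hf.sub hg).integrable_sq fun x => ?_)
  have e : χ x * max (f x - κ) 0 ^ 2 - χ x * max (g x - κ) 0 ^ 2 -
      (f x - g x) * (χ x * (2 * max (g x - κ) 0)) =
      χ x * (max (f x - κ) 0 ^ 2 - max (g x - κ) 0 ^ 2 - (f x - g x) * (2 * max (g x - κ) 0)) := by
    ring
  simp only [Pi.sub_apply]
  rw [e, norm_mul]
  refine (mul_le_mul (hχ1 x) (abs_sq_posPart_sub_le κ _ _) (abs_nonneg _) zero_le_one).trans_eq ?_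
  rw [one_mul]

/-- Differentiation of `∫ χ (u_t - κ)_+²` along a weakly differentiable curve in `L²`. -/
lemma hasDerivAt_integral_posPart_sq {u : ℝ → α → ℝ} {I : Set ℝ} (hI : IsOpen I)
    (hu : ∀ t ∈ I, MemLp (u t) 2 μ) {t : ℝ} (ht : t ∈ I)
    (hdiff : ∀ φ : α → ℝ, MemLp φ 2 μ → DifferentiableAt ℝ (fun t' => ∫ x, u t' x * φ x ∂μ) t)
    {κ : ℝ} (hκ : 0 ≤ κ) {χ : α → ℝ} (hχ : AEStronglyMeasurable χ μ) (hχ1 : ∀ x, |χ x| ≤ 1) :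
    HasDerivAt (fun t' => ∫ x, χ x * max (u t' x - κ) 0 ^ 2 ∂μ)
      (deriv (fun t' => ∫ x, u t' x * (χ x * (2 * max (u t x - κ) 0)) ∂μ) t) t := by
  classical
  -- The value `0` off `I` is immaterial: `I` is open and derivatives depend only on times near `t`.
  let U : ℝ → Lp ℝ 2 μ := fun t' => if h : MemLp (u t') 2 μ then h.toLp else 0
  have hUae {t'} (h : t' ∈ I) : U t' =ᵐ[μ] u t' := by
    simp only [U, dif_pos (hu t' h)]
    exact (hu t' h).coeFn_toLp
  have hinner (φ : Lp ℝ 2 μ) {t'} (h : t' ∈ I) :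
      inner ℝ (U t') φ = ∫ x, u t' x * φ x ∂μ := by
    rw [L2.inner_def]
    refine integral_congr_ae ?_
    filter_upwards [hUae h] with x hx
    rw [hx]; simp [mul_comm]
  have hnear : ∀ᶠ t' in 𝓝 t, t' ∈ I := hI.mem_nhds ht
  have hU (φ : Lp ℝ 2 μ) : DifferentiableAt ℝ (fun t' => inner ℝ (U t') φ) t :=
    (hdiff φ (Lp.memLp φ)).congr_of_eventuallyEq (hnear.mono fun t' h => hinner φ h)
  have hgm : MemLp (fun x => χ x * (2 * max (u t x - κ) 0)) 2 μ := by
    refine (((hu t ht).posPart_sub hκ).const_mul 2).mono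
      (hχ.mul (((hu t ht).posPart_sub hκ).const_mul 2).1) (.of_forall fun x => ?_)
    rw [norm_mul]
    exact mul_le_of_le_one_left (norm_nonneg _) (hχ1 x)
  let F : Lp ℝ 2 μ → ℝ := fun v => ∫ x, χ x * max (v x - κ) 0 ^ 2 ∂μ
  have key := hasDerivAt_comp_of_weakly_differentiable (F := F) (g := hgm.toLp) hU fun v => by
    have h1 := abs_integral_posPart_sq_sub_le (Lp.memLp v) (Lp.memLp (U t)) hκ hχ hχ1
    have h2 : inner ℝ (v - U t) hgm.toLp =
        ∫ x, (v x - U t x) * (χ x * (2 * max (U t x - κ) 0)) ∂μ := by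
      rw [L2.inner_def]
      refine integral_congr_ae ?_
      filter_upwards [Lp.coeFn_sub v (U t), hgm.coeFn_toLp, hUae ht] with x hx1 hx2 hx3
      rw [hx1, hx2, Pi.sub_apply, hx3]; simp [mul_comm]
    have h3 : ‖v - U t‖ ^ 2 = ∫ x, (v x - U t x) ^ 2 ∂μ := by
      rw [← real_inner_self_eq_norm_sq, L2.inner_def]
      refine integral_congr_ae ?_
      filter_upwards [Lp.coeFn_sub v (U t)] with x hx1
      rw [hx1]; simp [sq]
    rw [h2, h3]
    exact h1
  have e1 : (fun t' => ∫ x, χ x * max (u t' x - κ) 0 ^ 2 ∂μ) =ᶠ[𝓝 t] fun t' => F (U t') := by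
    filter_upwards [hnear] with t' h
    refine integral_congr_ae ?_
    filter_upwards [hUae h] with x hx
    rw [hx]
  have e2 : deriv (fun t' => inner ℝ (U t') hgm.toLp) t =
      deriv (fun t' => ∫ x, u t' x * (χ x * (2 * max (u t x - κ) 0)) ∂μ) t := by
    refine Filter.EventuallyEq.deriv_eq ?_
    filter_upwards [hnear] with t' h
    rw [hinner _ h]
    refine integral_congr_ae ?_
    filter_upwards [hgm.coeFn_toLp] with x hx
    rw [hx]
  rw [← e2]
  exact key.congr_of_eventuallyEq e1

end Curve

end DegenerateParabolic

/-! ### Integration in time and cutoff functions. -/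

namespace DegenerateParabolic

section Time

/-- Integration in time of the differential inequality `2 Φ' + g = b y` with `g ≥ 0`. -/
lemma sup_le_and_lintegral_le_of_hasDerivAt {Φ D y : ℝ → ℝ} {T₁ T₂ s b Z : ℝ} (h12 : T₁ < T₂)
    (hb : 0 ≤ b) (hZ : 0 ≤ Z) (hΦ : ∀ t ∈ Ioo T₁ s, HasDerivAt Φ (D t) t)
    (hy : ContinuousOn y (Ioo T₁ s)) (hΦ0 : ∀ t ∈ Ioo T₁ s, 0 ≤ Φ t)
    (hΦy : ∀ t ∈ Ioo T₁ s, Φ t ≤ y t) (hg : ∀ t ∈ Ioo T₁ s, 0 ≤ -2 * D t + b * y t)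
    (hyZ : ∫⁻ t in Ioo T₁ s, ENNReal.ofReal (y t) ≤ ENNReal.ofReal Z) :
    (∀ t ∈ Ioo T₂ s, Φ t ≤ (1 / (T₂ - T₁) + b / 2) * Z) ∧
      ∫⁻ t in Ioo T₂ s, ENNReal.ofReal (-2 * D t + b * y t) ≤
        ENNReal.ofReal ((2 / (T₂ - T₁) + b) * Z) := by
  rcases le_or_gt s T₂ with hs | h2s
  · simp [Ioo_eq_empty_of_le hs]
  have hsub : Ioo T₁ T₂ ⊆ Ioo T₁ s := Ioo_subset_Ioo_right h2s.le
  have h12' : 0 < T₂ - T₁ := sub_pos.2 h12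
  -- A good initial time: on `(T₁, T₂)` the function `y` is somewhere at most its mean, hence at
  -- most `Z / (T₂ - T₁)`.
  obtain ⟨t₁, ht₁, hyt₁⟩ : ∃ t ∈ Ioo T₁ T₂, y t ≤ Z / (T₂ - T₁) := by
    obtain ⟨t, ht, hle⟩ := exists_le_setLAverage (μ := volume) (s := Ioo T₁ T₂)
      (f := fun t => ENNReal.ofReal (y t)) (by simpa using h12) (by simp)
      ((hy.mono hsub).aemeasurable measurableSet_Ioo).ennreal_ofReal
    refine ⟨t, ht, ?_⟩
    rw [setLAverage_eq, Real.volume_Ioo] at hle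
    have h1 : ENNReal.ofReal (y t) ≤ ENNReal.ofReal (Z / (T₂ - T₁)) := by
      rw [ENNReal.ofReal_div_of_pos h12']
      exact hle.trans (ENNReal.div_le_div_right ((lintegral_mono_set hsub).trans hyZ) _)
    exact (ENNReal.ofReal_le_ofReal_iff (by positivity)).1 h1
  have ht₁s : t₁ ∈ Ioo T₁ s := hsub ht₁
  have hycont (t : ℝ) (ht : t ∈ Ioo T₁ s) : ContinuousAt y t :=
    hy.continuousAt (isOpen_Ioo.mem_nhds ht)
  have hyint (t : ℝ) (ht : t ∈ Ioo T₁ s) : IntervalIntegrable y volume t₁ t :=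
    (hy.mono (ordConnected_Ioo.uIcc_subset ht₁s ht)).intervalIntegrable
  have hprim (t : ℝ) (ht : t ∈ Ioo T₁ s) :
      HasDerivAt (fun t => b * (∫ τ in t₁..t, y τ) - 2 * Φ t) (-2 * D t + b * y t) t := by
    have := ((intervalIntegral.integral_hasDerivAt_right (hyint t ht)
      (hy.stronglyMeasurableAtFilter isOpen_Ioo t ht) (hycont t ht)).const_mul b).sub
      ((hΦ t ht).const_mul 2)
    exact this.congr_deriv (by ring)
  have hy0 (t : ℝ) (ht : t ∈ Ioo T₁ s) : 0 ≤ y t := (hΦ0 t ht).trans (hΦy t ht)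
  have hyle (t : ℝ) (ht : t ∈ Ioo T₁ s) (h : t₁ ≤ t) : ∫ τ in t₁..t, y τ ≤ Z := by
    have hsub' : Ioc t₁ t ⊆ Ioo T₁ s := fun τ hτ => ⟨ht₁.1.trans hτ.1, hτ.2.trans_lt ht.2⟩
    rw [intervalIntegral.integral_of_le h]
    refine (ENNReal.ofReal_le_ofReal_iff hZ).1 ?_
    rw [ofReal_integral_eq_lintegral_ofReal (hyint t ht).1
      ((ae_restrict_iff' measurableSet_Ioc).2 (.of_forall fun τ hτ => hy0 τ (hsub' hτ)))]
    exact (lintegral_mono_set hsub').trans hyZ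
  have key (t : ℝ) (ht : t ∈ Ioo T₁ s) (h : t₁ ≤ t) :
      IntegrableOn (fun t => -2 * D t + b * y t) (Ioc t₁ t) ∧
      2 * Φ t + ∫ τ in t₁..t, (-2 * D τ + b * y τ) ≤ (2 / (T₂ - T₁) + b) * Z := by
    have hsub' : Icc t₁ t ⊆ Ioo T₁ s := fun τ hτ => ⟨ht₁.1.trans_le hτ.1, hτ.2.trans_lt ht.2⟩
    have hc : ContinuousOn (fun t => b * (∫ τ in t₁..t, y τ) - 2 * Φ t) (Icc t₁ t) :=
      fun τ hτ => (hprim τ (hsub' hτ)).continuousAt.continuousWithinAt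
    -- `D` is not assumed integrable; integrability comes from the sign of the derivative of a
    -- continuous primitive.
    have hi := intervalIntegral.integrableOn_deriv_of_nonneg hc
      (fun τ hτ => hprim τ (hsub' (Ioo_subset_Icc_self hτ)))
      (fun τ hτ => hg τ (hsub' (Ioo_subset_Icc_self hτ)))
    refine ⟨hi, ?_⟩
    have e := intervalIntegral.integral_eq_sub_of_hasDerivAt_of_le h hc
      (fun τ hτ => hprim τ (hsub' (Ioo_subset_Icc_self hτ)))
      ((intervalIntegrable_iff_integrableOn_Ioc_of_le h).2 hi)
    rw [intervalIntegral.integral_same] at e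
    have h1 : Φ t₁ ≤ Z / (T₂ - T₁) := (hΦy _ ht₁s).trans hyt₁
    have h2 : b * ∫ τ in t₁..t, y τ ≤ b * Z := by gcongr; exact hyle t ht h
    have h3 : (2 / (T₂ - T₁) + b) * Z = 2 * (Z / (T₂ - T₁)) + b * Z := by ring
    rw [e, h3]
    linarith
  have hnn (t : ℝ) (ht : t ∈ Ioo T₁ s) (h : t₁ ≤ t) :
      0 ≤ ∫ τ in t₁..t, (-2 * D τ + b * y τ) :=
    intervalIntegral.integral_nonneg h fun τ hτ =>
      hg τ ⟨ht₁.1.trans_le hτ.1, hτ.2.trans_lt ht.2⟩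
  refine ⟨fun t ht => ?_, ?_⟩
  · have hts : t ∈ Ioo T₁ s := ⟨h12.trans ht.1, ht.2⟩
    have h1 := (key t hts (ht₁.2.trans ht.1).le).2
    have h2 := hnn t hts (ht₁.2.trans ht.1).le
    have h3 : (2 / (T₂ - T₁) + b) * Z = 2 * ((1 / (T₂ - T₁) + b / 2) * Z) := by ring
    linarith
  -- Nothing is known at the endpoint `s`, so the interval is exhausted from inside and monotone
  -- convergence is used.
  · obtain ⟨v, hvmono, hvlt, hvlim⟩ := exists_seq_strictMono_tendsto' h2s
    have hU : Ioo T₂ s ⊆ ⋃ n, Ioc t₁ (v n) := fun t ht => by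
      obtain ⟨n, hn⟩ := (hvlim.eventually_const_lt ht.2).exists
      exact mem_iUnion.2 ⟨n, ht₁.2.trans ht.1, hn.le⟩
    refine (lintegral_mono_set hU).trans ?_
    rw [setLIntegral_iUnion_of_directed _ (Monotone.directed_le
      fun m n hmn => Ioc_subset_Ioc_right (hvmono.monotone hmn))]
    refine iSup_le fun n => ?_
    have hvn : v n ∈ Ioo T₁ s := ⟨h12.trans (hvlt n).1, (hvlt n).2⟩
    have hle : t₁ ≤ v n := (ht₁.2.trans (hvlt n).1).le
    obtain ⟨hi, hk⟩ := key (v n) hvn hle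
    rw [← ofReal_integral_eq_lintegral_ofReal hi ((ae_restrict_iff' measurableSet_Ioc).2
      (.of_forall fun τ hτ => hg τ ⟨ht₁.1.trans hτ.1, hτ.2.trans_lt hvn.2⟩)),
      ← intervalIntegral.integral_of_le hle]
    exact ENNReal.ofReal_le_ofReal (by linarith [hΦ0 _ hvn])

end Time

section Cutoff

lemma exists_abs_deriv_smoothTransition_le :
    ∃ M : ℝ, 0 < M ∧ ∀ x, |deriv Real.smoothTransition x| ≤ M := by
  have hc : Continuous (deriv Real.smoothTransition) :=
    (Real.smoothTransition.contDiff (n := 1)).continuous_deriv (by simp)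
  have hsupp : HasCompactSupport (deriv Real.smoothTransition) := by
    refine HasCompactSupport.intro (isCompact_Icc (a := (0 : ℝ)) (b := 1)) fun x hx => ?_
    rw [mem_Icc, not_and_or, not_le, not_le] at hx
    rcases hx with hx | hx
    · have : Real.smoothTransition =ᶠ[𝓝 x] fun _ => 0 := by
        filter_upwards [Iio_mem_nhds hx] with y hy
        exact Real.smoothTransition.zero_of_nonpos hy.le
      rw [this.deriv_eq, deriv_const]
    · have : Real.smoothTransition =ᶠ[𝓝 x] fun _ => 1 := by
        filter_upwards [Ioi_mem_nhds hx] with y hy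
        exact Real.smoothTransition.one_of_one_le hy.le
      rw [this.deriv_eq, deriv_const]
  obtain ⟨M, hM⟩ := hc.bounded_above_of_compact_support hsupp
  exact ⟨max M 1, by positivity, fun x => (hM x).trans (le_max_left _ _)⟩

/-- Smooth cutoff functions between concentric balls, with a gradient bound. -/
lemma exists_cutoff : ∃ M : ℝ, 0 < M ∧ ∀ {d : ℕ} (x : Space d) (R' R : ℝ), 0 < R' → R' < R →
    ∃ η : Space d → ℝ, ContDiff ℝ ∞ η ∧ HasCompactSupport η ∧ tsupport η ⊆ Metric.ball x R ∧
      (∀ z ∈ Metric.ball x R', η z = 1) ∧ (∀ z, 0 ≤ η z) ∧ (∀ z, η z ≤ 1) ∧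
      ∀ z, ‖gradient η z‖ ≤ M / (R - R') := by
  obtain ⟨M, hM0, hM⟩ := exists_abs_deriv_smoothTransition_le
  refine ⟨4 * M, by positivity, fun {d} x R' R hR' hR => ?_⟩
  set R₁ := (R' + R) / 2 with hR₁
  have h1 : R' < R₁ := by rw [hR₁]; linarith
  have h2 : R₁ < R := by rw [hR₁]; linarith
  have hden : 0 < R₁ ^ 2 - R' ^ 2 := by nlinarith
  -- Using the squared distance keeps `f` smooth at the centre. It equals `1` at radius `R'` and `0`
  -- at the intermediate radius `R₁`, which keeps the closed support inside the open ball of radius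
  -- `R`.
  set f : Space d → ℝ := fun z => (R₁ ^ 2 - ‖z - x‖ ^ 2) / (R₁ ^ 2 - R' ^ 2) with hf
  set η : Space d → ℝ := fun z => Real.smoothTransition (f z) with hη
  have hfs : ContDiff ℝ ∞ f :=
    (contDiff_const.sub ((contDiff_id.sub contDiff_const).norm_sq ℝ)).div_const _
  have hηs : ContDiff ℝ ∞ η := Real.smoothTransition.contDiff.comp hfs
  have hzero (z : Space d) (hz : z ∉ Metric.closedBall x R₁) : f z < 0 := by
    rw [Metric.mem_closedBall, dist_eq_norm, not_le] at hz
    exact div_neg_of_neg_of_pos (by nlinarith) hden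
  have hsupp : tsupport η ⊆ Metric.closedBall x R₁ := by
    refine closure_minimal (fun z hz => ?_) Metric.isClosed_closedBall
    by_contra hcon
    exact hz (Real.smoothTransition.zero_of_nonpos (hzero z hcon).le)
  refine ⟨η, hηs, HasCompactSupport.of_support_subset_isCompact
    (isCompact_closedBall x R₁) (subset_tsupport η |>.trans hsupp),
    hsupp.trans (Metric.closedBall_subset_ball h2), fun z hz => ?_,
    fun z => Real.smoothTransition.nonneg _, fun z => Real.smoothTransition.le_one _, fun z => ?_⟩
  · rw [Metric.mem_ball, dist_eq_norm] at hz
    refine Real.smoothTransition.one_of_one_le ((one_le_div hden).2 ?_)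
    nlinarith [norm_nonneg (z - x)]
  · rw [norm_gradient]
    by_cases hz : z ∈ Metric.closedBall x R₁
    · rw [Metric.mem_closedBall, dist_eq_norm] at hz
      have hfd : HasFDerivAt f (-((R₁ ^ 2 - R' ^ 2)⁻¹ • (2 • (innerSL ℝ) (z - x)))) z := by
        have h3 : HasFDerivAt (fun z : Space d => ‖z - x‖ ^ 2) (2 • (innerSL ℝ) (z - x)) z := by
          have := ((hasFDerivAt_id (𝕜 := ℝ) z).sub_const x).norm_sq
          exact this.congr_fderiv (by ext; simp)
        have h4 := (h3.const_sub (R₁ ^ 2)).const_mul (R₁ ^ 2 - R' ^ 2)⁻¹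
        rw [smul_neg] at h4
        refine h4.congr_of_eventuallyEq (.of_forall fun z => ?_)
        simp only [hf, div_eq_inv_mul]
      have hd1 : DifferentiableAt ℝ Real.smoothTransition (f z) :=
        (Real.smoothTransition.contDiff (n := 1)).differentiable (by simp) _
      have h5 := hd1.hasDerivAt.comp_hasFDerivAt z hfd
      have h6 : fderiv ℝ η z = deriv Real.smoothTransition (f z) •
          -((R₁ ^ 2 - R' ^ 2)⁻¹ • (2 • (innerSL ℝ) (z - x))) := h5.fderiv
      rw [h6, norm_smul, norm_neg, norm_smul, norm_inv, Real.norm_of_nonneg hden.le,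
        ← Nat.cast_smul_eq_nsmul ℝ, norm_smul, innerSL_apply_norm]
      calc ‖deriv Real.smoothTransition (f z)‖ * ((R₁ ^ 2 - R' ^ 2)⁻¹ * (‖((2 : ℕ) : ℝ)‖ * ‖z - x‖))
          ≤ M * ((R₁ ^ 2 - R' ^ 2)⁻¹ * (2 * R₁)) := by
            gcongr
            · exact hM _
            · simp
        _ ≤ 4 * M / (R - R') := by
          have e : R₁ ^ 2 - R' ^ 2 = (R - R') / 2 * (R₁ + R') := by rw [hR₁]; ring
          have hRR : 0 < R - R' := by linarith
          have hs : 0 < R₁ + R' := by linarith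
          rw [e, mul_inv, inv_div]
          have : (R₁ + R')⁻¹ * R₁ ≤ 1 := by
            rw [inv_mul_le_iff₀ hs]; linarith
          calc M * (2 / (R - R') * (R₁ + R')⁻¹ * (2 * R₁))
              = 4 * M / (R - R') * ((R₁ + R')⁻¹ * R₁) := by ring
            _ ≤ 4 * M / (R - R') * 1 := by gcongr
            _ = _ := mul_one _
    · have : η =ᶠ[𝓝 z] fun _ => 0 := by
        filter_upwards [Metric.isClosed_closedBall.isOpen_compl.mem_nhds hz] with y hy
        exact Real.smoothTransition.zero_of_nonpos (hzero y hy).le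
      rw [this.fderiv_eq, fderiv_const_apply, norm_zero]
      have : 0 < R - R' := by linarith
      positivity

end Cutoff

end DegenerateParabolic

/-! ### The energy inequality at a fixed time. -/

namespace DegenerateParabolic

variable {d : ℕ} {a : Space d → Matrix (Fin d) (Fin d) ℝ} {lam Lam : Space d → ℝ} {p q : ℝ≥0∞}

namespace IsCoefficient

lemma integrable_and_integral_weightedMeasure (h : IsCoefficient a lam Lam p q) (hd : 0 < d)
    {f : Space d → ℝ} (hf : Integrable f (weightedMeasure Lam)) :
    Integrable (fun x => Lam x * f x) ∧
      ∫ x, f x ∂(weightedMeasure Lam) = ∫ x, Lam x * f x := by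
  have e : (fun x => (ENNReal.ofReal (Lam x)).toReal • f x) =ᵐ[volume] fun x => Lam x * f x := by
    filter_upwards [h.upper_pos hd] with x hx
    rw [ENNReal.toReal_ofReal hx.le, smul_eq_mul]
  constructor
  · exact ((integrable_withDensity_iff_integrable_smul₀' h.aemeasurable_upper.ennreal_ofReal
      (.of_forall fun _ => ENNReal.ofReal_lt_top)).1 hf).congr e
  · rw [weightedMeasure, integral_withDensity_eq_integral_toReal_smul₀
      h.aemeasurable_upper.ennreal_ofReal (.of_forall fun _ => ENNReal.ofReal_lt_top)]
    exact integral_congr_ae e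

lemma integrable_pairing (h : IsCoefficient a lam Lam p q) {V W : Space d → Space d}
    (hV : AEMeasurable V) (hW : AEMeasurable W) (hVe : energy a V < ⊤) (hWe : energy a W < ⊤) :
    Integrable fun x => pairing (a x) (V x) (W x) := by
  have hself {V : Space d → Space d} (hV : AEMeasurable V) (hVe : energy a V < ⊤) :
      Integrable fun x => pairing (a x) (V x) (V x) := by
    refine ⟨(h.aemeasurable_pairing hV hV).aestronglyMeasurable, ?_⟩
    rw [hasFiniteIntegral_iff_ofReal (h.nonneg.mono fun x hx => hx _)]
    exact hVe
  refine ((hself hV hVe).add (hself hW hWe)).mono'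
    (h.aemeasurable_pairing hV hW).aestronglyMeasurable ?_
  filter_upwards [h.symm, h.nonneg] with x hs hn
  have := two_mul_abs_pairing_le hs hn (V x) (W x)
  rw [Real.norm_eq_abs, Pi.add_apply]
  linarith [abs_nonneg (pairing (a x) (V x) (W x))]

end IsCoefficient

lemma memForm_formGradient {θ : Space d → ℝ} {u : Space d → ℝ} (hu : MemForm a θ univ u) :
    HasFormGradient a θ univ u (formGradient a θ u) := by
  rw [formGradient, dif_pos hu]
  exact hu.choose_spec

/-- The algebra behind Caccioppoli's inequality. -/
lemma pairing_cutoff_le {A : Matrix (Fin d) (Fin d) ℝ} (hA : A.IsSymm)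
    (hpos : ∀ ξ, 0 ≤ pairing A ξ ξ) (W N : Space d) (e χ v : ℝ) (hχ : χ = 0 ∨ χ = 1)
    (hv : χ = 0 → v = 0) :
    pairing A ((e * χ) • W + v • N) ((e * χ) • W + v • N) ≤
      2 * pairing A W ((2 * e ^ 2 * χ) • W + v • ((4 * e) • N)) + 10 * (v ^ 2 * pairing A N N) := by
  have hχv : χ * v = v := by
    rcases hχ with h | h
    · rw [h, hv h]; simp
    · rw [h, one_mul]
  have hχ2 : χ * χ = χ := by rcases hχ with h | h <;> simp [h]
  -- The constant is `10 = 2 + 8`: `2` from expanding the square on the left, `8` from absorbing the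
  -- cross term `8 e v ⟨A W, N⟩` into `2 e² χ ⟨A W, W⟩`.
  have h1 := pairing_add_self_le hA hpos ((e * χ) • W) (v • N)
  have h2 := two_mul_abs_pairing_le hA hpos ((e * χ) • W) ((2 * v) • N)
  have h3 := neg_abs_le (pairing A ((e * χ) • W) ((2 * v) • N))
  simp only [pairing_add_left, pairing_add_right, pairing_smul_left, pairing_smul_right] at *
  have e1 : e * χ * (e * χ * pairing A W W) = e ^ 2 * χ * pairing A W W := by
    linear_combination e ^ 2 * pairing A W W * hχ2
  have e2 : 2 * v * (e * χ * pairing A W N) = 2 * e * v * pairing A W N := by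
    linear_combination 2 * e * pairing A W N * hχv
  have e3 : 2 * v * (2 * v * pairing A N N) = 4 * (v ^ 2 * pairing A N N) := by ring
  have e4 : v * (v * pairing A N N) = v ^ 2 * pairing A N N := by ring
  rw [e1, e4] at h1
  rw [e1, e2, e3] at h2
  rw [e2] at h3
  linarith

lemma gradient_const_mul_sq {η : Space d → ℝ} (hη : ContDiff ℝ ∞ η) (z : Space d) :
    gradient (fun z => 2 * η z ^ 2) z = (4 * η z) • gradient η z := by
  have h1 := ((hη.differentiable (by simp) z).hasFDerivAt.pow 2).const_mul 2
  rw [gradient, h1.fderiv, map_smul, gradient]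
  simp only [map_smul, smul_smul]
  congr 1
  push_cast
  ring

namespace IsSubcaloric

variable {I : Set ℝ} {G : Set (Space d)} {u : ℝ → Space d → ℝ}

lemma memLp (hu : IsSubcaloric a Lam I G u) {t : ℝ} (ht : t ∈ I) :
    MemLp (u t) 2 (weightedMeasure Lam) := (hu.memForm t ht).choose_spec.1

/-- The energy inequality at a fixed time. -/
lemma energy_le (h : IsCoefficient a lam Lam p q) (hd : 0 < d) (hp : 1 ≤ p) (hq : 1 ≤ q)
    (hu : IsSubcaloric a Lam I G u) {t : ℝ} (ht : t ∈ I) {κ : ℝ} (hκ : 0 ≤ κ) {η : Space d → ℝ}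
    (hη : ContDiff ℝ ∞ η) (hηc : HasCompactSupport η) {S : Set (Space d)} (hS : MeasurableSet S)
    (hηS : tsupport η ⊆ S) (hSG : S ⊆ G) {c : ℝ} (hgrad : ∀ z, ‖gradient η z‖ ≤ c) :
    ∃ V, HasFormGradient a Lam G (fun z => η z * max (u t z - κ) 0) V ∧
      energy a V ≤ ENNReal.ofReal (-2 * deriv (fun t' => ∫ z in G,
        u t' z * (η z ^ 2 * (2 * max (u t z - κ) 0)) ∂(weightedMeasure Lam)) t +
        10 * c ^ 2 * ∫ z in S, max (u t z - κ) 0 ^ 2 ∂(weightedMeasure Lam)) ∧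
      0 ≤ -2 * deriv (fun t' => ∫ z in G,
        u t' z * (η z ^ 2 * (2 * max (u t z - κ) 0)) ∂(weightedMeasure Lam)) t +
        10 * c ^ 2 * ∫ z in S, max (u t z - κ) 0 ^ 2 ∂(weightedMeasure Lam) := by
  set W := formGradient a Lam (u t) with hWdef
  have hW : HasFormGradient a Lam univ (u t) W := memForm_formGradient (hu.memForm t ht)
  set v : Space d → ℝ := fun z => max (u t z - κ) 0 with hv
  have hζs : ContDiff ℝ ∞ (fun z => 2 * η z ^ 2) := contDiff_const.mul (hη.pow 2)
  have hζsub : Function.support (fun z => 2 * η z ^ 2) ⊆ tsupport η := fun z hz => by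
    by_contra hcon
    simp [image_eq_zero_of_notMem_tsupport hcon] at hz
  have hζt : tsupport (fun z => 2 * η z ^ 2) ⊆ tsupport η :=
    closure_minimal hζsub (isClosed_tsupport η)
  have hζc : HasCompactSupport (fun z => 2 * η z ^ 2) :=
    HasCompactSupport.of_support_subset_isCompact hηc.isCompact hζsub
  have hφ := hW.mul_truncation h hd hp hζs hζc (hζt.trans (hηS.trans hSG)) hκ
  have hV := hW.mul_truncation h hd hp hη hηc (hηS.trans hSG) hκ
  -- The test function `2 η² (u t - κ)_+` is the `L²(Λ dx)` gradient at `u t` of `v ↦ ∫ η² (v -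
  -- κ)_+² Λ`, so the time term becomes the derivative of that integral.
  set φ : Space d → ℝ := fun z => 2 * η z ^ 2 * max (u t z - κ) 0 with hφdef
  have hsub := hu.deriv_add_le φ ⟨_, hφ⟩ (.of_forall fun z =>
    mul_nonneg (by positivity) (le_max_right _ _)) t ht
  have e1 : (fun t' => ∫ z in G, u t' z * φ z ∂(weightedMeasure Lam)) = fun t' => ∫ z in G,
        u t' z * (η z ^ 2 * (2 * max (u t z - κ) 0)) ∂(weightedMeasure Lam) := by
    ext t'
    congr with z
    simp only [hφdef]
    ring
  rw [e1] at hsub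
  set D := deriv (fun t' => ∫ z in G,
        u t' z * (η z ^ 2 * (2 * max (u t z - κ) 0)) ∂(weightedMeasure Lam)) t
  have hφu := hφ.mono (subset_univ G)
  -- `formGradient` is an arbitrary choice; closability identifies it with the explicit gradient of
  -- `φ`.
  have hae := (memForm_formGradient ⟨_, hφu⟩).ae_eq h hd hp hq hφu
  set Y := ∫ z in S, max (u t z - κ) 0 ^ 2 ∂(weightedMeasure Lam) with hY
  have hv2 : Integrable (S.indicator fun z => v z ^ 2) (weightedMeasure Lam) :=
    ((hu.memLp ht).posPart_sub hκ).integrable_sq.indicator hS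
  obtain ⟨hi1, hi2⟩ := h.integrable_and_integral_weightedMeasure hd hv2
  rw [integral_indicator hS] at hi2
  have hi3 := h.integrable_pairing hW.2.1.aemeasurable hφ.2.1.aemeasurable
    (hW.energy_lt_top h hp) (hφ.energy_lt_top h hp)
  set f : Space d → ℝ := fun z => 2 * pairing (a z) (W z)
    ((2 * η z ^ 2 * if κ < u t z then 1 else 0) • W z +
      max (u t z - κ) 0 • gradient (fun z => 2 * η z ^ 2) z) +
    10 * c ^ 2 * (Lam z * S.indicator (fun z => v z ^ 2) z) with hf
  have hfi : Integrable f := (hi3.const_mul 2).add (hi1.const_mul _)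
  have hfint : ∫ z, f z = 2 * dirichletForm a Lam (u t) φ + 10 * c ^ 2 * Y := by
    rw [hf, integral_add (hi3.const_mul 2) (hi1.const_mul _), integral_const_mul,
      integral_const_mul, ← hi2, dirichletForm]
    congr 2
    refine integral_congr_ae ?_
    filter_upwards [hae] with z hz
    rw [hz]
  have hle : ∀ᵐ z, pairing (a z) ((η z * if κ < u t z then 1 else 0) • W z +
      max (u t z - κ) 0 • gradient η z) ((η z * if κ < u t z then 1 else 0) • W z +
      max (u t z - κ) 0 • gradient η z) ≤ f z := by
    filter_upwards [h.symm, h.nonneg, h.upper, h.upper_pos hd] with z hs hn hup hΛ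
    refine (pairing_cutoff_le hs hn (W z) (gradient η z) (η z) (if κ < u t z then 1 else 0)
      (max (u t z - κ) 0) (by split_ifs <;> simp) fun h0 => ?_).trans ?_
    · have : ¬ κ < u t z := fun hlt => by simp [hlt] at h0
      exact max_eq_right (by linarith)
    · rw [hf]
      simp only [gradient_const_mul_sq hη]
      refine add_le_add le_rfl ?_
      rw [mul_assoc]
      refine mul_le_mul_of_nonneg_left ?_ (by norm_num)
      by_cases hz : z ∈ S
      · rw [indicator_of_mem hz]
        have h1 : pairing (a z) (gradient η z) (gradient η z) ≤ Lam z * c ^ 2 :=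
          (hup _).trans (by gcongr; exact hgrad z)
        calc v z ^ 2 * pairing (a z) (gradient η z) (gradient η z)
            ≤ v z ^ 2 * (Lam z * c ^ 2) := by gcongr
          _ = _ := by ring
      · have : gradient η z = 0 := by
          by_contra hcon
          have h1 : z ∈ Function.support (fderiv ℝ η) := by
            rwa [Function.mem_support, ← norm_ne_zero_iff, ← norm_gradient, norm_ne_zero_iff]
          exact hz (hηS (support_fderiv_subset ℝ h1))
        rw [this, pairing_zero_left, indicator_of_notMem hz]
        simp
  have hf0 : 0 ≤ᵐ[volume] f := by
    filter_upwards [hle, h.nonneg] with z hz hn using (hn _).trans hz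
  have hfin : ∫ z, f z ≤ -2 * D + 10 * c ^ 2 * Y := by rw [hfint]; linarith
  refine ⟨_, hV, ?_, (integral_nonneg_of_ae hf0).trans hfin⟩
  refine le_trans ?_ (ENNReal.ofReal_le_ofReal hfin)
  rw [ofReal_integral_eq_lintegral_ofReal hfi hf0]
  exact lintegral_mono_ae (hle.mono fun z hz => ENNReal.ofReal_le_ofReal hz)

end IsSubcaloric

end DegenerateParabolic

/-! ### Caccioppoli's inequality on shrinking cylinders. -/

namespace DegenerateParabolic

variable {d : ℕ} {a : Space d → Matrix (Fin d) (Fin d) ℝ} {lam Lam : Space d → ℝ} {p q : ℝ≥0∞}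

/-- The integral `∫_{B(x,R)} (u_t - κ)_+² Λ dz`. -/
noncomputable def excess (Lam : Space d → ℝ) (u : ℝ → Space d → ℝ) (x : Space d) (κ R t : ℝ) : ℝ :=
  ∫ z in Metric.ball x R, max (u t z - κ) 0 ^ 2 ∂(weightedMeasure Lam)

lemma excess_nonneg (u : ℝ → Space d → ℝ) (x : Space d) (κ R t : ℝ) :
    0 ≤ excess Lam u x κ R t :=
  integral_nonneg fun _ => sq_nonneg _

lemma ofReal_excess {u : ℝ → Space d → ℝ} {t : ℝ} (hu : MemLp (u t) 2 (weightedMeasure Lam))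
    (x : Space d) {κ : ℝ} (hκ : 0 ≤ κ) (R : ℝ) : ENNReal.ofReal (excess Lam u x κ R t) =
      ∫⁻ z in Metric.ball x R, ENNReal.ofReal (max (u t z - κ) 0 ^ 2) ∂(weightedMeasure Lam) :=
  ofReal_integral_eq_lintegral_ofReal (hu.posPart_sub hκ).integrable_sq.integrableOn
    (.of_forall fun _ => sq_nonneg _)

lemma excess_mono {u : ℝ → Space d → ℝ} {t : ℝ} (hu : MemLp (u t) 2 (weightedMeasure Lam))
    (x : Space d) {κ κ' R R' : ℝ} (hκ : 0 ≤ κ) (hκκ' : κ ≤ κ') (hR : R' ≤ R) :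
    excess Lam u x κ' R' t ≤ excess Lam u x κ R t := by
  have hi {κ : ℝ} (hκ : 0 ≤ κ) (R : ℝ) :
      IntegrableOn (fun z => max (u t z - κ) 0 ^ 2) (Metric.ball x R) (weightedMeasure Lam) :=
    (hu.posPart_sub hκ).integrable_sq.integrableOn
  refine (setIntegral_mono_set (hi (hκ.trans hκκ') R) (.of_forall fun _ => sq_nonneg _)
    (Metric.ball_subset_ball hR).eventuallyLE).trans ?_
  refine integral_mono (hi (hκ.trans hκκ') R) (hi hκ R) fun z => ?_
  dsimp only
  gcongr

namespace IsSubcaloric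

variable {I : Set ℝ} {G : Set (Space d)} {u : ℝ → Space d → ℝ}

lemma hasDerivAt_integral (hu : IsSubcaloric a Lam I G u) (hI : IsOpen I) {t : ℝ} (ht : t ∈ I)
    {κ : ℝ} (hκ : 0 ≤ κ) {χ : Space d → ℝ} (hχ : Measurable χ) (hχ1 : ∀ x, |χ x| ≤ 1) :
    HasDerivAt (fun t' => ∫ z in G, χ z * max (u t' z - κ) 0 ^ 2 ∂(weightedMeasure Lam))
      (deriv (fun t' => ∫ z in G, u t' z * (χ z * (2 * max (u t z - κ) 0))
        ∂(weightedMeasure Lam)) t) t :=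
  hasDerivAt_integral_posPart_sq hI (fun _ ht => (hu.memLp ht).restrict G) ht
    (fun φ hφ => hu.differentiableAt φ hφ t ht) hκ hχ.aestronglyMeasurable hχ1

lemma excess_eq (Lam : Space d → ℝ) (u : ℝ → Space d → ℝ) (x : Space d) {κ R : ℝ} {t : ℝ}
    (hR : Metric.ball x R ⊆ G) : excess Lam u x κ R t = ∫ z in G,
      (Metric.ball x R).indicator (fun _ => 1) z * max (u t z - κ) 0 ^ 2
        ∂(weightedMeasure Lam) := by
  have e (z : Space d) : (Metric.ball x R).indicator (fun _ => (1 : ℝ)) z *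
      max (u t z - κ) 0 ^ 2 = (Metric.ball x R).indicator (fun z => max (u t z - κ) 0 ^ 2) z := by
    by_cases hz : z ∈ Metric.ball x R <;> simp [hz]
  simp only [e]
  rw [setIntegral_indicator measurableSet_ball, inter_eq_right.2 hR]
  rfl

/-- The derivative formula asks only for a bounded measurable weight, so it applies to the indicator
of a ball. -/
lemma continuousOn_excess (hu : IsSubcaloric a Lam I G u) (hI : IsOpen I) (x : Space d) {κ R : ℝ}
    (hκ : 0 ≤ κ) (hR : Metric.ball x R ⊆ G) : ContinuousOn (excess Lam u x κ R) I := fun t ht => by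
  rw [show excess Lam u x κ R = _ from funext fun t => excess_eq Lam u x hR]
  refine (hu.hasDerivAt_integral hI ht hκ (measurable_const.indicator measurableSet_ball)
    fun z => ?_).continuousAt.continuousWithinAt
  by_cases hz : z ∈ Metric.ball x R <;> simp [hz]

end IsSubcaloric

/-- Caccioppoli's inequality on shrinking cylinders, combined with interpolation. -/
lemma exists_caccioppoli (hd : 2 ≤ d) (hp : 1 ≤ p) (hq : 1 ≤ q)
    (hpq : p⁻¹ + q⁻¹ < 2 / (d : ℝ≥0∞)) (hdq : d = 2 → q ≠ ⊤) : ∃ M : ℝ, 0 < M ∧ ∃ C : NNReal,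
    ∀ {a : Space d → Matrix (Fin d) (Fin d) ℝ} {lam Lam : Space d → ℝ},
    IsCoefficient a lam Lam p q → ∀ {T₀ s r : ℝ} {x : Space d} {u : ℝ → Space d → ℝ},
    IsSubcaloric a Lam (Ioo T₀ s) (Metric.ball x r) u → ∀ {κ R' R T₁ T₂ Z : ℝ},
    0 ≤ κ → 0 < R' → R' < R → R ≤ r → T₀ ≤ T₁ → T₁ < T₂ → 0 ≤ Z →
    ∫⁻ t in Ioo T₁ s, ENNReal.ofReal (excess Lam u x κ R t) ≤ ENNReal.ofReal Z →
    (∀ t ∈ Ioo T₂ s, excess Lam u x κ R' t ≤ (1 / (T₂ - T₁) + M / (R - R') ^ 2) * Z) ∧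
    ∃ g : ℝ → ℝ≥0∞,
      ∫⁻ t in Ioo T₂ s, g t ≤ ENNReal.ofReal (2 * ((1 / (T₂ - T₁) + M / (R - R') ^ 2) * Z)) ∧
      ∀ t ∈ Ioo T₂ s, ENNReal.ofReal (excess Lam u x κ R' t) ≤
        C * eLpNorm (fun z => (lam z)⁻¹) q (volume.restrict (Metric.ball x r)) *
        eLpNorm Lam p (volume.restrict (Metric.ball x r)) ^ (2 - nu d p q) * g t *
        weightedMeasure Lam (Metric.ball x R ∩ {z | κ < u t z}) ^ (nu d p q - 1) := by
  obtain ⟨M, hM0, hM⟩ := exists_cutoff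
  obtain ⟨C, hC⟩ := exists_interpolation hd hp hq hpq hdq
  -- Half of the factor `10` in the energy inequality, with `|∇η| ≤ M / (R - R')`.
  refine ⟨5 * M ^ 2, by positivity, C, fun {a lam Lam} h {T₀ s r x u} hu {κ R' R T₁ T₂ Z}
    hκ hR' hRR hRr hT hT12 hZ hyZ => ?_⟩
  obtain ⟨η, hηs, hηc, hηR, hη1, hη0, hηle, hηg⟩ := hM x R' R hR' hRR
  have hd0 : 0 < d := by omega
  have hν := one_lt_nu hd hp hpq
  have hsubG : Metric.ball x R ⊆ Metric.ball x r := Metric.ball_subset_ball hRr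
  have hsubG' : Metric.ball x R' ⊆ Metric.ball x r :=
    (Metric.ball_subset_ball hRR.le).trans hsubG
  have hI : Ioo T₁ s ⊆ Ioo T₀ s := Ioo_subset_Ioo_left hT
  have hI2 : Ioo T₂ s ⊆ Ioo T₁ s := Ioo_subset_Ioo_left hT12.le
  have hηsq (z : Space d) : |η z ^ 2| ≤ 1 := by
    rw [abs_of_nonneg (sq_nonneg _)]
    exact pow_le_one₀ (hη0 z) (hηle z)
  have hηm : Measurable fun z => η z ^ 2 := (hηs.continuous.pow 2).measurable
  have hind (R : ℝ) (z : Space d) : |(Metric.ball x R).indicator (fun _ => (1 : ℝ)) z| ≤ 1 := by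
    by_cases hz : z ∈ Metric.ball x R <;> simp [hz]
  have hindm (R : ℝ) : Measurable ((Metric.ball x R).indicator fun _ => (1 : ℝ)) :=
    measurable_const.indicator measurableSet_ball
  have hint {χ : Space d → ℝ} (hχ : Measurable χ) (hχ1 : ∀ x, |χ x| ≤ 1) {t : ℝ}
      (ht : t ∈ Ioo T₁ s) : IntegrableOn (fun z => χ z * max (u t z - κ) 0 ^ 2)
        (Metric.ball x r) (weightedMeasure Lam) :=
    integrable_mul_posPart_sq ((hu.memLp (hI ht)).restrict _) hκ hχ.aestronglyMeasurable hχ1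
  set Φ : ℝ → ℝ := fun t => ∫ z in Metric.ball x r, η z ^ 2 * max (u t z - κ) 0 ^ 2
    ∂(weightedMeasure Lam) with hΦ
  have hΦy (t : ℝ) (ht : t ∈ Ioo T₁ s) : Φ t ≤ excess Lam u x κ R t := by
    rw [IsSubcaloric.excess_eq Lam u x hsubG]
    refine integral_mono (hint hηm hηsq ht) (hint (hindm R) (hind R) ht) fun z => ?_
    dsimp only
    gcongr
    by_cases hz : z ∈ Metric.ball x R
    · simpa [hz] using (abs_le.1 (hηsq z)).2
    · have : η z = 0 := image_eq_zero_of_notMem_tsupport fun h => hz (hηR h)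
      simp [hz, this]
  have hyΦ (t : ℝ) (ht : t ∈ Ioo T₁ s) : excess Lam u x κ R' t ≤ Φ t := by
    rw [IsSubcaloric.excess_eq Lam u x hsubG']
    refine integral_mono (hint (hindm R') (hind R') ht) (hint hηm hηsq ht) fun z => ?_
    dsimp only
    gcongr
    by_cases hz : z ∈ Metric.ball x R'
    · simp [hz, hη1 z hz]
    · simpa [hz] using sq_nonneg (η z)
  have hen (t : ℝ) (ht : t ∈ Ioo T₁ s) := hu.energy_le h hd0 hp hq (hI ht) hκ hηs hηc
    measurableSet_ball hηR hsubG hηg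
  obtain ⟨h1, h2⟩ := sup_le_and_lintegral_le_of_hasDerivAt (b := 10 * (M / (R - R')) ^ 2) hT12
    (by positivity) hZ (fun t ht => hu.hasDerivAt_integral isOpen_Ioo (hI ht) hκ hηm hηsq)
    ((hu.continuousOn_excess isOpen_Ioo x hκ hsubG).mono hI)
    (fun t ht => (excess_nonneg u x κ R' t).trans (hyΦ t ht)) hΦy
    (fun t ht => (hen t ht).choose_spec.2.2) hyZ
  have e1 : 1 / (T₂ - T₁) + 10 * (M / (R - R')) ^ 2 / 2 =
      1 / (T₂ - T₁) + 5 * M ^ 2 / (R - R') ^ 2 := by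
    rw [div_pow]; ring
  refine ⟨fun t ht => (hyΦ t (hI2 ht)).trans ((h1 t ht).trans_eq (by rw [e1])), _,
    h2.trans_eq ?_, fun t ht => ?_⟩
  · rw [← e1]; congr 1; ring
  · obtain ⟨V, hV, hVe, -⟩ := hen t (hI2 ht)
    -- `u t` is only almost everywhere measurable, so the level set is replaced by a measurable hull
    -- of the same measure.
    set S := toMeasurable (weightedMeasure Lam) (Metric.ball x R ∩ {z | κ < u t z}) ∩
      Metric.ball x r with hS
    have hsupp : Function.support (fun z => η z * max (u t z - κ) 0) ⊆ S := fun z hz => by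
      rw [Function.mem_support, mul_ne_zero_iff] at hz
      have hzR : z ∈ Metric.ball x R := hηR (subset_tsupport η hz.1)
      refine ⟨subset_toMeasurable _ _ ⟨hzR, ?_⟩, hsubG hzR⟩
      by_contra hcon
      exact hz.2 (max_eq_right (by simpa using hcon))
    have key := hC h hV (h.memLp_lower x r).2.ne
      ((measurableSet_toMeasurable _ _).inter measurableSet_ball) inter_subset_right hsupp
    have hle : ENNReal.ofReal (excess Lam u x κ R' t) ≤
        eLpNorm (fun z => η z * max (u t z - κ) 0) 2 (weightedMeasure Lam) ^ 2 := by
      rw [ofReal_excess (hu.memLp (hI (hI2 ht))) x hκ, eLpNorm_two_sq]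
      refine le_trans (le_of_eq ?_) (setLIntegral_le_lintegral (Metric.ball x R') _)
      refine setLIntegral_congr_fun measurableSet_ball fun z hz => ?_
      rw [hη1 z hz, one_mul, Real.enorm_eq_ofReal (le_max_right _ _),
        ENNReal.ofReal_pow (le_max_right _ _)]
    have hSle : weightedMeasure Lam S ≤
        weightedMeasure Lam (Metric.ball x R ∩ {z | κ < u t z}) :=
      (measure_mono inter_subset_left).trans_eq (measure_toMeasurable _)
    refine hle.trans (key.trans ?_)
    exact mul_le_mul' (mul_le_mul' le_rfl hVe) (ENNReal.rpow_le_rpow hSle (by linarith))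

end DegenerateParabolic

/-! ### One step of the iteration. -/

namespace DegenerateParabolic

variable {d : ℕ} {a : Space d → Matrix (Fin d) (Fin d) ℝ} {lam Lam : Space d → ℝ} {p q : ℝ≥0∞}

/-- Chebyshev's inequality for level sets. -/
lemma measure_level_le {u : ℝ → Space d → ℝ} {t : ℝ} (hu : MemLp (u t) 2 (weightedMeasure Lam))
    (x : Space d) {κ₀ κ₁ : ℝ} (hκ : 0 ≤ κ₀) (hκκ : κ₀ < κ₁) (R : ℝ) :
    weightedMeasure Lam (Metric.ball x R ∩ {z | κ₁ < u t z}) ≤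
      ENNReal.ofReal (excess Lam u x κ₀ R t / (κ₁ - κ₀) ^ 2) := by
  have hpos : 0 < (κ₁ - κ₀) ^ 2 := pow_pos (sub_pos.2 hκκ) 2
  rw [ENNReal.ofReal_div_of_pos hpos, ofReal_excess hu x hκ]
  have hm : AEMeasurable (fun z => ENNReal.ofReal (max (u t z - κ₀) 0 ^ 2))
      ((weightedMeasure Lam).restrict (Metric.ball x R)) :=
    (((hu.posPart_sub hκ).1.aemeasurable.pow_const 2).ennreal_ofReal).restrict
  refine le_trans ?_ (meas_ge_le_lintegral_div hm (ENNReal.ofReal_pos.2 hpos).ne' (by simp))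
  rw [inter_comm]
  refine (Measure.le_restrict_apply _ _).trans (measure_mono fun z (hz : κ₁ < u t z) => ?_)
  refine ENNReal.ofReal_le_ofReal (pow_le_pow_left₀ (sub_pos.2 hκκ).le ?_ 2)
  exact (sub_le_sub_right hz.le _).trans (le_max_left _ _)

/-- One step of De Giorgi's iteration. -/
lemma exists_deGiorgi_step (hd : 2 ≤ d) (hp : 1 ≤ p) (hq : 1 ≤ q)
    (hpq : p⁻¹ + q⁻¹ < 2 / (d : ℝ≥0∞)) (hdq : d = 2 → q ≠ ⊤) : ∃ M : ℝ, 0 < M ∧ ∃ C : NNReal,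
    ∀ {a : Space d → Matrix (Fin d) (Fin d) ℝ} {lam Lam : Space d → ℝ},
    IsCoefficient a lam Lam p q → ∀ {T₀ s r : ℝ} {x : Space d} {u : ℝ → Space d → ℝ},
    IsSubcaloric a Lam (Ioo T₀ s) (Metric.ball x r) u → ∀ {κ₀ κ₁ R₀ R₁ T₁ T₂ Z N B : ℝ},
    0 ≤ κ₀ → κ₀ < κ₁ → 0 < R₁ → R₁ < R₀ → R₀ ≤ r → T₀ ≤ T₁ → T₁ < T₂ → 0 ≤ Z → 0 ≤ N →
    C * eLpNorm (fun z => (lam z)⁻¹) q (volume.restrict (Metric.ball x r)) *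
      eLpNorm Lam p (volume.restrict (Metric.ball x r)) ^ (2 - nu d p q) ≤ ENNReal.ofReal N →
    2 / (T₂ - T₁) + M / (R₀ - R₁) ^ 2 ≤ B →
    ∫⁻ t in Ioo T₁ s, ENNReal.ofReal (excess Lam u x κ₀ R₀ t) ≤ ENNReal.ofReal Z →
    ∫⁻ t in Ioo T₂ s, ENNReal.ofReal (excess Lam u x κ₁ R₁ t) ≤
      ENNReal.ofReal (N * (2 * (B * Z)) * ((B * Z) / (κ₁ - κ₀) ^ 2) ^ (nu d p q - 1)) := by
  obtain ⟨M, hM0, C, hC⟩ := exists_caccioppoli hd hp hq hpq hdq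
  refine ⟨4 * M, by positivity, C, fun {a lam Lam} h {T₀ s r x u} hu {κ₀ κ₁ R₀ R₁ T₁ T₂ Z N B}
    hκ hκκ hR₁ hRR hR₀ hT₁ hTT hZ hN hCN hB hY => ?_⟩
  have hν := one_lt_nu hd hp hpq
  -- Caccioppoli is used twice, with a halfway cylinder between. At level `κ₀` it bounds the excess
  -- uniformly in time, hence by Chebyshev the set where `u > κ₁`; at level `κ₁` it bounds the
  -- energy. Halving the gaps turns `1` into `2` in the time term and `M` into `4 M` in the space
  -- term.
  set R := (R₀ + R₁) / 2 with hR
  set T := (T₁ + T₂) / 2 with hT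
  have e1 : 1 / (T - T₁) + M / (R₀ - R) ^ 2 = 2 / (T₂ - T₁) + 4 * M / (R₀ - R₁) ^ 2 := by
    have : T - T₁ = (T₂ - T₁) / 2 := by rw [hT]; ring
    have h' : R₀ - R = (R₀ - R₁) / 2 := by rw [hR]; ring
    rw [this, h', div_pow, one_div_div, div_div_eq_mul_div]; ring
  have e2 : 1 / (T₂ - T) + M / (R - R₁) ^ 2 = 2 / (T₂ - T₁) + 4 * M / (R₀ - R₁) ^ 2 := by
    have : T₂ - T = (T₂ - T₁) / 2 := by rw [hT]; ring
    have h' : R - R₁ = (R₀ - R₁) / 2 := by rw [hR]; ring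
    rw [this, h', div_pow, one_div_div, div_div_eq_mul_div]; ring
  have hTlt : T₁ < T := by rw [hT]; linarith
  have hTlt' : T < T₂ := by rw [hT]; linarith
  have hRlt : R < R₀ := by rw [hR]; linarith
  have hRlt' : R₁ < R := by rw [hR]; linarith
  have hsub : Ioo T s ⊆ Ioo T₁ s := Ioo_subset_Ioo_left hTlt.le
  have hsub0 : Ioo T s ⊆ Ioo T₀ s := hsub.trans (Ioo_subset_Ioo_left hT₁)
  obtain ⟨hsup, -⟩ := hC h hu hκ (hR₁.trans hRlt') hRlt hR₀ hT₁ hTlt hZ hY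
  have hY' : ∫⁻ t in Ioo T s, ENNReal.ofReal (excess Lam u x κ₁ R t) ≤ ENNReal.ofReal Z := by
    refine le_trans ?_ hY
    refine (setLIntegral_mono' measurableSet_Ioo fun t ht => ENNReal.ofReal_le_ofReal
      (excess_mono (hu.memLp (hsub0 ht)) x hκ hκκ.le hRlt.le)).trans (lintegral_mono_set hsub)
  obtain ⟨-, g, hg, hgle⟩ := hC h hu (hκ.trans hκκ.le) hR₁ hRlt' (hRlt.le.trans hR₀)
    (hT₁.trans hTlt.le) hTlt' hZ hY'
  rw [e1] at hsup
  rw [e2] at hg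
  have hBZ : (2 / (T₂ - T₁) + 4 * M / (R₀ - R₁) ^ 2) * Z ≤ B * Z := by gcongr
  have hB0 : 0 ≤ B := by
    refine le_trans ?_ hB
    have : 0 < T₂ - T₁ := sub_pos.2 hTT
    positivity
  have hκ2 : 0 < (κ₁ - κ₀) ^ 2 := pow_pos (sub_pos.2 hκκ) 2
  have hle (t : ℝ) (ht : t ∈ Ioo T₂ s) : ENNReal.ofReal (excess Lam u x κ₁ R₁ t) ≤
      ENNReal.ofReal N * ENNReal.ofReal (((B * Z) / (κ₁ - κ₀) ^ 2) ^ (nu d p q - 1)) * g t := by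
    have ht' : t ∈ Ioo T s := ⟨hTlt'.trans ht.1, ht.2⟩
    have h1 : weightedMeasure Lam (Metric.ball x R ∩ {z | κ₁ < u t z}) ≤
        ENNReal.ofReal ((B * Z) / (κ₁ - κ₀) ^ 2) := by
      refine (measure_level_le (hu.memLp (hsub0 ht')) x hκ hκκ R).trans
        (ENNReal.ofReal_le_ofReal ?_)
      gcongr
      exact (hsup t ht').trans hBZ
    refine (hgle t ht).trans ?_
    rw [mul_right_comm (ENNReal.ofReal N),
      ← ENNReal.ofReal_rpow_of_nonneg (by positivity) (by linarith)]
    exact mul_le_mul' (mul_le_mul' hCN le_rfl) (ENNReal.rpow_le_rpow h1 (by linarith))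
  refine (setLIntegral_mono' measurableSet_Ioo hle).trans ?_
  rw [lintegral_const_mul' _ _ (by finiteness)]
  refine (mul_le_mul' le_rfl (hg.trans (ENNReal.ofReal_le_ofReal
    (mul_le_mul_of_nonneg_left hBZ zero_le_two)))).trans_eq ?_
  rw [← ENNReal.ofReal_mul hN, ← ENNReal.ofReal_mul (by positivity)]
  congr 1
  ring

end DegenerateParabolic

/-! ### Geometric decay and the local boundedness estimate. -/

namespace DegenerateParabolic

variable {d : ℕ} {a : Space d → Matrix (Fin d) (Fin d) ℝ} {lam Lam : Space d → ℝ} {p q : ℝ≥0∞}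

/-- The geometric decay rate of De Giorgi's iteration. -/
noncomputable def decayRate (θ : ℝ) : ℝ := (4 * 16 ^ θ)⁻¹ ^ θ⁻¹

lemma decayRate_pos (θ : ℝ) : 0 < decayRate θ := by unfold decayRate; positivity

/-- The rate is defined by this balance: step `n` loses `4ⁿ` from the cylinder gaps in the linear
factor and `16ⁿ`, from those gaps and the level gap, inside the power `θ`. -/
lemma decayRate_rpow {θ : ℝ} (hθ : 0 < θ) : 4 * (16 * decayRate θ) ^ θ = 1 := by
  rw [Real.mul_rpow (by norm_num) (decayRate_pos θ).le, decayRate,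
    ← Real.rpow_mul (by positivity), inv_mul_cancel₀ hθ.ne', Real.rpow_one, ← mul_assoc]
  exact mul_inv_cancel₀ (by positivity)

lemma decayRate_lt_one {θ : ℝ} (hθ : 0 < θ) : decayRate θ < 1 := by
  refine Real.rpow_lt_one (by positivity) (inv_lt_one_of_one_lt₀ ?_) (inv_pos.2 hθ)
  have : (1 : ℝ) ≤ 16 ^ θ := Real.one_le_rpow (by norm_num) hθ.le
  linarith

/-- With the balance of `decayRate_rpow` all dependence on `n` beyond `Z εⁿ` cancels, so the
smallness condition at step `0` yields one factor `ε` at every step. The `4` in `4 b Z / k²` comes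
from the first level gap `k/2`. -/
lemma deGiorgi_recursion {θ N b Z k : ℝ} (hθ : 0 < θ) (hb : 0 ≤ b) (hZ : 0 ≤ Z)
    (hk : 0 < k) (hsmall : N * (2 * b) * (4 * b * Z / k ^ 2) ^ θ ≤ decayRate θ) (n : ℕ) :
    N * (2 * (4 ^ n * b * (Z * decayRate θ ^ n))) *
      ((4 ^ n * b * (Z * decayRate θ ^ n)) / (k * (1 / 2) ^ (n + 1)) ^ 2) ^ θ ≤
      Z * decayRate θ ^ (n + 1) := by
  set ε := decayRate θ with hε
  have hε0 : 0 < ε := decayRate_pos θ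
  have e1 : (4 ^ n * b * (Z * ε ^ n)) / (k * (1 / 2) ^ (n + 1)) ^ 2 =
      (4 * b * Z / k ^ 2) * (16 * ε) ^ n := by
    have h4 : ((1 / 2 : ℝ) ^ (n + 1)) ^ 2 = (4 * 4 ^ n)⁻¹ := by
      rw [one_div, inv_pow, inv_pow, ← pow_mul, mul_comm (n + 1) 2, pow_mul, pow_succ, mul_comm]
      norm_num
    have h16 : (16 : ℝ) ^ n = 4 ^ n * 4 ^ n := by rw [← mul_pow]; norm_num
    rw [mul_pow k, h4, mul_pow, h16]
    field_simp
  have e2 : ((16 * ε) ^ n) ^ θ = ((16 * ε) ^ θ) ^ n := by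
    rw [← Real.rpow_natCast, ← Real.rpow_mul (by positivity), mul_comm (n : ℝ) θ,
      Real.rpow_mul (by positivity), Real.rpow_natCast]
  rw [e1, Real.mul_rpow (by positivity) (by positivity), e2]
  have e3 : (4 * (16 * ε) ^ θ) ^ n = 1 := by rw [decayRate_rpow hθ, one_pow]
  calc N * (2 * (4 ^ n * b * (Z * ε ^ n))) * ((4 * b * Z / k ^ 2) ^ θ * ((16 * ε) ^ θ) ^ n)
      = (N * (2 * b) * (4 * b * Z / k ^ 2) ^ θ) * (Z * ε ^ n) * (4 * (16 * ε) ^ θ) ^ n := by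
        rw [mul_pow]; ring
    _ ≤ ε * (Z * ε ^ n) * 1 := by rw [e3]; gcongr
    _ = _ := by ring

/-- De Giorgi's local boundedness estimate. -/
lemma exists_deGiorgi (hd : 2 ≤ d) (hp : 1 ≤ p) (hq : 1 ≤ q)
    (hpq : p⁻¹ + q⁻¹ < 2 / (d : ℝ≥0∞)) (hdq : d = 2 → q ≠ ⊤) : ∃ M : ℝ, 0 < M ∧ ∃ C : NNReal,
    ∀ {a : Space d → Matrix (Fin d) (Fin d) ℝ} {lam Lam : Space d → ℝ},
    IsCoefficient a lam Lam p q → ∀ {T₀ s r : ℝ} {x : Space d} {u : ℝ → Space d → ℝ},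
    IsSubcaloric a Lam (Ioo T₀ s) (Metric.ball x r) u → ∀ {R₀ R₁ T₁ T₂ Z N k : ℝ},
    0 < R₁ → R₁ < R₀ → R₀ ≤ r → T₀ ≤ T₁ → T₁ < T₂ → 0 ≤ Z → 0 ≤ N → 0 < k →
    C * eLpNorm (fun z => (lam z)⁻¹) q (volume.restrict (Metric.ball x r)) *
      eLpNorm Lam p (volume.restrict (Metric.ball x r)) ^ (2 - nu d p q) ≤ ENNReal.ofReal N →
    ∫⁻ t in Ioo T₁ s, ENNReal.ofReal (excess Lam u x 0 R₀ t) ≤ ENNReal.ofReal Z →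
    ∀ {b : ℝ}, 4 * (2 / (T₂ - T₁) + M / (R₀ - R₁) ^ 2) ≤ b →
    N * (2 * b) * (4 * b * Z / k ^ 2) ^ (nu d p q - 1) ≤ decayRate (nu d p q - 1) →
    ∀ t ∈ Ioo T₂ s, ∀ᵐ z ∂(volume.restrict (Metric.ball x R₁)), u t z ≤ k := by
  obtain ⟨M, hM0, C, hC⟩ := exists_deGiorgi_step hd hp hq hpq hdq
  refine ⟨M, hM0, C, fun {a lam Lam} h {T₀ s r x u} hu {R₀ R₁ T₁ T₂ Z N k} hR₁ hRR hR₀ hT₁ hTT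
    hZ hN hk hCN hY b hb hsmall => ?_⟩
  have hν := one_lt_nu hd hp hpq
  set θ := nu d p q - 1 with hθ
  have hθ0 : 0 < θ := by rw [hθ]; linarith
  set ε := decayRate θ with hε
  have hε0 : 0 < ε := decayRate_pos θ
  have hδT : 0 < T₂ - T₁ := sub_pos.2 hTT
  have hδR : 0 < R₀ - R₁ := sub_pos.2 hRR
  have hb0 : 0 ≤ b := le_trans (by positivity) hb
  have hpow (n : ℕ) : (0 : ℝ) < (1 / 2) ^ n := by positivity
  have hpow1 (n : ℕ) : ((1 : ℝ) / 2) ^ n ≤ 1 := pow_le_one₀ (by norm_num) (by norm_num)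
  have hsucc (n : ℕ) : ((1 : ℝ) / 2) ^ (n + 1) = (1 / 2) ^ n / 2 := by rw [pow_succ]; ring
  -- Each gap in level, radius and time is `2^-(n+1)` times the total one. The space term scales
  -- like its inverse square, so `4ⁿ b` serves at step `n`, the extra `4` being included in `b`.
  have hiter (n : ℕ) : ∫⁻ t in Ioo (T₂ - (T₂ - T₁) * (1 / 2) ^ n) s, ENNReal.ofReal
      (excess Lam u x (k * (1 - (1 / 2) ^ n)) (R₁ + (R₀ - R₁) * (1 / 2) ^ n) t) ≤
      ENNReal.ofReal (Z * ε ^ n) := by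
    induction n with
    | zero => simpa using hY
    | succ n ih =>
      have hs := hsucc n
      have hn := hpow n
      have hn1 := hpow1 n
      have key := hC h hu (κ₀ := k * (1 - (1 / 2) ^ n)) (κ₁ := k * (1 - (1 / 2) ^ (n + 1)))
        (R₀ := R₁ + (R₀ - R₁) * (1 / 2) ^ n) (R₁ := R₁ + (R₀ - R₁) * (1 / 2) ^ (n + 1))
        (T₁ := T₂ - (T₂ - T₁) * (1 / 2) ^ n) (T₂ := T₂ - (T₂ - T₁) * (1 / 2) ^ (n + 1))
        (Z := Z * ε ^ n) (N := N) (B := 4 ^ n * b) (mul_nonneg hk.le (by linarith))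
        (by rw [hs]; gcongr; linarith) (by positivity)
        (by rw [hs]; gcongr; linarith) (by nlinarith) (by nlinarith)
        (by rw [hs]; gcongr; linarith) (by positivity) hN hCN ?_ ih
      · refine key.trans (ENNReal.ofReal_le_ofReal ?_)
        have e : k * (1 - (1 / 2) ^ (n + 1)) - k * (1 - (1 / 2) ^ n) = k * (1 / 2) ^ (n + 1) := by
          rw [hs]; ring
        rw [e]
        exact deGiorgi_recursion hθ0 hb0 hZ hk hsmall n
      · have e1 : T₂ - (T₂ - T₁) * (1 / 2) ^ (n + 1) - (T₂ - (T₂ - T₁) * (1 / 2) ^ n) =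
            (T₂ - T₁) * (1 / 2) ^ (n + 1) := by rw [hs]; ring
        have e2 : R₁ + (R₀ - R₁) * (1 / 2) ^ n - (R₁ + (R₀ - R₁) * (1 / 2) ^ (n + 1)) =
            (R₀ - R₁) * (1 / 2) ^ (n + 1) := by rw [hs]; ring
        have e3 : ((1 : ℝ) / 2) ^ (n + 1) = (2 ^ (n + 1))⁻¹ := by rw [one_div, inv_pow]
        have e4 : ((2 : ℝ) ^ (n + 1)) ^ 2 = 4 ^ (n + 1) := by
          rw [← pow_mul, mul_comm, pow_mul]; norm_num
        rw [e1, e2, mul_pow, e3, inv_pow, e4]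
        have h24 : (2 : ℝ) ^ (n + 1) ≤ 4 ^ (n + 1) := by gcongr; norm_num
        calc 2 / ((T₂ - T₁) * (2 ^ (n + 1))⁻¹) + M / ((R₀ - R₁) ^ 2 * (4 ^ (n + 1))⁻¹)
            = 2 / (T₂ - T₁) * 2 ^ (n + 1) + M / (R₀ - R₁) ^ 2 * 4 ^ (n + 1) := by
              field_simp
          _ ≤ 2 / (T₂ - T₁) * 4 ^ (n + 1) + M / (R₀ - R₁) ^ 2 * 4 ^ (n + 1) := by gcongr
          _ = 4 ^ n * (4 * (2 / (T₂ - T₁) + M / (R₀ - R₁) ^ 2)) := by rw [pow_succ]; ring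
          _ ≤ 4 ^ n * b := by gcongr
  have hT₂ : Ioo T₂ s ⊆ Ioo T₀ s := Ioo_subset_Ioo_left (hT₁.trans hTT.le)
  -- Each cylinder of the iteration contains the final one and each level is at most `k`, so the
  -- integral at level `k` is below every `Z εⁿ`.
  have hzero : ∫⁻ t in Ioo T₂ s, ENNReal.ofReal (excess Lam u x k R₁ t) = 0 := by
    have hlim : Tendsto (fun n => ENNReal.ofReal (Z * ε ^ n)) atTop (𝓝 0) := by
      have := ((tendsto_pow_atTop_nhds_zero_of_lt_one hε0.le (decayRate_lt_one hθ0)).const_mul Z)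
      rw [mul_zero] at this
      simpa using ENNReal.tendsto_ofReal this
    refine le_antisymm (ge_of_tendsto' hlim fun n => le_trans ?_ (hiter n)) zero_le
    have hn := hpow n
    have hn1 := hpow1 n
    refine (setLIntegral_mono' measurableSet_Ioo fun t ht => ENNReal.ofReal_le_ofReal
      (excess_mono (hu.memLp (hT₂ ht)) x (mul_nonneg hk.le (by linarith)) (by nlinarith)
      (by nlinarith))).trans (lintegral_mono_set (Ioo_subset_Ioo_left (by nlinarith)))
  have hcont := (hu.continuousOn_excess isOpen_Ioo x hk.le
    (Metric.ball_subset_ball (hRR.le.trans hR₀))).mono hT₂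
  have hae : excess Lam u x k R₁ =ᵐ[volume.restrict (Ioo T₂ s)] fun _ => 0 := by
    rw [lintegral_eq_zero_iff' (hcont.aemeasurable measurableSet_Ioo).ennreal_ofReal] at hzero
    filter_upwards [hzero] with t ht
    exact le_antisymm (ENNReal.ofReal_eq_zero.1 ht) (excess_nonneg u x k R₁ t)
  -- Continuity in time upgrades vanishing for almost every `t` to every `t`.
  have heq := Measure.eqOn_open_of_ae_eq hae isOpen_Ioo hcont continuousOn_const
  intro t ht
  have h0 : excess Lam u x k R₁ t = 0 := heq ht
  rw [excess, setIntegral_eq_zero_iff_of_nonneg_ae (.of_forall fun _ => sq_nonneg _)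
    ((hu.memLp (hT₂ ht)).posPart_sub hk.le).integrable_sq.integrableOn] at h0
  rw [EventuallyEq, ae_restrict_iff' measurableSet_ball,
    h.ae_weightedMeasure_iff (by omega)] at h0
  rw [ae_restrict_iff' measurableSet_ball]
  filter_upwards [h0] with z hz hzR
  have := (pow_eq_zero_iff two_ne_zero).1 (hz hzR)
  have := le_max_left (u t z - k) 0
  linarith

end DegenerateParabolic

/-! ### Averaged norms and the explicit constant. -/

namespace DegenerateParabolic

variable {d : ℕ} {a : Space d → Matrix (Fin d) (Fin d) ℝ} {lam Lam : Space d → ℝ} {p q : ℝ≥0∞}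

lemma eLpNorm_eq_mul_avgNorm (f : Space d → ℝ) (p : ℝ≥0∞) {x : Space d} {r : ℝ} (hr : 0 < r) :
    eLpNorm f p (volume.restrict (Metric.ball x r)) =
      volume (Metric.ball x r) ^ (p⁻¹).toReal * avgNorm f p (Metric.ball x r) := by
  have h0 : volume (Metric.ball x r) ≠ 0 := (Metric.measure_ball_pos volume x hr).ne'
  have ht : volume (Metric.ball x r) ≠ ⊤ := measure_ball_lt_top.ne
  rw [avgNorm, eLpNorm_smul_measure_of_ne_zero (ENNReal.inv_ne_zero.2 ht), smul_eq_mul, one_div,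
    ← mul_assoc, ← ENNReal.mul_rpow_of_ne_top ht (ENNReal.inv_ne_top.2 h0),
    ENNReal.mul_inv_cancel h0 ht, ENNReal.one_rpow, one_mul]

lemma volume_ball_eq (x : Space d) {r : ℝ} (hr : 0 < r) :
    volume (Metric.ball x r) =
      ENNReal.ofReal (r ^ d * (volume (Metric.ball (0 : Space d) 1)).toReal) := by
  rw [Measure.addHaar_ball_of_pos _ _ hr, finrank_euclideanSpace_fin, ENNReal.ofReal_mul (by positivity),
    ENNReal.ofReal_toReal measure_ball_lt_top.ne]

namespace IsCoefficient

lemma avgNorm_pos_lt_top {f : Space d → ℝ} {p : ℝ≥0∞} (hp : 1 ≤ p) {x : Space d} {r : ℝ}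
    (hr : 0 < r) (hf : MemLp f p (volume.restrict (Metric.ball x r))) (hpos : ∀ᵐ x, 0 < f x) :
    0 < avgNorm f p (Metric.ball x r) ∧ avgNorm f p (Metric.ball x r) < ⊤ := by
  have h0 : volume (Metric.ball x r) ≠ 0 := (Metric.measure_ball_pos volume x hr).ne'
  have ht : volume (Metric.ball x r) ≠ ⊤ := measure_ball_lt_top.ne
  have he := eLpNorm_eq_mul_avgNorm f p (x := x) hr
  constructor
  · rw [pos_iff_ne_zero]
    intro hz
    rw [hz, mul_zero, eLpNorm_eq_zero_iff hf.1 (zero_lt_one.trans_le hp).ne'] at he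
    have hfalse : ∀ᵐ z ∂(volume.restrict (Metric.ball x r)), False := by
      filter_upwards [he, ae_restrict_of_ae hpos] with z h1 h2
      exact h2.ne' h1
    rw [ae_iff] at hfalse
    simp at hfalse
    exact h0 hfalse
  · rw [lt_top_iff_ne_top]
    intro hz
    have hne : volume (Metric.ball x r) ^ (p⁻¹).toReal ≠ 0 := by
      rw [Ne, ENNReal.rpow_eq_zero_iff]
      simp [h0, ht]
    rw [hz, ENNReal.mul_top hne] at he
    exact hf.2.ne he

lemma sobolevConst_pos_lt_top (h : IsCoefficient a lam Lam p q) (hd : 2 ≤ d) (hp : 1 ≤ p)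
    (hq : 1 ≤ q) (hpq : p⁻¹ + q⁻¹ < 2 / (d : ℝ≥0∞)) (hdq : d = 2 → q ≠ ⊤) (x : Space d) {r : ℝ}
    (hr : 0 < r) : 0 < sobolevConst lam Lam p q (Metric.ball x r) ∧
      sobolevConst lam Lam p q (Metric.ball x r) < ⊤ := by
  have h1 := avgNorm_pos_lt_top hq hr (h.memLp_lower x r) (h.pos.mono fun _ h => inv_pos.2 h)
  have h2 := avgNorm_pos_lt_top hp hr (h.memLp_upper x r) (h.upper_pos (by omega))
  have h3 := nu_lt_two hd hp hq hpq hdq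
  unfold sobolevConst
  rw [two_mul_conjExp_div_rho]
  exact ⟨ENNReal.mul_pos h1.1.ne' (ENNReal.rpow_pos h2.1 h2.2.ne).ne',
    ENNReal.mul_lt_top h1.2 (ENNReal.rpow_lt_top_of_nonneg (by linarith) h2.2.ne)⟩

end IsCoefficient

/-- The power of `|B|` released when the two norms in the interpolation constant are replaced by
averages. -/
lemma toReal_inv_add_eq (hd : 2 ≤ d) (hp : 1 ≤ p) (hpq : p⁻¹ + q⁻¹ < 2 / (d : ℝ≥0∞)) :
    (q⁻¹).toReal + (p⁻¹).toReal * (2 - nu d p q) = 2 / d - (nu d p q - 1) := by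
  obtain ⟨-, h2, h3⟩ := inv_conjExp hd hp hpq
  have h4 : (p⁻¹).toReal = 1 - (conjExp p)⁻¹ := by linarith
  have h5 : (conjExp p)⁻¹ * (2 - nu d p q) = 2 * (rho d q)⁻¹ := by
    rw [← two_mul_conjExp_div_rho]
    field_simp
  rw [h4, sub_mul, h5, inv_rho hd, div_eq_mul_inv (2 : ℝ) (d : ℝ)]
  ring

lemma sobolevConst_eq (hd : 2 ≤ d) (hp : 1 ≤ p) (hq : 1 ≤ q)
    (hpq : p⁻¹ + q⁻¹ < 2 / (d : ℝ≥0∞)) (hdq : d = 2 → q ≠ ⊤) (x : Space d) {r : ℝ} (hr : 0 < r) :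
    eLpNorm (fun z => (lam z)⁻¹) q (volume.restrict (Metric.ball x r)) *
      eLpNorm Lam p (volume.restrict (Metric.ball x r)) ^ (2 - nu d p q) =
      volume (Metric.ball x r) ^ (2 / d - (nu d p q - 1)) *
        sobolevConst lam Lam p q (Metric.ball x r) := by
  have hν := nu_lt_two hd hp hq hpq hdq
  have h0 : volume (Metric.ball x r) ≠ 0 := (Metric.measure_ball_pos volume x hr).ne'
  have ht : volume (Metric.ball x r) ≠ ⊤ := measure_ball_lt_top.ne
  rw [eLpNorm_eq_mul_avgNorm _ q hr, eLpNorm_eq_mul_avgNorm _ p hr,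
    ENNReal.mul_rpow_of_nonneg _ _ (by linarith), ← ENNReal.rpow_mul, ← toReal_inv_add_eq hd hp hpq,
    ENNReal.rpow_add _ _ h0 ht, sobolevConst, two_mul_conjExp_div_rho]
  ring

/-- The threshold for De Giorgi's iteration. -/
lemma threshold_eq {θ N b ε Z : ℝ} (hθ : 0 < θ) (hN : 0 < N) (hb : 0 < b) (hε : 0 < ε)
    (hZ : 0 < Z) :
    N * (2 * b) * (4 * b * Z /
      ((4 * b * (N * (2 * b) / ε) ^ θ⁻¹) ^ (1 / 2 : ℝ) * Z ^ (1 / 2 : ℝ)) ^ 2) ^ θ = ε := by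
  have hsq {y : ℝ} (hy : 0 < y) : (y ^ (1 / 2 : ℝ)) ^ 2 = y := by
    rw [← Real.rpow_natCast, ← Real.rpow_mul hy.le]; norm_num
  set D := N * (2 * b) / ε with hD
  have hD0 : 0 < D := by positivity
  have hDθ : 0 < D ^ θ⁻¹ := by positivity
  rw [mul_pow, hsq (by positivity), hsq hZ]
  have e : 4 * b * Z / (4 * b * D ^ θ⁻¹ * Z) = (D ^ θ⁻¹)⁻¹ := by field_simp
  rw [e, Real.inv_rpow hDθ.le, ← Real.rpow_mul hD0.le, inv_mul_cancel₀ hθ.ne', Real.rpow_one, hD]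
  field_simp

/-- By scaling, `b` carries `r^(-2)` and `N` carries `r^(2 - Dθ)`, so the first factor carries
`r^(-1 - D/2)`, which cancels the root of the cylinder volume. The identity is linear in the
logarithms of the parameters, so logarithms are compared. -/
lemma constant_eq {θ ε m c₀ v S A r τ D : ℝ} (hθ : 0 < θ) (hε : 0 < ε) (hm : 0 < m) (hc : 0 < c₀)
    (hv : 0 < v) (hS : 0 < S) (hA : 0 < A) (hr : 0 < r) (hτ : 0 < τ) (hD : 0 < D)
    {V N b : ℝ} (hV : Real.log V = D * Real.log r + Real.log v) (hV0 : 0 < V)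
    (hN : N = c₀ * (V ^ (2 / D - θ) * S)) (hb : b = m * (A / r ^ 2)) :
    (4 * b * (N * (2 * b) / ε) ^ θ⁻¹) ^ (1 / 2 : ℝ) * (τ * r ^ 2 * V) ^ (1 / 2 : ℝ) =
      (2 * (2 / ε) ^ (1 / (2 * θ)) * c₀ ^ (1 / (2 * θ)) * m ^ ((1 + θ) / (2 * θ)) *
        v ^ (1 / (D * θ))) * S ^ (1 / (2 * θ)) * τ ^ (1 / 2 : ℝ) * A ^ ((1 + θ) / (2 * θ)) := by
  have hb0 : 0 < b := by rw [hb]; positivity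
  have hN0 : 0 < N := by rw [hN]; positivity
  refine Real.log_injOn_pos (mem_Ioi.2 (by positivity)) (mem_Ioi.2 (by positivity)) ?_
  have l4 : Real.log 4 = 2 * Real.log 2 := by
    rw [show (4 : ℝ) = 2 ^ 2 by norm_num, Real.log_pow]; norm_num
  have lb : Real.log b = Real.log m + (Real.log A - 2 * Real.log r) := by
    rw [hb, Real.log_mul (by positivity) (by positivity), Real.log_div (by positivity)
      (by positivity), Real.log_pow]
    norm_num
  have lN : Real.log N = Real.log c₀ + ((2 / D - θ) * (D * Real.log r + Real.log v) +
      Real.log S) := by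
    rw [hN, Real.log_mul (by positivity) (by positivity), Real.log_mul (by positivity)
      (by positivity), Real.log_rpow hV0, hV]
  have lL : Real.log ((4 * b * (N * (2 * b) / ε) ^ θ⁻¹) ^ (1 / 2 : ℝ) *
      (τ * r ^ 2 * V) ^ (1 / 2 : ℝ)) =
      1 / 2 * (Real.log 4 + Real.log b + θ⁻¹ * (Real.log N + (Real.log 2 + Real.log b) -
        Real.log ε)) + 1 / 2 * (Real.log τ + 2 * Real.log r + Real.log V) := by
    rw [Real.log_mul (by positivity) (by positivity), Real.log_rpow (by positivity),
      Real.log_rpow (by positivity), Real.log_mul (by positivity) (by positivity),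
      Real.log_mul (by positivity) (by positivity), Real.log_rpow (by positivity),
      Real.log_div (by positivity) (by positivity), Real.log_mul (by positivity) (by positivity),
      Real.log_mul (by positivity) (by positivity), Real.log_mul (by positivity) (by positivity),
      Real.log_mul (by positivity) (by positivity), Real.log_pow]
    norm_num
  have lR : Real.log ((2 * (2 / ε) ^ (1 / (2 * θ)) * c₀ ^ (1 / (2 * θ)) *
      m ^ ((1 + θ) / (2 * θ)) * v ^ (1 / (D * θ))) * S ^ (1 / (2 * θ)) * τ ^ (1 / 2 : ℝ) *
      A ^ ((1 + θ) / (2 * θ))) = Real.log 2 + 1 / (2 * θ) * (Real.log 2 - Real.log ε) +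
      1 / (2 * θ) * Real.log c₀ + (1 + θ) / (2 * θ) * Real.log m + 1 / (D * θ) * Real.log v +
      1 / (2 * θ) * Real.log S + 1 / 2 * Real.log τ + (1 + θ) / (2 * θ) * Real.log A := by
    rw [Real.log_mul (by positivity) (by positivity), Real.log_mul (by positivity) (by positivity),
      Real.log_mul (by positivity) (by positivity), Real.log_mul (by positivity) (by positivity),
      Real.log_mul (by positivity) (by positivity), Real.log_mul (by positivity) (by positivity),
      Real.log_mul (by positivity) (by positivity), Real.log_rpow (by positivity),
      Real.log_rpow hc, Real.log_rpow hm, Real.log_rpow hv, Real.log_rpow hS, Real.log_rpow hτ,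
      Real.log_rpow hA, Real.log_div (by positivity) (by positivity)]
  rw [lL, lR, lN, lb, l4, hV]
  field_simp
  ring

end DegenerateParabolic

/-! ### Comparison with the averaged norm and conclusion. -/

namespace DegenerateParabolic

variable {d : ℕ} {a : Space d → Matrix (Fin d) (Fin d) ℝ} {lam Lam : Space d → ℝ} {p q : ℝ≥0∞}

lemma lintegral_excess_le (h : IsCoefficient a lam Lam p q) (hd : 0 < d) {I J : Set ℝ}
    {G : Set (Space d)} {u : ℝ → Space d → ℝ} (hu : IsSubcaloric a Lam I G u) (hJ : J ⊆ I)
    (hJm : MeasurableSet J) (x : Space d) (R : ℝ) :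
    ∫⁻ t in J, ENNReal.ofReal (excess Lam u x 0 R t) ≤
      ∫⁻ t in J, ∫⁻ z in Metric.ball x R, ENNReal.ofReal (u t z ^ 2 * Lam z) := by
  refine setLIntegral_mono' hJm fun t ht => ?_
  have hut := hu.memLp (hJ ht)
  have hum : AEMeasurable (u t) := (hut.1.mono_ac (h.volume_ac hd)).aemeasurable
  rw [ofReal_excess hut x le_rfl, h.setLIntegral_weightedMeasure
    ((((hum.sub_const 0).max aemeasurable_const).pow_const 2).ennreal_ofReal) measurableSet_ball]
  refine lintegral_mono_ae (ae_restrict_of_ae ?_)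
  filter_upwards [h.upper_pos hd] with z hz
  rw [← ENNReal.ofReal_mul hz.le, mul_comm]
  refine ENNReal.ofReal_le_ofReal (mul_le_mul_of_nonneg_right ?_ hz.le)
  rw [sub_zero, ← sq_abs (u t z)]
  exact pow_le_pow_left₀ (le_max_right _ _) (max_le (le_abs_self _) (abs_nonneg _)) 2

/-- The iteration needs a positive level, hence a positive finite bound `Z`; letting `Z` decrease to
`Y` also covers `Y = 0`. -/
lemma le_mul_rpow_of_forall_lt {X Y : ℝ≥0∞} {c : ℝ} (hc : 0 < c)
    (h : ∀ Z : ℝ, 0 < Z → Y ≤ ENNReal.ofReal Z → X ≤ ENNReal.ofReal (c * Z ^ (1 / 2 : ℝ))) :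
    X ≤ ENNReal.ofReal c * Y ^ (1 / 2 : ℝ) := by
  rcases eq_or_ne Y ⊤ with hY | hY
  · rw [hY, ENNReal.top_rpow_of_pos (by norm_num), ENNReal.mul_top
      (ENNReal.ofReal_pos.2 hc).ne']
    exact le_top
  · have hlim : Tendsto (fun n : ℕ => ENNReal.ofReal
        (c * (Y.toReal + 1 / ((n : ℝ) + 1)) ^ (1 / 2 : ℝ))) atTop
        (𝓝 (ENNReal.ofReal (c * Y.toReal ^ (1 / 2 : ℝ)))) := by
      refine ENNReal.tendsto_ofReal (Tendsto.const_mul c ?_)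
      have h1 : Tendsto (fun n : ℕ => Y.toReal + 1 / ((n : ℝ) + 1)) atTop (𝓝 Y.toReal) := by
        simpa using tendsto_one_div_add_atTop_nhds_zero_nat.const_add Y.toReal
      exact h1.rpow_const (Or.inr (by norm_num))
    refine (ge_of_tendsto' hlim fun n => h _ (by positivity) ?_).trans_eq ?_
    · rw [← ENNReal.ofReal_toReal hY]
      refine ENNReal.ofReal_le_ofReal ?_
      rw [ENNReal.toReal_ofReal ENNReal.toReal_nonneg]
      exact le_add_of_nonneg_right (by positivity)
    · rw [ENNReal.ofReal_mul hc.le, ← ENNReal.ofReal_rpow_of_nonneg ENNReal.toReal_nonneg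
        (by norm_num), ENNReal.ofReal_toReal hY]

/-- Any upper bound `L` for the volume will do, so the volume of the full cylinder can replace that
of the one carrying the norm. -/
lemma lintegral_rpow_le_avgNormTwo {u : ℝ → Space d → ℝ} {x : Space d} {T s R L : ℝ} (hT : T < s)
    (hR : 0 < R) (hL : volume (Ioo T s) * volume (Metric.ball x R) ≤ ENNReal.ofReal L) :
    (∫⁻ t in Ioo T s, ∫⁻ z in Metric.ball x R, ENNReal.ofReal (u t z ^ 2 * Lam z)) ^ (1 / 2 : ℝ) ≤
      ENNReal.ofReal L ^ (1 / 2 : ℝ) * avgNormTwo Lam (Ioo T s) (Metric.ball x R) u := by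
  have h0 : volume (Ioo T s) * volume (Metric.ball x R) ≠ 0 := by
    refine mul_ne_zero ?_ (Metric.measure_ball_pos volume x hR).ne'
    simpa using hT
  have ht : volume (Ioo T s) * volume (Metric.ball x R) ≠ ⊤ :=
    ENNReal.mul_ne_top (by simp) measure_ball_lt_top.ne
  rw [avgNormTwo, ← ENNReal.mul_rpow_of_nonneg _ _ (by norm_num)]
  gcongr
  rw [← mul_assoc]
  refine le_mul_of_one_le_left zero_le ?_
  rw [← ENNReal.mul_inv_cancel h0 ht]
  gcongr

/-- As `σ - σ' ≤ 1`, the time gap, linear in `σ - σ'`, may be bounded below by a quadratic one and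
merged with the space gap. -/
lemma cylinder_gap_le {τ s r σ' σ M : ℝ} (hτ : 0 < τ) (hr : 0 < r) (hΔ : 0 < σ - σ')
    (hΔ1 : σ - σ' ≤ 1) (hM : 0 < M) :
    4 * (2 / (s - σ' * τ * r ^ 2 - (s - σ * τ * r ^ 2)) + M / (σ * r - σ' * r) ^ 2) ≤
      (8 + 4 * M) * ((1 + τ⁻¹) / (σ - σ') ^ 2 / r ^ 2) := by
  have e1 : s - σ' * τ * r ^ 2 - (s - σ * τ * r ^ 2) = (σ - σ') * τ * r ^ 2 := by ring
  have e2 : σ * r - σ' * r = (σ - σ') * r := by ring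
  have e3 : 2 / ((σ - σ') * τ * r ^ 2) ≤ 2 * τ⁻¹ / ((σ - σ') ^ 2 * r ^ 2) := by
    have : 2 / ((σ - σ') * τ * r ^ 2) = 2 * τ⁻¹ / ((σ - σ') * r ^ 2) := by field_simp
    rw [this]
    gcongr
    rw [sq]
    exact mul_le_of_le_one_left hΔ.le hΔ1
  rw [e1, e2, mul_pow, div_div, ← mul_div_assoc]
  calc 4 * (2 / ((σ - σ') * τ * r ^ 2) + M / ((σ - σ') ^ 2 * r ^ 2))
      ≤ 4 * (2 * τ⁻¹ / ((σ - σ') ^ 2 * r ^ 2) + M / ((σ - σ') ^ 2 * r ^ 2)) := by gcongr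
    _ = (8 * τ⁻¹ + 4 * M) / ((σ - σ') ^ 2 * r ^ 2) := by ring
    _ ≤ _ := by
      gcongr
      have : 0 < τ⁻¹ := inv_pos.2 hτ
      nlinarith [mul_pos hM this]

end DegenerateParabolic

theorem mainTheorem6 (d : ℕ) (hd : 2 ≤ d) (p q : ℝ≥0∞) (hp : 1 ≤ p) (hq : 1 ≤ q)
    (hpq : p⁻¹ + q⁻¹ < 2 / (d : ℝ≥0∞)) (hdq : d = 2 → q ≠ ⊤) :
    1 < DegenerateParabolic.nu d p q ∧
    ∃ C₁ : ℝ, 0 < C₁ ∧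
      ∀ (a : DegenerateParabolic.Space d → Matrix (Fin d) (Fin d) ℝ)
        (lam Lam : DegenerateParabolic.Space d → ℝ),
        DegenerateParabolic.IsCoefficient a lam Lam p q →
      ∀ (τ s r σ' σ : ℝ) (x : DegenerateParabolic.Space d),
        0 < τ → 0 < r → 1 / 2 ≤ σ' → σ' < σ → σ ≤ 1 →
      ∀ u : ℝ → DegenerateParabolic.Space d → ℝ,
        DegenerateParabolic.IsSubcaloric a Lam (Ioo (s - τ * r ^ 2) s) (Metric.ball x r) u →
        (∀ t ∈ Ioo (s - τ * r ^ 2) s, ∀ᵐ z, z ∈ Metric.ball x r → 0 ≤ u t z) →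
        DegenerateParabolic.cylinderSup
            (Ioo (s - σ' * τ * r ^ 2) s) (Metric.ball x (σ' * r)) u ≤
          ENNReal.ofReal C₁
            * DegenerateParabolic.sobolevConst lam Lam p q (Metric.ball x r)
                ^ (1 / (2 * DegenerateParabolic.nu d p q - 2))
            * ENNReal.ofReal (τ ^ (1 / 2 : ℝ))
            * ENNReal.ofReal (((1 + τ⁻¹) / (σ - σ') ^ 2)
                ^ (DegenerateParabolic.nu d p q / (2 * DegenerateParabolic.nu d p q - 2)))
            * DegenerateParabolic.avgNormTwo Lam
                (Ioo (s - σ * τ * r ^ 2) s) (Metric.ball x (σ * r)) u := by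
  open DegenerateParabolic in
  have hν := one_lt_nu hd hp hpq
  refine ⟨hν, ?_⟩
  obtain ⟨M, hM0, C, hC⟩ := exists_deGiorgi hd hp hq hpq hdq
  set θ := nu d p q - 1 with hθ
  have hθ0 : 0 < θ := by rw [hθ]; linarith
  have hν1 : 1 / (2 * nu d p q - 2) = 1 / (2 * θ) := by rw [hθ]; ring_nf
  have hν2 : nu d p q / (2 * nu d p q - 2) = (1 + θ) / (2 * θ) := by rw [hθ]; ring_nf
  rw [hν1, hν2]
  have hd0 : (0 : ℝ) < d := by have : 0 < d := by omega
                               exact_mod_cast this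
  set ε := decayRate θ with hε
  have hε0 : 0 < ε := decayRate_pos θ
  set v := (volume (Metric.ball (0 : Space d) 1)).toReal with hv
  have hv0 : 0 < v := ENNReal.toReal_pos (Metric.measure_ball_pos volume _ one_pos).ne'
    measure_ball_lt_top.ne
  obtain ⟨m, hm⟩ : ∃ y : ℝ, y = 8 + 4 * M := ⟨_, rfl⟩
  have hm0 : 0 < m := by rw [hm]; positivity
  -- One is added because `C` may vanish while the logarithms in `constant_eq` require positivity.
  obtain ⟨c₀, hc₀⟩ : ∃ y : ℝ, y = C + 1 := ⟨_, rfl⟩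
  have hc0 : 0 < c₀ := by rw [hc₀]; positivity
  refine ⟨2 * (2 / ε) ^ (1 / (2 * θ)) * c₀ ^ (1 / (2 * θ)) * m ^ ((1 + θ) / (2 * θ)) *
    v ^ (1 / (d * θ)), by positivity, ?_⟩
  intro a lam Lam h τ s r σ' σ x hτ hr hσ' hσσ hσ u hu _
  have hΔ : 0 < σ - σ' := sub_pos.2 hσσ
  have hΔ1 : σ - σ' ≤ 1 := by linarith
  set A := (1 + τ⁻¹) / (σ - σ') ^ 2 with hA
  have hA0 : 0 < A := by positivity
  obtain ⟨b, hb⟩ : ∃ y : ℝ, y = m * (A / r ^ 2) := ⟨_, rfl⟩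
  have hb0 : 0 < b := by rw [hb]; positivity
  obtain ⟨hS0, hSt⟩ := h.sobolevConst_pos_lt_top hd hp hq hpq hdq x hr
  set S := (sobolevConst lam Lam p q (Metric.ball x r)).toReal with hS
  have hSpos : 0 < S := ENNReal.toReal_pos hS0.ne' hSt.ne
  have hSeq : sobolevConst lam Lam p q (Metric.ball x r) = ENNReal.ofReal S :=
    (ENNReal.ofReal_toReal hSt.ne).symm
  obtain ⟨V, hV⟩ : ∃ y : ℝ, y = r ^ d * v := ⟨_, rfl⟩
  have hV0 : 0 < V := by rw [hV]; positivity
  obtain ⟨N, hN⟩ : ∃ y : ℝ, y = c₀ * (V ^ (2 / d - θ) * S) := ⟨_, rfl⟩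
  have hN0 : 0 < N := by rw [hN]; positivity
  -- Chosen so that the level `k = c Z^(1/2)` gives equality in the smallness condition, by
  -- `threshold_eq`.
  obtain ⟨c, hc⟩ : ∃ y : ℝ, y = (4 * b * (N * (2 * b) / ε) ^ θ⁻¹) ^ (1 / 2 : ℝ) := ⟨_, rfl⟩
  have hcpos : 0 < c := by rw [hc]; positivity
  have hCN : C * eLpNorm (fun z => (lam z)⁻¹) q (volume.restrict (Metric.ball x r)) *
      eLpNorm Lam p (volume.restrict (Metric.ball x r)) ^ (2 - nu d p q) ≤ ENNReal.ofReal N := by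
    rw [mul_assoc, sobolevConst_eq hd hp hq hpq hdq x hr, hSeq, volume_ball_eq x hr, ← hv, ← hV,
      ENNReal.ofReal_rpow_of_pos hV0, ← ENNReal.ofReal_mul (by positivity), hN,
      ENNReal.ofReal_mul hc0.le]
    gcongr
    rw [← ENNReal.ofReal_coe_nnreal]
    exact ENNReal.ofReal_le_ofReal (by rw [hc₀]; linarith)
  have hr2 : 0 < τ * r ^ 2 := by positivity
  have hσ'0 : 0 < σ' := by linarith
  have hσ0 : 0 < σ := hσ'0.trans hσσ
  have hσr : σ * τ * r ^ 2 ≤ τ * r ^ 2 := by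
    rw [mul_assoc]; exact mul_le_of_le_one_left hr2.le hσ
  have hσr' : σ' * τ * r ^ 2 < σ * τ * r ^ 2 := by gcongr
  have hσr0 : 0 < σ * τ * r ^ 2 := by positivity
  have hT0 : s - τ * r ^ 2 ≤ s - σ * τ * r ^ 2 := by linarith only [hσr]
  have hT1 : s - σ * τ * r ^ 2 < s - σ' * τ * r ^ 2 := by linarith only [hσr']
  have hT2 : s - σ * τ * r ^ 2 < s := by linarith only [hσr0]
  have hR0 : σ * r ≤ r := mul_le_of_le_one_left hr.le hσ
  have hble : 4 * (2 / (s - σ' * τ * r ^ 2 - (s - σ * τ * r ^ 2)) + M / (σ * r - σ' * r) ^ 2) ≤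
      b := by
    rw [hb, hm, hA]
    exact cylinder_gap_le hτ hr hΔ hΔ1 hM0
  have hsup : cylinderSup (Ioo (s - σ' * τ * r ^ 2) s) (Metric.ball x (σ' * r)) u ≤
      ENNReal.ofReal c * (∫⁻ t in Ioo (s - σ * τ * r ^ 2) s, ∫⁻ z in Metric.ball x (σ * r),
        ENNReal.ofReal (u t z ^ 2 * Lam z)) ^ (1 / 2 : ℝ) := by
    refine le_mul_rpow_of_forall_lt hcpos fun Z hZ hYZ => ?_
    have hbound := hC h hu (R₀ := σ * r) (R₁ := σ' * r) (Z := Z) (N := N)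
      (k := c * Z ^ (1 / 2 : ℝ)) (by positivity) (by gcongr) hR0 hT0 hT1 hZ.le hN0.le
      (by positivity) hCN ((lintegral_excess_le h (by omega) hu (Ioo_subset_Ioo_left hT0)
        measurableSet_Ioo x (σ * r)).trans hYZ) hble
      (by rw [hc]; exact (threshold_eq hθ0 hN0 hb0 hε0 hZ).le)
    refine iSup₂_le fun t ht => essSup_le_of_ae_le _ ?_
    filter_upwards [hbound t ht] with z hz using ENNReal.ofReal_le_ofReal hz
  refine hsup.trans ((mul_le_mul' le_rfl (lintegral_rpow_le_avgNormTwo (L := τ * r ^ 2 * V) hT2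
    (mul_pos hσ0 hr) ?_)).trans_eq ?_)
  · rw [Real.volume_Ioo, ENNReal.ofReal_mul hr2.le, hV, hv, ← volume_ball_eq x hr]
    refine mul_le_mul' (ENNReal.ofReal_le_ofReal (by linarith only [hσr]))
      (measure_mono (Metric.ball_subset_ball hR0))
  · have hVlog : Real.log V = d * Real.log r + Real.log v := by
      rw [hV, Real.log_mul (by positivity) (by positivity), Real.log_pow]
    have hfin := constant_eq hθ0 hε0 hm0 hc0 hv0 hSpos hA0 hr hτ hd0 hVlog hV0 hN hb
    rw [← mul_assoc, ENNReal.ofReal_rpow_of_pos (by positivity), ← ENNReal.ofReal_mul hcpos.le, hc,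
      hfin, hSeq, ENNReal.ofReal_rpow_of_pos hSpos, ← ENNReal.ofReal_mul (by positivity),
      ← ENNReal.ofReal_mul (by positivity), ← ENNReal.ofReal_mul (by positivity)]
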